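/- Let $\mathbb F_q$ be a finite field with $q$ elements, $A=\mathbb F_q[\theta]$, $k=\mathbb F_q(\theta)$ with a fixed algebraic closure $\overline k$, and $|f/g|_\infty=q^{\deg f-\deg g}$, $|0|_\infty=0$ on $k$. For an $A$-algebra $L$ let $C:A\to \operatorname{End}_{\mathbb F_q}(L)$ be the Carlitz module, i.e. the $\mathbb F_q$-algebra homomorphism with $C_\theta(z)=\theta z+z^q$. Let $v\in A$ be monic irreducible of degree $d$ and let $\mathfrak n\in A$ be monic and relatively prime to $v$. Let $\Lambda_{\mathfrak n}=\{\lambda\in\overline k: C_{\mathfrak n}(\lambda)=0\}$, let $K_{\mathfrak n}=k(\Lambda_{\mathfrak n})$, and let $\mathcal O_{\mathfrak n}$ be the integral closure of $A$ in $K_{\mathfrak n}$. Let $\mathfrak P_{\mathfrak n}$ be any prime of $\mathcal O_{\mathfrak n}$ above $v$, let $\ell$ be its residue degree over $v$, put $\mathbb F_{\mathfrak P}=\mathcal O_{\mathfrak n}/\mathfrak P_{\mathfrak n}$, and let $\psi:\mathbb F_{\mathfrak P}\to\mathbb F_{q^{d\ell}}\subseteq\overline k$ be any $\mathbb F_q$-algebra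 isomorphism. Let $\omega$ be the inverse of the reduction map from $\Lambda_{\mathfrak n}$ to the $\mathfrak n$-torsion of the Carlitz module over $\mathbb F_{\mathfrak P}$. Let $K_{\mathfrak n,d\ell}=K_{\mathfrak n}\cdot k\mathbb F_{q^{d\ell}}$, let $\mathcal O_{\mathfrak n,d\ell}$ be the integral closure of $A$ in it, and for $x\in\mathfrak n^{-1}A$ put $$\mathcal G^{\rm geo}_x=1+\sum_{z\in\mathbb F_{\mathfrak P}^\times}\omega\bigl(C_{x(v^\ell-1)}(z^{-1})\bigr)\,\psi(z)\in K_{\mathfrak n,d\ell}.$$ For $a\in A$ relatively prime to $\mathfrak n$ let $\rho_a\in\operatorname{Gal}(K_{\mathfrak n}/k)$ be the automorphism with $\rho_a(\lambda)=C_a(\lambda)$ for all $\lambda\in\Lambda_{\mathfrak n}$, and for $s\ge 0$ let $\sigma_{a,s}\in\operatorname{Gal}(K_{\mathfrak n,d\ell}/k)$ be the automorphism that restricts to $\rho_a$ on $K_{\mathfrak n}$ and to $c\mapsto c^{q^s}$ on $\mathbb F_{q^{d\ell}}$; put $\tau_q=\sigma_{1,1}$ and $G^{\rm geo}_\ell(x)=\prod_{s=0}^{d\ell-1}\tau_q^s(\mathcal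 G^{\rm geo}_x)$. Let $\mathfrak P_{\mathfrak n,d\ell}\subseteq\mathcal O_{\mathfrak n,d\ell}$ be the ideal corresponding to the kernel of $\mathbb F_{q^{d\ell}}\otimes_{\mathbb F_q}\mathcal O_{\mathfrak n}\to\mathbb F_{q^{d\ell}}$, $\epsilon\otimes\alpha\mapsto\epsilon\,\psi(\overline\alpha)$, under the canonical isomorphism $\mathbb F_{q^{d\ell}}\otimes_{\mathbb F_q}\mathcal O_{\mathfrak n}\simeq\mathcal O_{\mathfrak n,d\ell}$. For an ideal $I$ and an element $\eta=\sum_\sigma m_\sigma\sigma$ of the integral group ring of the Galois group write $I^\eta=\prod_\sigma\sigma(I)^{m_\sigma}$. Finally put $$\eta_{\mathfrak n,d\ell}=\sum_a\sigma_{a,\deg a}^{-1}\in\mathbb Z[\operatorname{Gal}(K_{\mathfrak n,d\ell}/k)],\qquad \eta_{\mathfrak n}=\sum_a\rho_a^{-1}\in\mathbb Z[\operatorname{Gal}(K_{\mathfrak n}/k)],$$ both sums over the monic $a\in A$ with $\deg a<\deg\mathfrak n$ and $(a,\mathfrak n)=1$. **Theorem.** Let $x\in k$ with $0<|x|_\infty<1$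 be of the form $x=a_0/\mathfrak n$ with $a_0\in A$, $\deg a_0<\deg\mathfrak n$ and $(a_0,\mathfrak n)=1$. Then $\mathfrak P_{\mathfrak n,d\ell}$ is a prime ideal lying above $\mathfrak P_{\mathfrak n}$, and $$\mathcal G^{\rm geo}_x\cdot\mathcal O_{\mathfrak n,d\ell}=\mathfrak P_{\mathfrak n,d\ell}^{\,\sigma_{a_0,\deg\mathfrak n}\cdot\eta_{\mathfrak n,d\ell}}.$$ Consequently, $G^{\rm geo}_\ell(x)$ lies in $K_{\mathfrak n}$ and $$G^{\rm geo}_\ell(x)\cdot\mathcal O_{\mathfrak n}=\mathfrak P_{\mathfrak n}^{\,\rho_{a_0}\cdot\eta_{\mathfrak n}}.$$ -/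

import Mathlib

open Polynomial
open scoped Pointwise nonZeroDivisors TensorProduct

noncomputable section

namespace GeometricGauss

open Classical in
/-- The absolute value at infinity on `k = F(θ)`: `|0| = 0` and `|f / g| = q ^ (deg f - deg g)`. -/
def inftyAbs (F : Type*) [Field F] [Fintype F] (x : RatFunc F) : ℝ :=
  if x = 0 then 0 else (Fintype.card F : ℝ) ^ x.intDegree

/-! ### The Carlitz module -/

section Carlitz

variable (F : Type*) [Field F] [Fintype F]
variable (L : Type*) [CommRing L] [Algebra F L] [Algebra F[X] L]

/-- The operator `C_θ = θ + τ` on an `F[θ]`-algebra `L`, where `F` is the finite field with `q`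
elements and `τ` is the `q`-th power map: `C_θ(z) = θ z + z ^ q`. -/
def carlitzTheta : L →ₗ[F] L :=
  LinearMap.mulLeft F (algebraMap F[X] L X) + (FiniteField.frobeniusAlgHom F L).toLinearMap

/-- The Carlitz module `a ↦ C_a` over `L`: the homomorphism of `F`-algebras from `F[θ]` to the
`F`-linear endomorphisms of `L` that sends `θ` to `C_θ`. -/
def carlitz : F[X] →ₐ[F] Module.End F L :=
  aeval (carlitzTheta F L)

/-- The `n`-torsion of the Carlitz module over `L`. -/
def torsion (n : F[X]) : Set L := {z | carlitz F L n z = 0}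

end Carlitz

/-! ### Fields and rings of integers -/

section Fields

variable (F : Type*) [Field F] [Fintype F]

/-- The algebraic closure of the rational function field `k = F(θ)`. -/
abbrev kbar : Type _ := AlgebraicClosure (RatFunc F)

/-- The cyclotomic function field `K_n = k(Λ_n)`. -/
def cycField (n : F[X]) : IntermediateField (RatFunc F) (kbar F) :=
  IntermediateField.adjoin (RatFunc F) (torsion F (kbar F) n)

/-- The finite field with `q ^ m` elements inside the algebraic closure of `k`, for `m ≥ 1`:
the subfield generated over `F` by the roots of `X ^ (q ^ m) - X`. -/
def constField (m : ℕ) : IntermediateField F (kbar F) :=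
  IntermediateField.adjoin F ((X ^ (Fintype.card F ^ m) - X : F[X]).rootSet (kbar F))

/-- The compositum `K_{n,m}` of `K_n` and the constant field extension of `k` of degree `m`. -/
def compField (n : F[X]) (m : ℕ) : IntermediateField (RatFunc F) (kbar F) :=
  cycField F n ⊔ IntermediateField.adjoin (RatFunc F) (constField F m : Set (kbar F))

variable {F}

instance isScalarTower_intermediateField (K : IntermediateField (RatFunc F) (kbar F)) :
    IsScalarTower F F[X] K :=
  IsScalarTower.of_algebraMap_eq fun r =>
    Subtype.ext (IsScalarTower.algebraMap_apply F F[X] (kbar F) r)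

/-- The integral closure of `A = F[θ]` in an intermediate field of `k` and its algebraic
closure. -/
abbrev integers (K : IntermediateField (RatFunc F) (kbar F)) : Subalgebra F[X] K :=
  integralClosure F[X] K

instance isFractionRing_integers (K : IntermediateField (RatFunc F) (kbar F)) :
    IsFractionRing (integers K) K :=
  have : Algebra.IsAlgebraic F[X] K :=
    (IsFractionRing.comap_isAlgebraic_iff (K := RatFunc F)).mpr inferInstance
  IsIntegralClosure.isFractionRing_of_algebraic F[X] (integers K) fun x hx => by
    rw [IsScalarTower.algebraMap_apply F[X] (RatFunc F) K] at hx
    simpa using hx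

theorem cycField_le_compField (n : F[X]) (m : ℕ) : cycField F n ≤ compField F n m :=
  le_sup_left

theorem mem_compField_of_mem_constField (n : F[X]) (m : ℕ) {c : kbar F}
    (hc : c ∈ constField F m) : c ∈ compField F n m :=
  (le_sup_right : _ ≤ compField F n m) (IntermediateField.subset_adjoin _ _ hc)

theorem isIntegral_of_mem_constField (m : ℕ) {c : kbar F} (hc : c ∈ constField F m) :
    IsIntegral F c := by
  have h : Algebra.IsAlgebraic F (constField F m) := by
    refine IntermediateField.isAlgebraic_adjoin fun x hx => ?_
    obtain ⟨hp, hx⟩ := mem_rootSet.mp hx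
    exact IsAlgebraic.isIntegral ⟨_, hp, hx⟩
  have h2 := (h.isAlgebraic ⟨c, hc⟩).isIntegral
  exact h2.map (constField F m).val

/-- The inclusion of the ring of integers of `K_n` in that of `K_{n,m}`. -/
def integersIncl (n : F[X]) (m : ℕ) :
    integers (cycField F n) →ₐ[F[X]] integers (compField F n m) :=
  ((IntermediateField.inclusion (cycField_le_compField n m)).restrictScalars F[X]).mapIntegralClosure

/-- The inclusion of the constant field in the ring of integers of `K_{n,m}`. -/
def constIncl (n : F[X]) (m : ℕ) :
    constField F m →ₐ[F] integers (compField F n m) where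
  toFun c := ⟨⟨c, mem_compField_of_mem_constField n m c.2⟩, by
    have h := (isIntegral_of_mem_constField m c.2).tower_top (A := F[X])
    exact (isIntegral_algHom_iff ((compField F n m).val.restrictScalars F[X])
      (compField F n m).val.injective).mp h⟩
  map_one' := rfl
  map_mul' _ _ := rfl
  map_zero' := rfl
  map_add' _ _ := rfl
  commutes' r := by
    apply Subtype.ext
    apply Subtype.ext
    rfl

end Fields

/-! ### Galois groups and group rings -/

section Galois

variable {F : Type*} [Field F] [Fintype F]

open Classical in
/-- The element `ρ_a` of `Gal(K_n/k)`, for `a` prime to `n`: the automorphism that acts on the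
`n`-torsion of the Carlitz module as `C_a`. -/
def rho (n a : F[X]) : Gal(cycField F n/RatFunc F) :=
  if h : ∃ σ : Gal(cycField F n/RatFunc F),
      ∀ z : cycField F n, z ∈ torsion F (cycField F n) n →
        σ z = carlitz F (cycField F n) a z
  then h.choose else 1

open Classical in
/-- The element `σ_{a,s}` of `Gal(K_{n,m}/k)`, for `a` prime to `n`: the automorphism that acts on
the `n`-torsion of the Carlitz module as `C_a`, hence restricts to `ρ_a` on `K_n`, and acts on the
field of constants as the `s`-th power of the `q`-Frobenius. -/
def sigma (n : F[X]) (m : ℕ) (a : F[X]) (s : ℕ) : Gal(compField F n m/RatFunc F) :=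
  if h : ∃ σ : Gal(compField F n m/RatFunc F),
      (∀ z : compField F n m, z ∈ torsion F (compField F n m) n →
        σ z = carlitz F (compField F n m) a z) ∧
      (∀ c : compField F n m, (c : kbar F) ∈ constField F m → σ c = c ^ (Fintype.card F ^ s))
  then h.choose else 1

/-- The power `I ^ η = ∏ σ, σ(I) ^ (η σ)` of an ideal `I` by an element `η` of the integral group
ring, as a fractional ideal. -/
def idealPow {K : IntermediateField (RatFunc F) (kbar F)} (I : Ideal (integers K))
    (η : MonoidAlgebra ℤ Gal(K/RatFunc F)) : FractionalIdeal (integers K)⁰ K :=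
  η.coeff.prod fun σ e =>
    ((σ • I : Ideal (integers K)) : FractionalIdeal (integers K)⁰ K) ^ e.toNat /
      ((σ • I : Ideal (integers K)) : FractionalIdeal (integers K)⁰ K) ^ (-e).toNat

theorem finite_degree_lt (n : F[X]) : {a : F[X] | a.degree < n.degree}.Finite := by
  have h : Finite (degreeLT F n.natDegree) :=
    Finite.of_equiv _ (degreeLTEquiv F n.natDegree).symm.toEquiv
  refine (Set.toFinite (degreeLT F n.natDegree : Set F[X])).subset fun a ha => ?_
  exact mem_degreeLT.mpr (lt_of_lt_of_le ha degree_le_natDegree)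

variable (F) in
/-- The finite set of monic `a` with `deg a < deg n` and `a` prime to `n`. -/
def monicCoprime (n : F[X]) : Finset F[X] :=
  Set.Finite.toFinset (s := {a : F[X] | a.Monic ∧ a.degree < n.degree ∧ IsCoprime a n})
    ((finite_degree_lt n).subset fun _ h => h.2.1)

/-- The element `η_n = ∑ ρ_a⁻¹` of `ℤ[Gal(K_n/k)]`. -/
def etaCyc (n : F[X]) : MonoidAlgebra ℤ Gal(cycField F n/RatFunc F) :=
  ∑ a ∈ monicCoprime F n, MonoidAlgebra.single (rho n a)⁻¹ 1

/-- The element `η_{n,m} = ∑ σ_{a, deg a}⁻¹` of `ℤ[Gal(K_{n,m}/k)]`. -/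
def etaComp (n : F[X]) (m : ℕ) : MonoidAlgebra ℤ Gal(compField F n m/RatFunc F) :=
  ∑ a ∈ monicCoprime F n, MonoidAlgebra.single (sigma n m a a.natDegree)⁻¹ 1

end Galois

/-! ### Geometric Gauss sums -/

section GaussSum

variable {F : Type*} [Field F] [Fintype F] {n : F[X]}

/-- The geometric Teichmüller character, that is, the inverse of the reduction map from the
`n`-torsion of the Carlitz module in the ring of integers of `K_n` to the `n`-torsion of the
Carlitz module over the residue field of `P`. -/
def teichmuller (P : Ideal (integers (cycField F n))) :
    integers (cycField F n) ⧸ P → integers (cycField F n) :=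
  Function.invFunOn (Ideal.Quotient.mk P) (torsion F (integers (cycField F n)) n)

/-- The geometric Gauss sum
`1 + ∑ ω(C_{x (v ^ l - 1)}(z⁻¹)) ψ(z)`, the sum over the nonzero elements `z` of the (finite)
residue field of `P`, for `x ∈ n⁻¹ A`, where `l` is the residue degree of `P` over `v`. As
`x (v ^ l - 1)` lies in `A`, it is equal to its numerator. -/
def gaussSum (P : Ideal (integers (cycField F n))) (v : F[X]) (l : ℕ)
    (ψ : (integers (cycField F n) ⧸ P) ≃ₐ[F] constField F (v.natDegree * l)) (x : RatFunc F) :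
    compField F n (v.natDegree * l) :=
  1 + ∑ᶠ z : (integers (cycField F n) ⧸ P)ˣ,
    (integersIncl n (v.natDegree * l) (teichmuller P (carlitz F (integers (cycField F n) ⧸ P)
      (x * algebraMap F[X] (RatFunc F) (v ^ l - 1)).num
      (↑z⁻¹ : integers (cycField F n) ⧸ P))) : compField F n (v.natDegree * l)) *
    (constIncl n (v.natDegree * l) (ψ z) : compField F n (v.natDegree * l))

/-- The monomial `∏ (0 ≤ s < m) τ_q ^ s (G)`, where `τ_q = σ_{1,1}` is the `q`-Frobenius on the
constants, extended to `K_{n,m}` by the identity on `K_n`. -/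
def frobMonomial {m : ℕ} (G : compField F n m) : compField F n m :=
  ∏ s ∈ Finset.range m, (sigma n m 1 1 ^ s) G

/-- The homomorphism `ε ⊗ α ↦ ε ψ(α mod P)` from `F_{q ^ m} ⊗ O_n` to `F_{q ^ m}`. -/
def tensorResidue {m : ℕ} (P : Ideal (integers (cycField F n)))
    (ψ : (integers (cycField F n) ⧸ P) ≃ₐ[F] constField F m) :
    constField F m ⊗[F] integers (cycField F n) →ₐ[F] constField F m :=
  Algebra.TensorProduct.productMap (AlgHom.id F (constField F m))
    (ψ.toAlgHom.comp (Ideal.Quotient.mkₐ F P))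

/-- The canonical map `ε ⊗ α ↦ ε α` from `F_{q ^ m} ⊗ O_n` to `O_{n,m}`. -/
def tensorIntegers (n : F[X]) (m : ℕ) :
    constField F m ⊗[F] integers (cycField F n) →ₐ[F] integers (compField F n m) :=
  Algebra.TensorProduct.productMap (constIncl n m) ((integersIncl n m).restrictScalars F)

/-- The prime of `K_{n,m}` above `P` attached to `ψ`: the kernel of `ε ⊗ α ↦ ε ψ(α mod P)`,
transported to `O_{n,m}` by the canonical map `F_{q ^ m} ⊗ O_n → O_{n,m}`, which is an
isomorphism. -/
def primeAbove {m : ℕ} (P : Ideal (integers (cycField F n)))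
    (ψ : (integers (cycField F n) ⧸ P) ≃ₐ[F] constField F m) :
    Ideal (integers (compField F n m)) :=
  (RingHom.ker (tensorResidue P ψ)).map (tensorIntegers n m)

end GaussSum

end GeometricGauss

end

/-! Write q for the order of `F`, d = deg v, m = d * l, J = `primeAbove P ψ`, and G(c, s) for
`gaussConj P ψ c s`, that is 1 + ∑ ω(C_c(z⁻¹)) ψ(z) ^ (q ^ s), where s matters only mod m. Modulo v
the operator C_v is the q ^ d-power map, so C_(v ^ l - 1) kills the residue field of P; hence v ^ l
- 1 = n * c with c monic of degree m - deg n. The Galois group acts by σ_(a,t) G(c, s) = G(a * c, s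
+ t) (`sigma_smul_gaussConj`). So the Gauss sum, which is G(a₀ * c, 0), is the image under σ_(a₀,
deg n) of G₀ = G(c, m - deg n), and it is enough to show that (G₀) is the product of the ideals
σ_(a, deg a)⁻¹ J over the set S of monic a prime to n with deg a < deg n.

The product divides (G₀). A torsion point of level n is fixed by C_(v ^ l), and each application of
C_v raises the order at J by one. So ω(C_c(z)) may be replaced by C_(v ^ l * c)(z) modulo J ^ (l +
1), and orthogonality of the maps z ↦ z ^ (q ^ i) extracts coefficients: G(c, s) ≡ 1 - [v ^ l * c,
s] - [v ^ l * c, s + m] when deg (v ^ l * c) < 2 * m (`gauss_sum_congr`). For σ_(a, deg a) G₀ = G(a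
* c, deg (a * c)) the last coefficient is the leading one and cancels the 1, and the other is
divisible by a known power of v (`pow_dvd_carlitzCoeff_pow_mul`). On the other side, the primes
belonging to a and to b, with deg b ≤ deg a, agree only if a = b * v ^ i (`eq_mul_pow_of_smul_eq`).
So a prime occurs in the product at most as often as that power of v allows, when b is taken of
least degree (`prod_smul_dvd_span`).

Equality follows by comparing norms to F[θ]. At infinity torsion points have size at most |θ| ^ (1 /
(q - 1)) and constants have size at most 1, so the norm of G₀ has degree at most |Gal| / (q - 1),
which is at most m * |S| (`natDegree_le_of_prod_smul_gaussConj`). The norm of the product has degree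
exactly m * |S|. Hence the cofactor has norm 1 (`span_eq_of_dvd`). Only upper bounds enter: neither
the exact order of the Galois group nor an exact valuation of G₀ is computed beforehand.

Descent to K_n rests on the identity y = -∑ z⁻¹ Tr(z y) over the nonzero constants z. It gives
O_(n,m) = F_(q ^ m) ⊗ O_n (`tensorIntegers_bijective`), the decomposition of P as the product of the
τ_q ^ s J (`map_inclHom_eq_prod`), and the fact that an ideal of O_n is recovered from its extension
(`comap_map_inclHom`). The product of the τ_q-conjugates of the Gauss sum is fixed by τ_q, so it
lies in K_n, and its ideal can be compared after extension. -/

noncomputable section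

namespace GeometricGauss

set_option maxHeartbeats 800000
set_option synthInstance.maxHeartbeats 60000

/-! ### Coefficients of `C_a` and their divisibility by `v` -/

section CarlitzCoeff

variable (F : Type*) [Field F] [Fintype F]

/-- Left multiplication by `θ + τ` on the twisted polynomials `∑ u_i τ ^ i` over `F[θ]`, which are
represented by the polynomials `∑ u_i X ^ i`. -/
def twistTheta : Module.End F F[X][X] :=
  LinearMap.mulLeft F (C X) +
    LinearMap.mulLeft F X ∘ₗ (mapAlgHom (FiniteField.frobeniusAlgHom F F[X])).toLinearMap

variable {F}

/-- The coefficients of `C_a = ∑ [a, i] τ ^ i`. -/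
def carlitzCoeff (a : F[X]) (i : ℕ) : F[X] := (aeval (twistTheta F) a 1).coeff i

theorem twistTheta_coeff_zero (u : F[X][X]) : (twistTheta F u).coeff 0 = X * u.coeff 0 := by
  simp [twistTheta]

theorem twistTheta_coeff_succ (u : F[X][X]) (i : ℕ) :
    (twistTheta F u).coeff (i + 1) = X * u.coeff (i + 1) + u.coeff i ^ Fintype.card F := by
  simp [twistTheta]

theorem aeval_twistTheta_X_mul (a : F[X]) (u : F[X][X]) :
    aeval (twistTheta F) (X * a) u = twistTheta F (aeval (twistTheta F) a u) := by
  rw [map_mul, aeval_X, Module.End.mul_apply]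

/-- The multiplication rule τ ^ j * u = u ^ (q ^ j) * τ ^ j of twisted polynomials. The right factor
stays arbitrary, so that induction on `a` only peels factors θ off the left. -/
theorem aeval_twistTheta_coeff (a : F[X]) (u : F[X][X]) (i : ℕ) :
    (aeval (twistTheta F) a u).coeff i =
      ∑ j ∈ Finset.range (i + 1), carlitzCoeff a j * u.coeff (i - j) ^ Fintype.card F ^ j := by
  induction a using Polynomial.induction_on generalizing i with
  | C c =>
    rw [Finset.sum_range_succ', Finset.sum_eq_zero]
    · simp [carlitzCoeff, Module.algebraMap_end_apply]
    · intro j _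
      simp [carlitzCoeff, Module.algebraMap_end_apply, coeff_one]
  | add a b ha hb =>
    simp only [map_add, LinearMap.add_apply, coeff_add, ha, hb, carlitzCoeff, add_mul,
      Finset.sum_add_distrib]
  | monomial k c ih =>
    have e : C c * X ^ (k + 1) = X * (C c * X ^ k) := by ring
    rw [e, aeval_twistTheta_X_mul]
    have h0 : carlitzCoeff (X * (C c * X ^ k)) 0 = X * carlitzCoeff (C c * X ^ k) 0 := by
      rw [carlitzCoeff, aeval_twistTheta_X_mul, twistTheta_coeff_zero, carlitzCoeff]
    have h1 (j : ℕ) : carlitzCoeff (X * (C c * X ^ k)) (j + 1) =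
        X * carlitzCoeff (C c * X ^ k) (j + 1) + carlitzCoeff (C c * X ^ k) j ^ Fintype.card F := by
      rw [carlitzCoeff, aeval_twistTheta_X_mul, twistTheta_coeff_succ, carlitzCoeff, carlitzCoeff]
    cases i with
    | zero =>
      rw [twistTheta_coeff_zero, ih]
      simp [h0, mul_assoc]
    | succ i =>
      have hf (f : ℕ → F[X]) (t : Finset ℕ) :
          (∑ j ∈ t, f j) ^ Fintype.card F = ∑ j ∈ t, f j ^ Fintype.card F :=
        map_sum (FiniteField.frobeniusAlgHom F F[X]) f t
      rw [twistTheta_coeff_succ, ih, ih, Finset.sum_range_succ', Finset.sum_range_succ' _ (i + 1),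
        hf, h0]
      simp only [h1, add_mul, Finset.sum_add_distrib, mul_add, Finset.mul_sum]
      simp only [Nat.reduceSubDiff, mul_assoc, mul_pow, ← pow_mul, ← pow_succ]
      ring

theorem carlitzCoeff_mul (a b : F[X]) (i : ℕ) :
    carlitzCoeff (a * b) i = ∑ j ∈ Finset.range (i + 1),
      carlitzCoeff a j * carlitzCoeff b (i - j) ^ Fintype.card F ^ j := by
  rw [carlitzCoeff, map_mul, Module.End.mul_apply, aeval_twistTheta_coeff]
  rfl

theorem carlitzCoeff_add (a b : F[X]) (i : ℕ) :
    carlitzCoeff (a + b) i = carlitzCoeff a i + carlitzCoeff b i := by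
  simp [carlitzCoeff]

theorem carlitzCoeff_X_mul_succ (a : F[X]) (i : ℕ) :
    carlitzCoeff (X * a) (i + 1) = X * carlitzCoeff a (i + 1) + carlitzCoeff a i ^ Fintype.card F := by
  rw [carlitzCoeff, aeval_twistTheta_X_mul, twistTheta_coeff_succ, carlitzCoeff, carlitzCoeff]

theorem carlitzCoeff_X_mul_zero (a : F[X]) :
    carlitzCoeff (X * a) 0 = X * carlitzCoeff a 0 := by
  rw [carlitzCoeff, aeval_twistTheta_X_mul, twistTheta_coeff_zero, carlitzCoeff]

theorem carlitzCoeff_C (c : F) (i : ℕ) : carlitzCoeff (C c) i = if i = 0 then C c else 0 := by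
  simp only [carlitzCoeff, aeval_C, Module.algebraMap_end_apply, coeff_smul, coeff_one, smul_ite,
    smul_zero]
  simp [smul_eq_C_mul]

theorem carlitzCoeff_zero (a : F[X]) : carlitzCoeff a 0 = a := by
  induction a using Polynomial.induction_on with
  | C c => simp [carlitzCoeff_C]
  | add a b ha hb => rw [carlitzCoeff_add, ha, hb]
  | monomial k c ih =>
    have e : C c * X ^ (k + 1) = X * (C c * X ^ k) := by ring
    rw [e, carlitzCoeff_X_mul_zero, ih]

theorem carlitzCoeff_X_pow (k : ℕ) :
    (∀ i, k < i → carlitzCoeff (X ^ k : F[X]) i = 0) ∧ carlitzCoeff (X ^ k : F[X]) k = 1 := by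
  induction k with
  | zero =>
    rw [pow_zero, ← C_1]
    refine ⟨fun i hi => ?_, ?_⟩
    · rw [carlitzCoeff_C, if_neg (by lia)]
    · rw [carlitzCoeff_C, if_pos rfl]
  | succ k ih =>
    rw [pow_succ']
    refine ⟨fun i hi => ?_, ?_⟩
    · obtain ⟨i, rfl⟩ : ∃ j, i = j + 1 := ⟨i - 1, by lia⟩
      rw [carlitzCoeff_X_mul_succ, ih.1 _ (by lia), ih.1 _ (by lia), mul_zero,
        zero_pow Fintype.card_ne_zero, add_zero]
    · rw [carlitzCoeff_X_mul_succ, ih.1 _ (by lia), ih.2, mul_zero, one_pow, zero_add]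

theorem carlitzCoeff_eq_sum (a : F[X]) (i : ℕ) : carlitzCoeff a i =
    ∑ k ∈ Finset.range (a.natDegree + 1), a.coeff k • carlitzCoeff (X ^ k) i := by
  rw [carlitzCoeff, aeval_eq_sum_range]
  simp [carlitzCoeff, finsetSum_coeff]

theorem carlitzCoeff_of_natDegree_lt {a : F[X]} {i : ℕ} (h : a.natDegree < i) :
    carlitzCoeff a i = 0 := by
  rw [carlitzCoeff_eq_sum]
  refine Finset.sum_eq_zero fun k hk => ?_
  rw [(carlitzCoeff_X_pow k).1 i (by simp at hk; lia), smul_zero]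

theorem carlitzCoeff_natDegree (a : F[X]) : carlitzCoeff a a.natDegree = C a.leadingCoeff := by
  rw [carlitzCoeff_eq_sum, Finset.sum_range_succ, Finset.sum_eq_zero, zero_add,
    (carlitzCoeff_X_pow _).2, smul_eq_C_mul, mul_one, leadingCoeff]
  intro k hk
  rw [(carlitzCoeff_X_pow k).1 _ (by simpa using hk), smul_zero]

/-- Expands C_a ∘ C_θ, whereas `carlitzCoeff_X_mul_succ` expands C_θ ∘ C_a. Since both operators are
the same, equating them yields a recursion between consecutive coefficients. -/
theorem carlitzCoeff_mul_X_succ (a : F[X]) (i : ℕ) : carlitzCoeff (a * X) (i + 1) =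
    carlitzCoeff a (i + 1) * X ^ Fintype.card F ^ (i + 1) + carlitzCoeff a i := by
  have h1 := (carlitzCoeff_X_pow (F := F) 1).2
  have h2 := (carlitzCoeff_X_pow (F := F) 1).1
  rw [pow_one] at h1 h2
  rw [carlitzCoeff_mul, Finset.sum_range_succ, Finset.sum_range_succ, Finset.sum_eq_zero, zero_add,
    add_comm]
  · simp [carlitzCoeff_zero, h1]
  · intro j hj
    rw [Finset.mem_range] at hj
    rw [h2 _ (by lia), zero_pow (pow_ne_zero _ Fintype.card_ne_zero), mul_zero]

/-- Commutation of C_v with C_θ gives [v, i + 1] * (θ ^ (q ^ (i + 1)) - θ) = [v, i] ^ q - [v, i].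
The factor on the left is prime to v as long as i + 1 < deg v, so divisibility passes from [v, 0] =
v upwards. -/
theorem dvd_carlitzCoeff {v : F[X]} (hv : Irreducible v) {i : ℕ} (hi : i < v.natDegree) :
    v ∣ carlitzCoeff v i := by
  induction i with
  | zero => rw [carlitzCoeff_zero]
  | succ i ih =>
    have e : carlitzCoeff v (i + 1) * (X ^ Fintype.card F ^ (i + 1) - X) =
        carlitzCoeff v i ^ Fintype.card F - carlitzCoeff v i := by
      have h := carlitzCoeff_mul_X_succ v i
      rw [mul_comm v X, carlitzCoeff_X_mul_succ] at h
      linear_combination -h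
    have h : v ∣ carlitzCoeff v (i + 1) * (X ^ Fintype.card F ^ (i + 1) - X) := by
      rw [e]
      exact dvd_sub ((ih (by lia)).trans (dvd_pow_self _ Fintype.card_ne_zero)) (ih (by lia))
    refine (hv.prime.dvd_or_dvd h).resolve_right fun h' => ?_
    rw [← Nat.card_eq_fintype_card] at h'
    have := Nat.le_of_dvd (by lia) (hv.natDegree_dvd_of_dvd_X_pow_card_pow_sub_X h')
    lia

/-- Peel one factor v off on the left: the terms with j < deg v gain a factor v from [v, j], and in
the terms with j ≥ deg v the index i - j has a quotient by deg v that is smaller by at least one.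
This is the source of the exponents in the factorization. -/
theorem pow_dvd_carlitzCoeff_pow_mul {v : F[X]} (hv : Irreducible v) (c : F[X]) (l i : ℕ) :
    v ^ (l - i / v.natDegree) ∣ carlitzCoeff (v ^ l * c) i := by
  have hd : 0 < v.natDegree := hv.natDegree_pos
  induction l generalizing i with
  | zero => simp
  | succ l ih =>
    rw [pow_succ', mul_assoc, carlitzCoeff_mul]
    refine Finset.dvd_sum fun j hj => ?_
    rw [Finset.mem_range] at hj
    have hq : (1 : ℕ) ≤ Fintype.card F ^ j := Nat.one_le_pow _ _ Fintype.card_pos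
    have h1 : v ^ (l - (i - j) / v.natDegree) ∣
        carlitzCoeff (v ^ l * c) (i - j) ^ Fintype.card F ^ j :=
      (ih _).trans (dvd_pow_self _ (by lia))
    rcases lt_or_ge j v.natDegree with hjd | hjd
    · refine (pow_dvd_pow v (n := 1 + (l - (i - j) / v.natDegree)) ?_).trans ?_
      · have := Nat.div_le_div_right (c := v.natDegree) (Nat.sub_le i j)
        lia
      · rw [pow_add, pow_one]
        exact mul_dvd_mul (dvd_carlitzCoeff hv hjd) h1
    · refine (pow_dvd_pow v ?_).trans (h1.trans (dvd_mul_left _ _))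
      have h2 : (i - j) / v.natDegree ≤ (i - v.natDegree) / v.natDegree :=
        Nat.div_le_div_right (by lia)
      have h3 : i / v.natDegree = (i - v.natDegree) / v.natDegree + 1 :=
        Nat.div_eq_sub_div hd (by lia)
      lia

end CarlitzCoeff

/-! ### The Carlitz action on algebras and its behaviour at an ideal above `v` -/

section CarlitzEval

variable {F : Type*} [Field F] [Fintype F]
variable {L : Type*} [CommRing L] [Algebra F L] [Algebra F[X] L]

theorem mem_torsion {n : F[X]} {z : L} : z ∈ torsion F L n ↔ carlitz F L n z = 0 := Iff.rfl

theorem carlitz_X_mul (a : F[X]) (z : L) :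
    carlitz F L (X * a) z =
      algebraMap F[X] L X * carlitz F L a z + carlitz F L a z ^ Fintype.card F := by
  rw [carlitz, map_mul, aeval_X, Module.End.mul_apply]
  simp [carlitzTheta]

theorem carlitz_C (c : F) (z : L) : carlitz F L (C c) z = algebraMap F L c * z := by
  rw [carlitz, aeval_C, Module.algebraMap_end_apply, Algebra.smul_def]

theorem carlitz_mul (a b : F[X]) (z : L) :
    carlitz F L (a * b) z = carlitz F L a (carlitz F L b z) := by
  rw [map_mul, Module.End.mul_apply]

theorem carlitz_one (z : L) : carlitz F L 1 z = z := by
  rw [map_one, Module.End.one_apply]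

theorem carlitz_add (a b : F[X]) (z : L) :
    carlitz F L (a + b) z = carlitz F L a z + carlitz F L b z := by
  rw [map_add, LinearMap.add_apply]

theorem carlitz_sub (a b : F[X]) (z : L) :
    carlitz F L (a - b) z = carlitz F L a z - carlitz F L b z := by
  rw [map_sub, LinearMap.sub_apply]

theorem carlitz_comm (a b : F[X]) (z : L) :
    carlitz F L a (carlitz F L b z) = carlitz F L b (carlitz F L a z) := by
  rw [← carlitz_mul, mul_comm, carlitz_mul]

theorem torsion_sub {n : F[X]} {x y : L} (hx : x ∈ torsion F L n) (hy : y ∈ torsion F L n) :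
    x - y ∈ torsion F L n := by
  rw [mem_torsion] at *
  rw [map_sub, hx, hy, sub_zero]

theorem carlitz_mem_torsion {n : F[X]} {x : L} (a : F[X]) (hx : x ∈ torsion F L n) :
    carlitz F L a x ∈ torsion F L n := by
  rw [mem_torsion] at *
  rw [carlitz_comm, hx, map_zero]

theorem carlitz_eq_of_dvd_sub {n a b : F[X]} (h : n ∣ a - b) {x : L} (hx : x ∈ torsion F L n) :
    carlitz F L a x = carlitz F L b x := by
  obtain ⟨c, hc⟩ := h
  rw [← sub_eq_zero, ← carlitz_sub, hc, mul_comm, carlitz_mul, hx, map_zero]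

variable [IsScalarTower F F[X] L]

theorem carlitz_map {L' : Type*} [CommRing L'] [Algebra F L'] [Algebra F[X] L']
    [IsScalarTower F F[X] L'] (φ : L →ₐ[F[X]] L') (a : F[X]) (z : L) :
    φ (carlitz F L a z) = carlitz F L' a (φ z) := by
  induction a using Polynomial.induction_on with
  | C c =>
    rw [carlitz_C, carlitz_C, map_mul, IsScalarTower.algebraMap_apply F F[X] L, φ.commutes,
      ← IsScalarTower.algebraMap_apply]
  | add a b ha hb => rw [carlitz_add, map_add, ha, hb, carlitz_add]
  | monomial k c ih =>
    have e : C c * X ^ (k + 1) = X * (C c * X ^ k) := by ring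
    rw [e, carlitz_X_mul, carlitz_X_mul, map_add, map_mul, map_pow, ih, φ.commutes]

theorem carlitz_eq_sum (a : F[X]) (z : L) {B : ℕ} (hB : a.natDegree < B) :
    carlitz F L a z = ∑ i ∈ Finset.range B,
      algebraMap F[X] L (carlitzCoeff a i) * z ^ Fintype.card F ^ i := by
  -- The degree is not controlled along the induction, since a sum may drop in degree. So only the
  -- formula for all large lengths is proved here, and the sum is cut down to length B at the end.
  have key : ∀ a : F[X], ∃ B₀, ∀ B ≥ B₀, (∀ i ≥ B, carlitzCoeff a i = 0) ∧
      carlitz F L a z = ∑ i ∈ Finset.range B,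
        algebraMap F[X] L (carlitzCoeff a i) * z ^ Fintype.card F ^ i := by
    intro a
    induction a using Polynomial.induction_on with
    | C c =>
      refine ⟨1, fun B hB => ⟨fun i hi => ?_, ?_⟩⟩
      · rw [carlitzCoeff_C, if_neg (by lia)]
      · rw [Finset.sum_eq_single 0]
        · simp [carlitzCoeff_C, carlitz_C, IsScalarTower.algebraMap_apply F F[X] L]
        · intro i _ hi
          rw [carlitzCoeff_C, if_neg hi, map_zero, zero_mul]
        · simp; lia
    | add a b ha hb =>
      obtain ⟨A, hA⟩ := ha
      obtain ⟨B, hB⟩ := hb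
      refine ⟨max A B, fun D hD => ⟨fun i hi => ?_, ?_⟩⟩
      · rw [carlitzCoeff_add, (hA D (by lia)).1 i hi, (hB D (by lia)).1 i hi, add_zero]
      · rw [carlitz_add, (hA D (by lia)).2, (hB D (by lia)).2, ← Finset.sum_add_distrib]
        simp only [carlitzCoeff_add, map_add, add_mul]
    | monomial k c ih =>
      have e : C c * X ^ (k + 1) = X * (C c * X ^ k) := by ring
      rw [e]
      obtain ⟨A, hA⟩ := ih
      refine ⟨A + 1, fun B hB => ?_⟩
      obtain ⟨B, rfl⟩ : ∃ j, B = j + 1 := ⟨B - 1, by lia⟩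
      obtain ⟨h1, h2⟩ := hA B (by lia)
      have h3 := (hA (B + 1) (by lia)).2
      refine ⟨fun i hi => ?_, ?_⟩
      · obtain ⟨i, rfl⟩ : ∃ j, i = j + 1 := ⟨i - 1, by lia⟩
        rw [carlitzCoeff_X_mul_succ, h1 _ (by lia), h1 _ (by lia), mul_zero,
          zero_pow Fintype.card_ne_zero, add_zero]
      · have hf (f : ℕ → L) (t : Finset ℕ) :
            (∑ j ∈ t, f j) ^ Fintype.card F = ∑ j ∈ t, f j ^ Fintype.card F :=
          map_sum (FiniteField.frobeniusAlgHom F L) f t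
        rw [carlitz_X_mul]
        -- The copy multiplied by θ is expanded to B + 1 terms and the copy under the q-th power to
        -- B terms, so that the two sums match after the shift of the index.
        nth_rw 1 [h3]
        rw [h2, hf, Finset.sum_range_succ', Finset.sum_range_succ', carlitzCoeff_X_mul_zero]
        simp only [carlitzCoeff_X_mul_succ, map_add, map_mul, map_pow, add_mul,
          Finset.sum_add_distrib, mul_add, Finset.mul_sum, mul_pow, ← pow_mul, ← pow_succ,
          mul_assoc]
        ring
  obtain ⟨B₀, h⟩ := key a
  rw [(h (max B₀ B) (by lia)).2]
  symm
  refine Finset.sum_subset (by simp) fun i _ hi => ?_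
  rw [carlitzCoeff_of_natDegree_lt (by simp at hi; lia), map_zero, zero_mul]

theorem carlitz_mem_ideal (I : Ideal L) (a : F[X]) {z : L} (hz : z ∈ I) : carlitz F L a z ∈ I := by
  rw [carlitz_eq_sum a z (Nat.lt_succ_self _)]
  exact I.sum_mem fun i _ =>
    I.mul_mem_left _ (I.pow_mem_of_mem hz _ (pow_pos Fintype.card_pos _))

theorem torsion_map {L' : Type*} [CommRing L'] [Algebra F L'] [Algebra F[X] L']
    [IsScalarTower F F[X] L'] (φ : L →ₐ[F[X]] L') {n : F[X]} {x : L} (hx : x ∈ torsion F L n) :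
    φ x ∈ torsion F L' n := by
  rw [mem_torsion] at *
  rw [← carlitz_map, hx, map_zero]

theorem mem_torsion_of_map {L' : Type*} [CommRing L'] [Algebra F L'] [Algebra F[X] L']
    [IsScalarTower F F[X] L'] {φ : L →ₐ[F[X]] L'} (hφ : Function.Injective φ) {n : F[X]} {x : L}
    (hx : φ x ∈ torsion F L' n) : x ∈ torsion F L n := by
  rw [mem_torsion] at *
  rwa [← carlitz_map, map_eq_zero_iff φ hφ] at hx

/-- A torsion point in an ideal that does not contain the level is zero. -/
theorem eq_zero_of_mem_torsion [IsDomain L] {n : F[X]} {I : Ideal L}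
    (hn : algebraMap F[X] L n ∉ I) {z : L} (hz : z ∈ torsion F L n) (hzI : z ∈ I) : z = 0 := by
  by_contra h0
  rw [mem_torsion, carlitz_eq_sum n z (Nat.lt_succ_self _),
    Finset.sum_range_succ', carlitzCoeff_zero, pow_zero, pow_one] at hz
  have hq : 1 < Fintype.card F := Fintype.one_lt_card
  -- Two factors z are split off: one is cancelled from the equation, the other keeps the remaining
  -- sum in `I`. Both are available because q ≥ 2.
  have hk (k : ℕ) : z ^ Fintype.card F ^ (k + 1) =
      z ^ (Fintype.card F ^ (k + 1) - 2) * z * z := by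
    have : 2 ≤ Fintype.card F ^ (k + 1) :=
      le_trans hq (Nat.le_self_pow (by lia) _)
    rw [mul_assoc, ← sq, ← pow_add]
    congr 1
    lia
  simp only [hk, ← mul_assoc] at hz
  rw [← Finset.sum_mul, ← add_mul] at hz
  have := (mul_eq_zero.mp hz).resolve_right h0
  refine hn ?_
  rw [eq_neg_of_add_eq_zero_right this]
  exact I.neg_mem (I.sum_mem fun i _ => I.mul_mem_left _ hzI)

/-- The coefficients of C_v below the leading one are divisible by v, which supplies the extra
factor from `I`; the leading term is a power z ^ (q ^ d), and its order is at least 2 * k ≥ k + 1.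
-/
theorem carlitz_mem_pow_succ {v : F[X]} (hvirr : Irreducible v)
    {I : Ideal L} (hvI : algebraMap F[X] L v ∈ I) {k : ℕ} (hk : 1 ≤ k) {z : L} (hz : z ∈ I ^ k) :
    carlitz F L v z ∈ I ^ (k + 1) := by
  have hq : 1 < Fintype.card F := Fintype.one_lt_card
  rw [carlitz_eq_sum v z (Nat.lt_succ_self _)]
  refine Ideal.sum_mem _ fun i hi => ?_
  rw [Finset.mem_range] at hi
  rcases lt_or_ge i v.natDegree with h | h
  · obtain ⟨c, hc⟩ := dvd_carlitzCoeff hvirr h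
    rw [hc, map_mul, pow_succ', mul_assoc]
    exact Ideal.mul_mem_mul hvI (Ideal.mul_mem_left _ _
      (Ideal.pow_mem_of_mem _ hz _ (pow_pos Fintype.card_pos _)))
  · refine Ideal.mul_mem_left _ _ ?_
    have h1 := Ideal.pow_mem_pow hz (Fintype.card F ^ i)
    rw [← pow_mul] at h1
    refine Ideal.pow_le_pow_right ?_ h1
    have : 2 ≤ Fintype.card F ^ i :=
      le_trans hq (Nat.le_self_pow (by have := hvirr.natDegree_pos; lia) _)
    nlinarith

theorem carlitz_pow_mem_pow_succ {v : F[X]} (hvirr : Irreducible v)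
    {I : Ideal L} (hvI : algebraMap F[X] L v ∈ I) (k : ℕ) {z : L} (hz : z ∈ I) :
    carlitz F L (v ^ k) z ∈ I ^ (k + 1) := by
  induction k with
  | zero => simpa [carlitz_one] using hz
  | succ k ih =>
    rw [pow_succ' v, carlitz_mul]
    exact carlitz_mem_pow_succ hvirr hvI (by lia) ih

/-- Modulo `v`, the operator `C_v` is the Frobenius of `F[θ] / v`. -/
theorem carlitz_sub_pow_mem {v : F[X]} (hv : v.Monic) (hvirr : Irreducible v)
    {I : Ideal L} (hvI : algebraMap F[X] L v ∈ I) (z : L) :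
    carlitz F L v z - z ^ Fintype.card F ^ v.natDegree ∈ I := by
  rw [carlitz_eq_sum v z (Nat.lt_succ_self _), Finset.sum_range_succ, carlitzCoeff_natDegree,
    hv.leadingCoeff, C_1, map_one, one_mul, add_sub_cancel_right]
  refine I.sum_mem fun i hi => ?_
  obtain ⟨c, hc⟩ := dvd_carlitzCoeff hvirr (Finset.mem_range.mp hi)
  rw [hc, map_mul, mul_assoc]
  exact I.mul_mem_right _ hvI

theorem carlitz_pow_sub_pow_mem {v : F[X]} (hv : v.Monic) (hvirr : Irreducible v)
    {I : Ideal L} (hvI : algebraMap F[X] L v ∈ I) (k : ℕ) (z : L) :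
    carlitz F L (v ^ k) z - z ^ Fintype.card F ^ (v.natDegree * k) ∈ I := by
  induction k with
  | zero => simp
  | succ k ih =>
    have h1 := carlitz_mem_ideal I v ih
    have h2 := carlitz_sub_pow_mem hv hvirr hvI (z ^ Fintype.card F ^ (v.natDegree * k))
    rw [map_sub, ← carlitz_mul, ← pow_succ'] at h1
    rw [← pow_mul, ← pow_add] at h2
    have h3 := I.add_mem h1 h2
    rwa [sub_add_sub_cancel] at h3

end CarlitzEval

/-! ### The Carlitz polynomials -/

section CarlitzPoly

variable {F : Type*} [Field F] [Fintype F]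

/-- The polynomial `C_a(X) = ∑ [a, i] X ^ (q ^ i)`. -/
def carlitzPoly (a : F[X]) : F[X][X] := carlitz F F[X][X] a X

theorem carlitzPoly_eq_sum (a : F[X]) : carlitzPoly a =
    ∑ i ∈ Finset.range (a.natDegree + 1), C (carlitzCoeff a i) * X ^ Fintype.card F ^ i :=
  carlitz_eq_sum a X (Nat.lt_succ_self _)

/-- Every exponent q ^ i with i > 0 vanishes in characteristic p, so only the linear term survives.
This makes the polynomial separable wherever `a` is nonzero. -/
theorem derivative_carlitzPoly (a : F[X]) : derivative (carlitzPoly a) = C a := by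
  rw [carlitzPoly_eq_sum, derivative_sum, Finset.sum_range_succ', Finset.sum_eq_zero]
  · simp [carlitzCoeff_zero]
  · intro i _
    have h : (Fintype.card F : F[X][X]) = 0 := by
      rw [← map_natCast (algebraMap F F[X][X]), FiniteField.cast_card_eq_zero, map_zero]
    rw [derivative_C_mul, derivative_X_pow, Nat.cast_pow, C_pow, C_eq_natCast, h,
      zero_pow (Nat.succ_ne_zero i), zero_mul, mul_zero]

theorem monic_carlitzPoly {a : F[X]} (ha : a.Monic) :
    (carlitzPoly a).Monic ∧ (carlitzPoly a).natDegree = Fintype.card F ^ a.natDegree := by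
  have hlt : (∑ i ∈ Finset.range a.natDegree,
      C (carlitzCoeff a i) * X ^ Fintype.card F ^ i : F[X][X]).degree <
      (Fintype.card F ^ a.natDegree : ℕ) := by
    refine (degree_sum_le _ _).trans_lt ?_
    rw [Finset.sup_lt_iff (by exact_mod_cast WithBot.bot_lt_coe _)]
    intro i hi
    refine (degree_C_mul_X_pow_le _ _).trans_lt ?_
    exact_mod_cast Nat.pow_lt_pow_right Fintype.one_lt_card (Finset.mem_range.mp hi)
  rw [carlitzPoly_eq_sum, Finset.sum_range_succ, carlitzCoeff_natDegree, ha.leadingCoeff, C_1, C_1,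
    one_mul, add_comm]
  refine ⟨monic_X_pow_add hlt, ?_⟩
  rw [natDegree_add_eq_left_of_degree_lt (by rwa [degree_X_pow]), natDegree_X_pow]

theorem aeval_carlitzPoly {L : Type*} [CommRing L] [Algebra F L] [Algebra F[X] L]
    [IsScalarTower F F[X] L] (a : F[X]) (z : L) : aeval z (carlitzPoly a) = carlitz F L a z := by
  rw [carlitzPoly, carlitz_map (aeval z : F[X][X] →ₐ[F[X]] L), aeval_X]

end CarlitzPoly

/-! ### Size and cyclicity of the torsion -/

section TorsionCount

variable {F : Type*} [Field F] [Fintype F]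
variable {L : Type*} [CommRing L] [IsDomain L] [Algebra F L] [Algebra F[X] L] [IsScalarTower F F[X] L]

open Classical in
theorem torsion_eq_roots {a : F[X]} (ha : a.Monic) :
    torsion F L a = ((carlitzPoly a).map (algebraMap F[X] L)).roots.toFinset := by
  ext z
  rw [Finset.mem_coe, Multiset.mem_toFinset, mem_roots ((monic_carlitzPoly ha).1.map _).ne_zero,
    IsRoot.def, eval_map_algebraMap, aeval_carlitzPoly, mem_torsion]

theorem finite_torsion {a : F[X]} (ha : a.Monic) : (torsion F L a).Finite := by
  classical
  rw [torsion_eq_roots ha]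
  exact Finset.finite_toSet _

theorem ncard_torsion_le {a : F[X]} (ha : a.Monic) :
    (torsion F L a).ncard ≤ Fintype.card F ^ a.natDegree := by
  classical
  rw [torsion_eq_roots ha, Set.ncard_coe_finset]
  refine (Multiset.toFinset_card_le _).trans ((card_roots' _).trans ?_)
  rw [(monic_carlitzPoly ha).1.natDegree_map, (monic_carlitzPoly ha).2]

theorem ncard_torsion_of_isSepClosed {L : Type*} [Field L] [IsSepClosed L] [Algebra F L]
    [Algebra F[X] L] [IsScalarTower F F[X] L] {a : F[X]} (ha : a.Monic)
    (ha0 : algebraMap F[X] L a ≠ 0) : (torsion F L a).ncard = Fintype.card F ^ a.natDegree := by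
  classical
  have hsep : ((carlitzPoly a).map (algebraMap F[X] L)).Separable := by
    rw [separable_def, derivative_map, derivative_carlitzPoly, map_C]
    exact ⟨0, C (algebraMap F[X] L a)⁻¹, by
      rw [zero_mul, zero_add, ← C_mul, inv_mul_cancel₀ ha0, C_1]⟩
  rw [torsion_eq_roots ha, Set.ncard_coe_finset, Multiset.toFinset_card_of_nodup
    (nodup_roots hsep), ← (IsSepClosed.splits_of_separable _ hsep).natDegree_eq_card_roots,
    (monic_carlitzPoly ha).1.natDegree_map, (monic_carlitzPoly ha).2]

theorem ncard_degree_lt (n : F[X]) (hn : n ≠ 0) :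
    {a : F[X] | a.degree < n.degree}.ncard = Fintype.card F ^ n.natDegree := by
  have h : {a : F[X] | a.degree < n.degree} = (degreeLT F n.natDegree : Set F[X]) := by
    ext a
    rw [SetLike.mem_coe, mem_degreeLT, degree_eq_natDegree hn]
    rfl
  rw [h, ← Nat.card_coe_set_eq]
  refine (Nat.card_congr (degreeLTEquiv F n.natDegree).toEquiv).trans ?_
  simp

/-- The torsion module, if it has as many elements as possible, has annihilator `n`. -/
theorem dvd_of_carlitz_eq_zero {n : F[X]} (hn : n.Monic)
    (hcard : (torsion F L n).ncard = Fintype.card F ^ n.natDegree) {a : F[X]}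
    (h : ∀ z ∈ torsion F L n, carlitz F L a z = 0) : n ∣ a := by
  rw [← modByMonic_eq_zero_iff_dvd hn]
  by_contra h0
  have h1 : ∀ z ∈ torsion F L n, carlitz F L (a %ₘ n) z = 0 := by
    intro z hz
    rw [← h z hz]
    exact carlitz_eq_of_dvd_sub ⟨-(a /ₘ n), by rw [modByMonic_eq_sub_mul_div]; ring⟩ hz
  set r := a %ₘ n
  -- The remainder is made monic so that the bound q ^ (deg r) on its torsion applies. It would have
  -- to annihilate all q ^ (deg n) points of level n, which is too many.
  set r' := C r.leadingCoeff⁻¹ * r with hr'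
  have hm : r'.Monic := by
    rw [hr', mul_comm]
    exact monic_mul_leadingCoeff_inv h0
  have hdeg : r'.natDegree < n.natDegree := by
    have h2 : r'.natDegree ≤ r.natDegree := natDegree_C_mul_le _ _
    refine h2.trans_lt (natDegree_modByMonic_lt a hn ?_)
    rintro rfl
    simp [r] at h0
  have hsub : torsion F L n ⊆ torsion F L r' := by
    intro z hz
    rw [mem_torsion, carlitz_mul, h1 z hz, map_zero]
  have := (Set.ncard_le_ncard hsub (finite_torsion hm)).trans (ncard_torsion_le hm)
  rw [hcard] at this
  exact absurd this (not_le.mpr (Nat.pow_lt_pow_right Fintype.one_lt_card hdeg))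

/-- A finite module over a principal ideal domain contains an element whose annihilator is that of
the whole module. Here the latter is contained in (n), so the multiples of such an element by the
polynomials of degree < deg n are distinct, and there are as many of them as torsion points. -/
theorem exists_torsion_generator {n : F[X]} (hn : n.Monic)
    (hcard : (torsion F L n).ncard = Fintype.card F ^ n.natDegree) :
    ∃ g ∈ torsion F L n, (∀ a, carlitz F L a g = 0 → n ∣ a) ∧
      ∀ z ∈ torsion F L n, ∃ a, z = carlitz F L a g := by
  -- The copy of `L` on which F[θ] acts through the Carlitz module rather than by multiplication.
  let M := Module.AEval' (carlitzTheta F L)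
  let e : L ≃ₗ[F] M := Module.AEval'.of (carlitzTheta F L)
  have he (a : F[X]) (z : L) : a • e z = e (carlitz F L a z) :=
    (Module.AEval.of_aeval_smul (R := F) (a := carlitzTheta F L) a z).symm
  let T : Submodule F[X] M := Submodule.torsionBy F[X] M n
  have hT (z : L) : e z ∈ T ↔ z ∈ torsion F L n := by
    rw [Submodule.mem_torsionBy_iff, he, LinearEquiv.map_eq_zero_iff, mem_torsion]
  have : Finite T := by
    have h1 : (T : Set M) = e '' torsion F L n := by
      ext x
      obtain ⟨z, rfl⟩ := e.surjective x
      rw [SetLike.mem_coe, hT, e.injective.mem_set_image]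
    have h2 : (T : Set M).Finite := h1 ▸ (finite_torsion hn).image _
    exact h2.to_subtype
  have : Module.Finite F[X] T := Module.Finite.of_finite
  obtain ⟨⟨x, hx⟩, hker⟩ := Module.exists_ker_toSpanSingleton_eq_annihilator (R := F[X]) (M := T)
  obtain ⟨g, rfl⟩ := e.surjective x
  have hg := (hT g).mp hx
  have hann : ∀ a, carlitz F L a g = 0 → n ∣ a := by
    intro a ha
    have h1 : a ∈ LinearMap.ker (LinearMap.toSpanSingleton F[X] T ⟨e g, hx⟩) := by
      rw [LinearMap.mem_ker, LinearMap.toSpanSingleton_apply]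
      apply Subtype.ext
      rw [Submodule.coe_smul, he, ha, map_zero, Submodule.coe_zero]
    rw [hker, Module.mem_annihilator] at h1
    refine dvd_of_carlitz_eq_zero hn hcard fun z hz => ?_
    have h2 := congrArg Subtype.val (h1 ⟨e z, (hT z).mpr hz⟩)
    rwa [Submodule.coe_smul, he, Submodule.coe_zero, LinearEquiv.map_eq_zero_iff] at h2
  refine ⟨g, hg, hann, ?_⟩
  have hinj : Set.InjOn (fun a => carlitz F L a g) {a : F[X] | a.degree < n.degree} := by
    intro a ha b hb hab
    have h1 : n ∣ a - b := hann _ (by rw [carlitz_sub]; exact sub_eq_zero.mpr hab)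
    refine sub_eq_zero.mp (eq_zero_of_dvd_of_degree_lt h1 ?_)
    exact (degree_sub_le _ _).trans_lt (max_lt ha hb)
  have himg : (fun a => carlitz F L a g) '' {a : F[X] | a.degree < n.degree} = torsion F L n := by
    refine Set.eq_of_subset_of_ncard_le ?_ ?_ (finite_torsion hn)
    · rintro _ ⟨a, _, rfl⟩
      exact carlitz_mem_torsion a hg
    · rw [hinj.ncard_image, hcard, ncard_degree_lt n hn.ne_zero]
  intro z hz
  rw [← himg] at hz
  obtain ⟨a, _, rfl⟩ := hz
  exact ⟨a, rfl⟩

end TorsionCount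

/-! ### Rings of integers of intermediate fields and their torsion -/

section Integers

variable {F : Type*} [Field F]

theorem algebraMap_kbar_injective : Function.Injective (algebraMap F[X] (kbar F)) := by
  rw [IsScalarTower.algebraMap_eq F[X] (RatFunc F) (kbar F)]
  exact (algebraMap (RatFunc F) (kbar F)).injective.comp (IsFractionRing.injective F[X] (RatFunc F))

theorem isDedekindDomain_integers (K : IntermediateField (RatFunc F) (kbar F))
    [FiniteDimensional (RatFunc F) K] [IsGalois (RatFunc F) K] : IsDedekindDomain (integers K) :=
  integralClosure.isDedekindDomain F[X] (RatFunc F) K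

theorem finite_integers (K : IntermediateField (RatFunc F) (kbar F))
    [FiniteDimensional (RatFunc F) K] [IsGalois (RatFunc F) K] :
    Module.Finite F[X] (integers K) :=
  IsIntegralClosure.finite F[X] (RatFunc F) K (integers K)

theorem isGaloisGroup_integers (K : IntermediateField (RatFunc F) (kbar F))
    [FiniteDimensional (RatFunc F) K] [IsGalois (RatFunc F) K] :
    IsGaloisGroup Gal(K/RatFunc F) F[X] (integers K) :=
  IsGaloisGroup.of_isFractionRing _ F[X] (integers K) (RatFunc F) K

theorem algebraMap_integers_injective (K : IntermediateField (RatFunc F) (kbar F)) :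
    Function.Injective (algebraMap F[X] (integers K)) := by
  intro a b h
  exact algebraMap_kbar_injective (congrArg (fun z : integers K => ((z : K) : kbar F)) h)

theorem faithfulSMul_integers (K : IntermediateField (RatFunc F) (kbar F)) :
    FaithfulSMul F[X] (integers K) :=
  (faithfulSMul_iff_algebraMap_injective _ _).mpr (algebraMap_integers_injective K)

variable [Fintype F]

theorem isIntegral_of_mem_torsion {L : Type*} [CommRing L] [Algebra F L] [Algebra F[X] L]
    [IsScalarTower F F[X] L] {n : F[X]} (hn : n.Monic) {z : L} (hz : z ∈ torsion F L n) :
    IsIntegral F[X] z :=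
  ⟨carlitzPoly n, (monic_carlitzPoly hn).1, by
    rw [← aeval_def, aeval_carlitzPoly, mem_torsion.mp hz]⟩

theorem coe_mem_torsion_iff (K : IntermediateField (RatFunc F) (kbar F)) {n : F[X]} {z : K} :
    (z : kbar F) ∈ torsion F (kbar F) n ↔ z ∈ torsion F K n :=
  ⟨mem_torsion_of_map (φ := K.val.restrictScalars F[X]) K.val.injective,
    torsion_map (K.val.restrictScalars F[X])⟩

theorem coe_mem_torsion_integers_iff (K : IntermediateField (RatFunc F) (kbar F)) {n : F[X]}
    {z : integers K} : (z : K) ∈ torsion F K n ↔ z ∈ torsion F (integers K) n :=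
  ⟨mem_torsion_of_map (φ := (integers K).val) Subtype.val_injective,
    torsion_map (integers K).val⟩

theorem ncard_torsion_kbar {n : F[X]} (hn : n.Monic) :
    (torsion F (kbar F) n).ncard = Fintype.card F ^ n.natDegree :=
  ncard_torsion_of_isSepClosed hn <| by
    rw [Ne, map_eq_zero_iff _ algebraMap_kbar_injective]
    exact hn.ne_zero

theorem ncard_torsion_integers {K : IntermediateField (RatFunc F) (kbar F)} {n : F[X]}
    (hn : n.Monic) (hK : torsion F (kbar F) n ⊆ K) :
    (torsion F (integers K) n).ncard = Fintype.card F ^ n.natDegree := by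
  rw [← ncard_torsion_kbar hn]
  refine Set.ncard_congr (fun z _ => ((z : K) : kbar F)) ?_ ?_ ?_
  · intro z hz
    rwa [coe_mem_torsion_iff, coe_mem_torsion_integers_iff]
  · intro a b _ _ h
    exact Subtype.ext (Subtype.ext h)
  · intro z hz
    have h1 : (⟨z, hK hz⟩ : K) ∈ torsion F K n := (coe_mem_torsion_iff K).mp hz
    refine ⟨⟨⟨z, hK hz⟩, isIntegral_of_mem_torsion hn h1⟩, ?_, rfl⟩
    rwa [← coe_mem_torsion_integers_iff]

end Integers

/-! ### Automorphisms with prescribed action on torsion and constants -/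

section Frobenius

variable {F : Type*} [Field F] [Fintype F]

theorem natCard_quotient_span {w : F[X]} (hw : w ≠ 0) :
    Finite (F[X] ⧸ Ideal.span {w}) ∧
      Nat.card (F[X] ⧸ Ideal.span {w}) = Fintype.card F ^ w.natDegree := by
  have hfin : Module.Finite F (F[X] ⧸ Ideal.span {w}) := (AdjoinRoot.powerBasis hw).finite
  refine ⟨Module.finite_of_finite F, ?_⟩
  rw [Module.natCard_eq_pow_finrank (K := F), finrank_quotient_span_eq_natDegree,
    Nat.card_eq_fintype_card]

theorem finite_quotient_of_liesOver {R S : Type*} [CommRing R] [CommRing S] [Algebra R S]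
    [Module.Finite R S] (p : Ideal R) (P : Ideal S) [P.LiesOver p] [Finite (R ⧸ p)] :
    Finite (S ⧸ P) :=
  Module.finite_of_finite (R ⧸ p)

variable {K : IntermediateField (RatFunc F) (kbar F)}

/-- The automorphism `σ` of `K` acts on the `n`-torsion of the Carlitz module as `C_a`, and on the
constants as the `s`-th power of the `q`-Frobenius. -/
def ActsAs (n a : F[X]) (s : ℕ) (σ : Gal(K/RatFunc F)) : Prop :=
  (∀ z : K, z ∈ torsion F K n → σ z = carlitz F K a z) ∧
    ∀ c : K, IsIntegral F c → σ c = c ^ Fintype.card F ^ s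

theorem ActsAs.mul {n a b : F[X]} {s t : ℕ} {σ τ : Gal(K/RatFunc F)} (hσ : ActsAs n a s σ)
    (hτ : ActsAs n b t τ) : ActsAs n (a * b) (s + t) (σ * τ) := by
  refine ⟨fun z hz => ?_, fun c hc => ?_⟩
  · rw [AlgEquiv.mul_apply, hτ.1 z hz, hσ.1 _ (carlitz_mem_torsion b hz), carlitz_mul]
  · rw [AlgEquiv.mul_apply, hτ.2 c hc, map_pow, hσ.2 c hc, ← pow_mul, pow_add]

theorem actsAs_one (n : F[X]) : ActsAs n 1 0 (1 : Gal(K/RatFunc F)) :=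
  ⟨fun z _ => by rw [carlitz_one, AlgEquiv.one_apply], fun c _ => by
    rw [pow_zero, pow_one, AlgEquiv.one_apply]⟩

variable [FiniteDimensional (RatFunc F) K] [IsGalois (RatFunc F) K]

/-- The Frobenius automorphism at a prime `w` that does not divide `n`. -/
theorem exists_actsAs_of_irreducible {n w : F[X]} (hn : n.Monic) (hw : w.Monic)
    (hwirr : Irreducible w) (hwn : ¬ w ∣ n) :
    ∃ σ : Gal(K/RatFunc F), ActsAs n w w.natDegree σ := by
  have := isDedekindDomain_integers K
  have := finite_integers K
  have := isGaloisGroup_integers K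
  have := faithfulSMul_integers K
  have hmax : (Ideal.span {w}).IsMaximal :=
    PrincipalIdealRing.isMaximal_of_irreducible hwirr
  obtain ⟨W, hWmax, hW⟩ :=
    Ideal.exists_maximal_ideal_liesOver_of_isIntegral (S := integers K) (Ideal.span {w})
  obtain ⟨hfin, hcard⟩ := natCard_quotient_span hw.ne_zero
  have hover := hW.over
  have hmem (f : F[X]) : algebraMap F[X] (integers K) f ∈ W ↔ w ∣ f := by
    rw [← Ideal.mem_span_singleton, hover, Ideal.under_def, Ideal.mem_comap]
  have : Finite (integers K ⧸ W) := finite_quotient_of_liesOver (Ideal.span {w}) W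
  obtain ⟨σ, hσ⟩ := IsArithFrobAt.exists_of_isInvariant F[X] Gal(K/RatFunc F) W
  have hσ' (x : integers K) : σ • x - x ^ Fintype.card F ^ w.natDegree ∈ W := by
    have := hσ x
    rwa [← hover, hcard] at this
  refine ⟨σ, fun z hz => ?_, fun c hc => ?_⟩
  · have hzi := isIntegral_of_mem_torsion hn hz
    set z' : integers K := ⟨z, hzi⟩
    have hz' : z' ∈ torsion F (integers K) n := (coe_mem_torsion_integers_iff K).mp hz
    -- Both σ z and C_w(z) are congruent to z ^ (q ^ deg w) modulo W, and reduction modulo W is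
    -- injective on the n-torsion because w does not divide n.
    have h1 := W.sub_mem (hσ' z') (carlitz_sub_pow_mem hw hwirr ((hmem w).mpr dvd_rfl) z')
    rw [sub_sub_sub_cancel_right] at h1
    have h2 : σ • z' ∈ torsion F (integers K) n := by
      rw [← coe_mem_torsion_integers_iff, integralClosure.coe_smul]
      exact torsion_map ((σ : K →ₐ[RatFunc F] K).restrictScalars F[X]) hz
    have h3 := eq_zero_of_mem_torsion (I := W) (by rwa [hmem])
      (torsion_sub h2 (carlitz_mem_torsion w hz')) h1
    have h4 := congrArg (integers K).val (sub_eq_zero.mp h3)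
    rw [carlitz_map (integers K).val] at h4
    exact h4
  · set c' : integers K := ⟨c, hc.tower_top⟩
    have h1 := hσ' c'
    by_contra h0
    -- The difference is algebraic over `F`; were it nonzero, its inverse would be algebraic over
    -- `F` too, so it would be a unit of the ring of integers lying in W.
    have h2 : IsIntegral F (σ c - c ^ Fintype.card F ^ w.natDegree) :=
      (hc.map ((σ : K →ₐ[RatFunc F] K).restrictScalars F)).sub (hc.pow _)
    have h3 := h2.inv
    refine hWmax.ne_top ((Ideal.eq_top_iff_one _).mpr ?_)
    have h4 := W.mul_mem_left (⟨_, h3.tower_top⟩ : integers K) h1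
    convert! h4 using 1
    refine Subtype.ext ?_
    exact (inv_mul_cancel₀ (sub_ne_zero.mpr h0)).symm

/-- Multiply the Frobenius automorphisms at the prime factors of `a`; the Frobenius exponents on
constants are the degrees of the factors, so they add up to deg a. -/
theorem exists_actsAs_of_monic {n : F[X]} (hn : n.Monic) (a : F[X]) (ha : a.Monic)
    (han : IsCoprime a n) : ∃ σ : Gal(K/RatFunc F), ActsAs n a a.natDegree σ := by
  induction hk : a.natDegree using Nat.strong_induction_on generalizing a with
  | _ k ih =>
    subst hk
    rcases Nat.eq_zero_or_pos a.natDegree with h0 | h0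
    · rw [h0, ha.natDegree_eq_zero.mp h0]
      exact ⟨1, actsAs_one n⟩
    · obtain ⟨w, hw, hwirr, b, rfl⟩ := exists_monic_irreducible_factor a
        (not_isUnit_of_natDegree_pos a h0)
      have hb : b.Monic := hw.of_mul_monic_left ha
      have hdeg := hw.natDegree_mul hb
      have hwpos := hwirr.natDegree_pos
      obtain ⟨σ, hσ⟩ := exists_actsAs_of_irreducible (K := K) hn hw hwirr fun h =>
        hwirr.not_isUnit (han.of_mul_left_left.isUnit_of_dvd' dvd_rfl h)
      obtain ⟨τ, hτ⟩ := ih b.natDegree (by lia) b hb han.of_mul_left_right rfl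
      rw [hdeg]
      exact ⟨σ * τ, hσ.mul hτ⟩

/-- The action on torsion depends only on `a` mod n, while the action on constants depends on the
degree of the representative. So `a` is replaced by a monic representative of large degree in the
right class mod m. It need not be irreducible, so no theorem on primes in progressions is required.
-/
theorem exists_actsAs {n : F[X]} (hn : n.Monic) {m : ℕ} (hm : 0 < m) {a : F[X]}
    (han : IsCoprime a n) (s : ℕ) : ∃ (t : ℕ) (σ : Gal(K/RatFunc F)),
      t ≡ s [MOD m] ∧ ActsAs n a t σ := by
  -- Chosen so that deg n + D ≡ s mod m; the last summand makes n * X ^ D dominate `a`.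
  set D := s + (m - 1) * n.natDegree + m * (a.natDegree + 1) with hD
  set b := n * X ^ D + a with hb
  have hlt : a.degree < (n * X ^ D).degree := by
    refine degree_lt_degree ?_
    rw [hn.natDegree_mul (monic_X_pow _), natDegree_X_pow]
    nlinarith
  have hbm : b.Monic := (hn.mul (monic_X_pow D)).add_of_left hlt
  have hbdeg : b.natDegree = n.natDegree + D := by
    rw [hb, natDegree_add_eq_left_of_degree_lt hlt, hn.natDegree_mul (monic_X_pow _),
      natDegree_X_pow]
  have hbn : IsCoprime b n := by
    rw [hb, add_comm]
    exact han.add_mul_left_left _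
  obtain ⟨σ, hσ⟩ := exists_actsAs_of_monic (K := K) hn b hbm hbn
  refine ⟨_, σ, ?_, fun z hz => ?_, hσ.2⟩
  · have : b.natDegree = s + m * (n.natDegree + a.natDegree + 1) := by
      rw [hbdeg, hD]
      obtain ⟨k, rfl⟩ : ∃ k, m = k + 1 := ⟨m - 1, by lia⟩
      rw [Nat.add_sub_cancel]
      ring
    rw [this]
    exact Nat.modEq_iff_dvd.mpr ⟨-(n.natDegree + a.natDegree + 1), by push_cast; ring⟩
  · rw [hσ.1 z hz]
    exact carlitz_eq_of_dvd_sub ⟨X ^ D, by rw [hb]; ring⟩ hz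

end Frobenius

/-! ### The constant field with q ^ m elements -/

section ConstField

variable {F : Type*} [Field F]

theorem rootSet_X_pow_sub_X {k : Type*} [Field k] [Algebra k (kbar F)] {Q : ℕ} (hQ : 1 < Q)
    (c : kbar F) : c ∈ (X ^ Q - X : k[X]).rootSet (kbar F) ↔ c ^ Q = c := by
  rw [mem_rootSet, map_sub, map_pow, aeval_X, sub_eq_zero]
  exact and_iff_right (FiniteField.X_pow_card_sub_X_ne_zero _ hQ)

variable [Fintype F]

theorem one_lt_card_pow {m : ℕ} (hm : 0 < m) : 1 < Fintype.card F ^ m :=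
  Nat.one_lt_pow hm.ne' Fintype.one_lt_card

theorem frobeniusAlgHom_pow_apply {L : Type*} [CommRing L] [Algebra F L] (m : ℕ) (z : L) :
    (FiniteField.frobeniusAlgHom F L ^ m) z = z ^ Fintype.card F ^ m := by
  induction m generalizing z with
  | zero => simp
  | succ m ih => rw [pow_succ, AlgHom.mul_apply, ih, FiniteField.coe_frobeniusAlgHom, ← pow_mul,
      ← pow_succ']

theorem frobenius_pow_sub {L : Type*} [CommRing L] [Algebra F L] (m : ℕ) (x y : L) :
    (x - y) ^ Fintype.card F ^ m = x ^ Fintype.card F ^ m - y ^ Fintype.card F ^ m := by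
  simp only [← frobeniusAlgHom_pow_apply, map_sub]

theorem frobenius_pow_add {L : Type*} [CommRing L] [Algebra F L] (m : ℕ) (x y : L) :
    (x + y) ^ Fintype.card F ^ m = x ^ Fintype.card F ^ m + y ^ Fintype.card F ^ m := by
  simp only [← frobeniusAlgHom_pow_apply, map_add]

/-- The roots of X ^ (q ^ m) - X are already closed under the field operations, so the field they
generate contains nothing else. -/
theorem mem_constField_iff {m : ℕ} (hm : 0 < m) {c : kbar F} :
    c ∈ constField F m ↔ c ^ Fintype.card F ^ m = c := by
  rw [← rootSet_X_pow_sub_X (k := F) (one_lt_card_pow hm)]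
  refine ⟨fun hc => ?_, fun hc => IntermediateField.subset_adjoin _ _ hc⟩
  rw [rootSet_X_pow_sub_X (one_lt_card_pow hm)]
  induction hc using IntermediateField.adjoin_induction with
  | mem x hx => rwa [rootSet_X_pow_sub_X (one_lt_card_pow hm)] at hx
  | algebraMap x => rw [← map_pow, FiniteField.pow_card_pow]
  | add x y _ _ hx hy => rw [frobenius_pow_add, hx, hy]
  | inv x _ hx => rw [inv_pow, hx]
  | mul x y _ _ hx hy => rw [mul_pow, hx, hy]

theorem coe_constField {m : ℕ} (hm : 0 < m) (k : Type*) [Field k] [Algebra k (kbar F)] :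
    (constField F m : Set (kbar F)) = (X ^ Fintype.card F ^ m - X : k[X]).rootSet (kbar F) := by
  ext c
  rw [rootSet_X_pow_sub_X (one_lt_card_pow hm), SetLike.mem_coe, mem_constField_iff hm]

theorem separable_X_pow_sub_X {m : ℕ} (hm : 0 < m) (k : Type*) [Field k] [Algebra F k] :
    (X ^ Fintype.card F ^ m - X : k[X]).Separable := by
  obtain ⟨p, hp⟩ := CharP.exists F
  have : CharP k p := charP_of_injective_algebraMap (algebraMap F k).injective p
  refine galois_poly_separable p _ ?_
  rw [← CharP.cast_eq_zero_iff F p, Nat.cast_pow, FiniteField.cast_card_eq_zero, zero_pow hm.ne']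

theorem natCard_constField {m : ℕ} (hm : 0 < m) :
    Nat.card (constField F m) = Fintype.card F ^ m := by
  classical
  have h : Nat.card (constField F m) = Nat.card (constField F m : Set (kbar F)) := rfl
  rw [h, coe_constField hm F, Nat.card_eq_fintype_card,
    card_rootSet_eq_natDegree (separable_X_pow_sub_X hm F) (IsAlgClosed.splits _),
    FiniteField.X_pow_card_pow_sub_X_natDegree_eq F hm.ne' Fintype.one_lt_card]

theorem finite_constField {m : ℕ} (hm : 0 < m) : Finite (constField F m) :=
  Nat.finite_of_card_ne_zero <| by
    rw [natCard_constField hm]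
    exact pow_ne_zero _ Fintype.card_ne_zero

theorem card_constField {m : ℕ} [Fintype (constField F m)] (hm : 0 < m) :
    Fintype.card (constField F m) = Fintype.card F ^ m := by
  rw [← Nat.card_eq_fintype_card, natCard_constField hm]

end ConstField

/-! ### The Galois groups of K_n and K_(n,m) -/

section GaloisGroup

variable {F : Type*} [Field F] [Fintype F]

theorem isGalois_adjoin_rootSet {k E : Type*} [Field k] [Field E] [Algebra k E] [IsAlgClosed E]
    {p : k[X]} (hp : p.Separable) :
    FiniteDimensional k (IntermediateField.adjoin k (p.rootSet E)) ∧
      IsGalois k (IntermediateField.adjoin k (p.rootSet E)) := by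
  have := IntermediateField.adjoin_rootSet_isSplittingField (p := p) (L := E)
    (IsAlgClosed.splits _)
  exact ⟨IsSplittingField.finiteDimensional _ p, IsGalois.of_separable_splitting_field hp⟩

theorem torsion_eq_rootSet {n : F[X]} (hn : n.Monic) : torsion F (kbar F) n =
    ((carlitzPoly n).map (algebraMap F[X] (RatFunc F))).rootSet (kbar F) := by
  ext z
  rw [mem_rootSet, aeval_map_algebraMap, aeval_carlitzPoly, mem_torsion]
  exact (and_iff_right ((monic_carlitzPoly hn).1.map _).ne_zero).symm

theorem isGalois_cycField {n : F[X]} (hn : n.Monic) :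
    FiniteDimensional (RatFunc F) (cycField F n) ∧ IsGalois (RatFunc F) (cycField F n) := by
  rw [cycField, torsion_eq_rootSet hn]
  refine isGalois_adjoin_rootSet ?_
  rw [separable_def, derivative_map, derivative_carlitzPoly, map_C]
  have : algebraMap F[X] (RatFunc F) n ≠ 0 := by
    rw [Ne, map_eq_zero_iff _ (IsFractionRing.injective F[X] (RatFunc F))]
    exact hn.ne_zero
  exact ⟨0, C (algebraMap F[X] (RatFunc F) n)⁻¹, by
    rw [zero_mul, zero_add, ← C_mul, inv_mul_cancel₀ this, C_1]⟩

theorem isGalois_compField {n : F[X]} (hn : n.Monic) {m : ℕ} (hm : 0 < m) :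
    FiniteDimensional (RatFunc F) (compField F n m) ∧ IsGalois (RatFunc F) (compField F n m) := by
  obtain ⟨h1, h2⟩ := isGalois_cycField hn
  obtain ⟨h3, h4⟩ := isGalois_adjoin_rootSet (k := RatFunc F) (E := kbar F)
    (separable_X_pow_sub_X (F := F) hm (RatFunc F))
  rw [← coe_constField hm] at h3 h4
  have hnor : Normal (RatFunc F) (compField F n m) :=
    IntermediateField.normal_sup (RatFunc F) (kbar F) (cycField F n)
      (IntermediateField.adjoin (RatFunc F) (constField F m : Set (kbar F)))
  have hsep : Algebra.IsSeparable (RatFunc F) (compField F n m) :=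
    IntermediateField.isSeparable_sup (RatFunc F) (kbar F) (cycField F n)
      (IntermediateField.adjoin (RatFunc F) (constField F m : Set (kbar F)))
  exact ⟨IntermediateField.finiteDimensional_sup (cycField F n)
    (IntermediateField.adjoin (RatFunc F) (constField F m : Set (kbar F))), ⟨⟩⟩

theorem torsion_subset_cycField (n : F[X]) : torsion F (kbar F) n ⊆ cycField F n :=
  IntermediateField.subset_adjoin _ _

theorem torsion_subset_compField (n : F[X]) (m : ℕ) :
    torsion F (kbar F) n ⊆ compField F n m :=
  (torsion_subset_cycField n).trans (cycField_le_compField n m)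

theorem isIntegral_of_coe_mem_constField {K : IntermediateField (RatFunc F) (kbar F)} {m : ℕ}
    {c : K} (hc : (c : kbar F) ∈ constField F m) : IsIntegral F c :=
  (isIntegral_algHom_iff (K.val.restrictScalars F) K.val.injective).mp
    (isIntegral_of_mem_constField m hc)

theorem pow_card_pow_eq_of_modEq {L : Type*} [Monoid L] {Q m s t : ℕ} (hst : s ≡ t [MOD m]) {c : L}
    (hc : c ^ Q ^ m = c) : c ^ Q ^ s = c ^ Q ^ t := by
  have h (k r : ℕ) : c ^ Q ^ (r + m * k) = c ^ Q ^ r := by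
    induction k with
    | zero => simp
    | succ k ih => rw [mul_add, mul_one, ← add_assoc, add_comm, pow_add, pow_mul, hc, ih]
  rw [← Nat.mod_add_div s m, ← Nat.mod_add_div t m, h, h, hst]

theorem sigma_spec {n : F[X]} (hn : n.Monic) {m : ℕ} (hm : 0 < m) {a : F[X]}
    (han : IsCoprime a n) (s : ℕ) :
    (∀ z : compField F n m, z ∈ torsion F (compField F n m) n →
        sigma n m a s z = carlitz F (compField F n m) a z) ∧
      (∀ c : compField F n m, (c : kbar F) ∈ constField F m →
        sigma n m a s c = c ^ (Fintype.card F ^ s)) := by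
  obtain ⟨_, _⟩ := isGalois_compField hn hm
  have h : ∃ σ : Gal(compField F n m/RatFunc F),
      (∀ z : compField F n m, z ∈ torsion F (compField F n m) n →
        σ z = carlitz F (compField F n m) a z) ∧
      (∀ c : compField F n m, (c : kbar F) ∈ constField F m →
        σ c = c ^ (Fintype.card F ^ s)) := by
    obtain ⟨t, σ, hts, hσ⟩ := exists_actsAs (K := compField F n m) hn hm han s
    refine ⟨σ, hσ.1, fun c hc => ?_⟩
    rw [hσ.2 c (isIntegral_of_coe_mem_constField hc)]
    refine pow_card_pow_eq_of_modEq hts (Subtype.ext ?_)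
    exact (mem_constField_iff hm).mp hc
  rw [sigma, dif_pos h]
  exact h.choose_spec

theorem rho_spec {n : F[X]} (hn : n.Monic) {a : F[X]} (han : IsCoprime a n) :
    ∀ z : cycField F n, z ∈ torsion F (cycField F n) n →
      rho n a z = carlitz F (cycField F n) a z := by
  obtain ⟨_, _⟩ := isGalois_cycField hn
  have h : ∃ σ : Gal(cycField F n/RatFunc F), ∀ z : cycField F n,
      z ∈ torsion F (cycField F n) n → σ z = carlitz F (cycField F n) a z := by
    obtain ⟨t, σ, -, hσ⟩ := exists_actsAs (K := cycField F n) hn one_pos han 0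
    exact ⟨σ, hσ.1⟩
  rw [rho, dif_pos h]
  exact h.choose_spec

theorem compField_algHom_ext {n : F[X]} {m : ℕ} {L : Type*} [Field L] [Algebra (RatFunc F) L]
    {σ τ : compField F n m →ₐ[RatFunc F] L}
    (h1 : ∀ z : compField F n m, z ∈ torsion F (compField F n m) n → σ z = τ z)
    (h2 : ∀ c : compField F n m, (c : kbar F) ∈ constField F m → σ c = τ c) : σ = τ := by
  have h : compField F n m = IntermediateField.adjoin (RatFunc F)
      (torsion F (kbar F) n ∪ (constField F m : Set (kbar F))) := by
    rw [compField, cycField, IntermediateField.adjoin_union]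
  refine IntermediateField.algHom_ext_of_eq_adjoin _ h fun x hx => ?_
  rcases hx with hx | hx
  · exact h1 _ ((coe_mem_torsion_iff _).mp hx)
  · exact h2 _ hx

theorem compField_algEquiv_ext {n : F[X]} {m : ℕ} {σ τ : Gal(compField F n m/RatFunc F)}
    (h1 : ∀ z : compField F n m, z ∈ torsion F (compField F n m) n → σ z = τ z)
    (h2 : ∀ c : compField F n m, (c : kbar F) ∈ constField F m → σ c = τ c) : σ = τ :=
  AlgEquiv.coe_toAlgHom_injective (compField_algHom_ext h1 h2)

theorem exists_forall_algHom_eq_pow {E : Type*} [Field E] [Finite E] [Algebra F E]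
    (f : E →ₐ[F] E) : ∃ s : ℕ, ∀ c, f c = c ^ Fintype.card F ^ s := by
  have hf : Function.Bijective f :=
    (Finite.injective_iff_bijective (f := f)).mp f.toRingHom.injective
  obtain ⟨s, hs⟩ := (FiniteField.bijective_frobeniusAlgEquivOfAlgebraic_pow F E).2
    (AlgEquiv.ofBijective f hf)
  refine ⟨s, fun c => ?_⟩
  have h1 := AlgEquiv.congr_fun hs c
  have h2 (k : ℕ) (c : E) : (FiniteField.frobeniusAlgEquivOfAlgebraic F E ^ k) c =
      c ^ Fintype.card F ^ k := by
    induction k generalizing c with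
    | zero => simp
    | succ k ih =>
      rw [pow_succ, AlgEquiv.mul_apply, ih, FiniteField.coe_frobeniusAlgEquivOfAlgebraic, ← pow_mul,
        ← pow_succ']
  exact h1.symm.trans (h2 _ c)

theorem exists_forall_const_eq_pow {K : IntermediateField (RatFunc F) (kbar F)} {m : ℕ}
    (hm : 0 < m) (hK : (constField F m : Set (kbar F)) ⊆ K) (σ : Gal(K/RatFunc F)) :
    ∃ s < m, ∀ c : K, (c : kbar F) ∈ constField F m → σ c = c ^ Fintype.card F ^ s := by
  have := finite_constField (F := F) hm
  let i : constField F m →ₐ[F] K := {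
    toFun c := ⟨c, hK c.2⟩
    map_one' := rfl
    map_mul' _ _ := rfl
    map_zero' := rfl
    map_add' _ _ := rfl
    commutes' _ := rfl }
  let j : constField F m →ₐ[F] kbar F := (K.val.restrictScalars F).comp
    (((σ : K →ₐ[RatFunc F] K).restrictScalars F).comp i)
  have hj (c : constField F m) : j c ∈ constField F m := by
    rw [mem_constField_iff hm, ← map_pow]
    congr 1
    exact Subtype.ext ((mem_constField_iff hm).mp c.2)
  obtain ⟨s, hs⟩ := exists_forall_algHom_eq_pow (j.codRestrict (constField F m).toSubalgebra hj)
  refine ⟨s % m, Nat.mod_lt _ hm, fun c hc => ?_⟩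
  rw [pow_card_pow_eq_of_modEq (Nat.mod_modEq s m) (c := c)
    (Subtype.ext ((mem_constField_iff hm).mp hc))]
  exact Subtype.ext (congrArg (fun e : constField F m => (e : kbar F)) (hs ⟨c, hc⟩))

theorem ncard_torsion {K : IntermediateField (RatFunc F) (kbar F)} {n : F[X]}
    (hn : n.Monic) (hK : torsion F (kbar F) n ⊆ K) :
    (torsion F K n).ncard = Fintype.card F ^ n.natDegree := by
  rw [← ncard_torsion_kbar hn]
  refine Set.ncard_congr (fun z _ => (z : kbar F)) ?_ ?_ ?_
  · intro z hz
    rwa [coe_mem_torsion_iff]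
  · intro a b _ _ h
    exact Subtype.ext h
  · intro z hz
    exact ⟨⟨z, hK hz⟩, (coe_mem_torsion_iff K).mp hz, rfl⟩

/-- An automorphism commutes with the Carlitz action, so it is determined on torsion by the image
C_a(g) of a generator g; the image of g under the inverse automorphism supplies an inverse of `a`
modulo n. -/
theorem exists_forall_torsion_eq_carlitz {K : IntermediateField (RatFunc F) (kbar F)} {n : F[X]}
    (hn : n.Monic) (hK : torsion F (kbar F) n ⊆ K) (σ : Gal(K/RatFunc F)) :
    ∃ a : F[X], IsCoprime a n ∧ ∀ z : K, z ∈ torsion F K n → σ z = carlitz F K a z := by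
  obtain ⟨g, hg, hann, hgen⟩ := exists_torsion_generator hn (ncard_torsion hn hK)
  have hσ (τ : Gal(K/RatFunc F)) (b : F[X]) (z : K) :
      τ (carlitz F K b z) = carlitz F K b (τ z) :=
    carlitz_map ((τ : K →ₐ[RatFunc F] K).restrictScalars F[X]) b z
  have hmem (τ : Gal(K/RatFunc F)) : τ g ∈ torsion F K n := by
    rw [mem_torsion, ← hσ, mem_torsion.mp hg, map_zero]
  obtain ⟨a, ha⟩ := hgen _ (hmem σ)
  obtain ⟨b, hb⟩ := hgen _ (hmem σ⁻¹)
  refine ⟨a, ?_, fun z hz => ?_⟩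
  · have h1 : σ (σ⁻¹ g) = g := by rw [← AlgEquiv.mul_apply, mul_inv_cancel, AlgEquiv.one_apply]
    rw [hb, hσ, ha, ← carlitz_mul] at h1
    obtain ⟨c, hc⟩ := hann (b * a - 1) (by rw [carlitz_sub, h1, carlitz_one, sub_self])
    exact ⟨b, -c, by linear_combination hc⟩
  · obtain ⟨c, rfl⟩ := hgen z hz
    rw [hσ, ha, carlitz_comm]

theorem mem_monicCoprime {n a : F[X]} :
    a ∈ monicCoprime F n ↔ a.Monic ∧ a.degree < n.degree ∧ IsCoprime a n := by
  rw [monicCoprime, Set.Finite.mem_toFinset]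
  rfl

/-- An automorphism is determined by its Frobenius exponent mod m and by a unit mod n, and the
reduced representative of the unit is a leading coefficient times a monic polynomial. The factor q -
1 from the leading coefficients is what cancels the exponent 1 / (q - 1) at infinity. -/
theorem natCard_gal_compField_le {n : F[X]} (hn : n.Monic) (hn0 : 0 < n.natDegree) {m : ℕ}
    (hm : 0 < m) : Nat.card Gal(compField F n m/RatFunc F) ≤
      m * ((Fintype.card F - 1) * (monicCoprime F n).card) := by
  classical
  have key : ∀ σ : Gal(compField F n m/RatFunc F),
      ∃ p : Fin m × Fˣ × monicCoprime F n,
        (∀ z : compField F n m, z ∈ torsion F (compField F n m) n →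
          σ z = carlitz F (compField F n m) (C (p.2.1 : F) * p.2.2) z) ∧
        ∀ c : compField F n m, (c : kbar F) ∈ constField F m →
          σ c = c ^ Fintype.card F ^ (p.1 : ℕ) := by
    intro σ
    obtain ⟨s, hs, h1⟩ := exists_forall_const_eq_pow hm
      (fun c hc => mem_compField_of_mem_constField n m hc) σ
    obtain ⟨a, han, h2⟩ := exists_forall_torsion_eq_carlitz hn (torsion_subset_compField n m) σ
    have hn1 : n ≠ 1 := by
      rintro rfl
      simp at hn0
    have hr : IsCoprime (a %ₘ n) n := by
      rw [modByMonic_eq_sub_mul_div, sub_eq_add_neg, ← mul_neg]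
      exact han.add_mul_left_left _
    have hr0 : a %ₘ n ≠ 0 := by
      intro h0
      rw [h0, isCoprime_zero_left] at hr
      exact hn1 (hn.eq_one_of_isUnit hr)
    have hlc := leadingCoeff_ne_zero.mpr hr0
    refine ⟨⟨⟨s, hs⟩, Units.mk0 _ hlc, ⟨a %ₘ n * C (a %ₘ n).leadingCoeff⁻¹, ?_⟩⟩,
      fun z hz => ?_, h1⟩
    · rw [mem_monicCoprime]
      refine ⟨monic_mul_leadingCoeff_inv hr0, ?_, ?_⟩
      · rw [degree_mul_C (inv_ne_zero hlc)]
        exact degree_modByMonic_lt a hn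
      · exact (isCoprime_mul_unit_right_left (isUnit_C.mpr (inv_ne_zero hlc).isUnit) _ _).mpr hr
    · rw [h2 z hz]
      refine carlitz_eq_of_dvd_sub ⟨a /ₘ n, ?_⟩ hz
      have h3 : C (a %ₘ n).leadingCoeff * C (a %ₘ n).leadingCoeff⁻¹ = 1 := by
        rw [← C_mul, mul_inv_cancel₀ hlc, C_1]
      have h4 := modByMonic_add_div a n
      simp only [Units.val_mk0]
      linear_combination -h4 - (a %ₘ n) * h3
  choose f hf using key
  have hinj : Function.Injective f := by
    intro σ τ h
    refine compField_algEquiv_ext (fun z hz => ?_) (fun c hc => ?_)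
    · rw [(hf σ).1 z hz, (hf τ).1 z hz, h]
    · rw [(hf σ).2 c hc, (hf τ).2 c hc, h]
  refine (Nat.card_le_card_of_injective f hinj).trans (le_of_eq ?_)
  rw [Nat.card_prod, Nat.card_prod, Nat.card_fin, Nat.card_units, Nat.card_eq_fintype_card,
    Nat.card_eq_fintype_card, Fintype.card_coe]

end GaloisGroup

/-! ### Sizes at the infinite places -/

section Infinity

variable {F : Type*} [Field F]
variable {L : Type*} [Field L] [Algebra F L] {B : ValuationSubring L}

theorem valuation_const (hB : ∀ c : F, algebraMap F L c ∈ B) {c : F} (hc : c ≠ 0) : B.valuation (algebraMap F L c) = 1 := by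
  have hc' : algebraMap F L c ≠ 0 := (_root_.map_ne_zero _).mpr hc
  refine le_antisymm ((B.valuation_le_one_iff _).mpr (hB c)) ?_
  have := (B.valuation_le_one_iff _).mpr (hB c⁻¹)
  rw [map_inv₀, map_inv₀] at this
  exact (inv_le_one₀ (zero_lt_iff.mpr ((_root_.map_ne_zero _).mpr hc'))).mp this

theorem valuation_le_one_of_isIntegral (hB : ∀ c : F, algebraMap F L c ∈ B)
    {c : L} (hc : IsIntegral F c) : B.valuation c ≤ 1 := by
  obtain ⟨p, hp, hpc⟩ := hc
  by_contra! h
  have hlt : B.valuation (∑ i ∈ Finset.range p.natDegree, algebraMap F L (p.coeff i) * c ^ i) <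
      B.valuation (c ^ p.natDegree) := by
    have hc0 : c ≠ 0 := by
      rintro rfl
      rw [map_zero] at h
      exact not_lt_zero h
    refine Valuation.map_sum_lt _ ((_root_.map_ne_zero _).mpr (pow_ne_zero _ hc0)) fun i hi => ?_
    · rw [map_mul, map_pow, map_pow]
      exact (mul_le_of_le_one_left' ((B.valuation_le_one_iff _).mpr (hB _))).trans_lt
        (pow_lt_pow_right₀ h (Finset.mem_range.mp hi))
  have h1 := Valuation.map_add_eq_of_lt_right _ hlt
  rw [eval₂_eq_sum_range, Finset.sum_range_succ, hp.coeff_natDegree, map_one, one_mul] at hpc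
  rw [hpc, map_zero, eq_comm, map_eq_zero] at h1
  rw [h1, map_zero] at hlt
  exact not_lt_zero hlt

variable [Algebra F[X] L] [IsScalarTower F F[X] L]

/-- The valuation rings of `L` above the infinite place of `F(θ)`. -/
theorem exists_valuationSubring_infty (hinj : Function.Injective (algebraMap F[X] L)) :
    ∃ B : ValuationSubring L, (∀ c : F, algebraMap F L c ∈ B) ∧
      1 < B.valuation (algebraMap F[X] L X) := by
  set θ := algebraMap F[X] L X with hθ
  have hθ0 : θ ≠ 0 := by
    rw [hθ, Ne, map_eq_zero_iff _ hinj]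
    exact X_ne_zero
  have haeval (p : F[X]) : aeval θ p = algebraMap F[X] L p := by
    rw [hθ, aeval_algebraMap_apply, aeval_X_left_apply]
  -- The ring F[1/θ], in which 1/θ is not a unit: an inverse would make 1/θ, and hence θ, algebraic
  -- over `F`. A valuation ring in which the ideal (1/θ) becomes non-invertible lies above infinity.
  let A : Subring L := (aeval θ⁻¹ : F[X] →ₐ[F] L).range.toSubring
  have hmem (p : F[X]) : aeval θ⁻¹ p ∈ A := ⟨p, rfl⟩
  have hθA : θ⁻¹ ∈ A := by simpa using hmem X
  let I : Ideal A := Ideal.span {⟨θ⁻¹, hθA⟩}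
  have hI : I ≠ ⊤ := by
    intro h
    rw [Ideal.span_singleton_eq_top, isUnit_iff_exists_inv] at h
    obtain ⟨⟨_, p, rfl⟩, hp⟩ := h
    have hp' : θ⁻¹ * aeval θ⁻¹ p = 1 := congrArg Subtype.val hp
    have halg : IsAlgebraic F θ⁻¹ := by
      refine ⟨X * p - 1, fun h0 => ?_, by rw [map_sub, map_mul, aeval_X, hp', map_one, sub_self]⟩
      have := congrArg (coeff · 0) h0
      simp at this
    obtain ⟨r, hr0, hr⟩ := IsAlgebraic.inv_iff.mp halg
    rw [haeval, map_eq_zero_iff _ hinj] at hr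
    exact hr0 hr
  obtain ⟨B, hAB, hIB⟩ := Ideal.image_subset_nonunits_valuationSubring I hI
  refine ⟨B, fun c => hAB ?_, ?_⟩
  · simpa using hmem (C c)
  · have h1 : θ⁻¹ ∈ B.nonunits := hIB ⟨⟨θ⁻¹, hθA⟩, Ideal.mem_span_singleton_self _, rfl⟩
    rw [ValuationSubring.mem_nonunits_iff, map_inv₀] at h1
    exact (inv_lt_one₀ (zero_lt_iff.mpr ((_root_.map_ne_zero _).mpr hθ0))).mp h1

theorem valuation_polynomial (hB : ∀ c : F, algebraMap F L c ∈ B)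
    (hθ : 1 < B.valuation (algebraMap F[X] L X)) {f : F[X]} (hf : f ≠ 0) :
    B.valuation (algebraMap F[X] L f) = B.valuation (algebraMap F[X] L X) ^ f.natDegree := by
  set θ := algebraMap F[X] L X with hθ'
  have hθ0 : θ ≠ 0 := by
    intro h
    rw [h, map_zero] at hθ
    exact not_lt_zero hθ
  have h1 : algebraMap F[X] L f =
      ∑ i ∈ Finset.range (f.natDegree + 1), algebraMap F L (f.coeff i) * θ ^ i := by
    conv_lhs => rw [f.as_sum_range_C_mul_X_pow]
    rw [map_sum]
    refine Finset.sum_congr rfl fun i _ => ?_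
    rw [map_mul, map_pow, IsScalarTower.algebraMap_apply F F[X] L, algebraMap_eq]
  have h2 : B.valuation (algebraMap F L (f.coeff f.natDegree) * θ ^ f.natDegree) =
      B.valuation θ ^ f.natDegree := by
    rw [coeff_natDegree, map_mul, map_pow, valuation_const hB (leadingCoeff_ne_zero.mpr hf), one_mul]
  rw [h1, Finset.sum_range_succ, Valuation.map_add_eq_of_lt_right, h2]
  rw [h2]
  refine Valuation.map_sum_lt _ (pow_ne_zero _ ((_root_.map_ne_zero _).mpr hθ0)) fun i hi => ?_
  rw [map_mul, map_pow]
  exact (mul_le_of_le_one_left' ((B.valuation_le_one_iff _).mpr (hB _))).trans_lt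
    (pow_lt_pow_right₀ hθ (Finset.mem_range.mp hi))

variable [Fintype F]

/-- The torsion points of the Carlitz module have absolute value at most `q ^ (1 / (q - 1))` at
infinity. -/
theorem valuation_torsion (hθ : 1 < B.valuation (algebraMap F[X] L X))
    {n : F[X]} (hn : n.Monic) {z : L} (hz : z ∈ torsion F L n) :
    B.valuation z ^ (Fintype.card F - 1) ≤ B.valuation (algebraMap F[X] L X) := by
  have hq : 1 < Fintype.card F := Fintype.one_lt_card
  -- For a torsion point y of maximal size, |y| ^ (q - 1) > |θ| would make y ^ q dominate C_θ(y), so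
  -- that the torsion point C_θ(y) would be larger than y.
  obtain ⟨y, hy, hmax⟩ := Set.exists_max_image (torsion F L n) B.valuation (finite_torsion hn)
    ⟨z, hz⟩
  refine (pow_le_pow_left₀ zero_le (hmax z hz) _).trans ?_
  by_contra! h
  have hy1 : 1 < B.valuation y := by
    by_contra! h1
    exact (lt_irrefl _ ((hθ.trans h).trans_le (pow_le_one₀ zero_le h1)))
  have hy0 : 0 < B.valuation y := zero_lt_one.trans hy1
  have e : B.valuation (y ^ Fintype.card F) =
      B.valuation y ^ (Fintype.card F - 1) * B.valuation y := by
    rw [map_pow, ← pow_succ]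
    congr 1
    lia
  have h1 : B.valuation (algebraMap F[X] L X * y) < B.valuation (y ^ Fintype.card F) := by
    rw [map_mul, e]
    exact mul_lt_mul_of_pos_right h hy0
  have h2 := Valuation.map_add_eq_of_lt_right _ h1
  have h3 := hmax _ (carlitz_mem_torsion X hy)
  rw [← mul_one (X : F[X]), carlitz_X_mul, carlitz_one, h2, e] at h3
  refine absurd h3 (not_le.mpr ?_)
  conv_lhs => rw [← one_mul (B.valuation y)]
  exact mul_lt_mul_of_pos_right (hθ.trans h) hy0

/-- A bound for the degree of the norm of `1 + ∑ λ c` with `λ` torsion and `c` constant. -/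
theorem natDegree_mul_le_of_prod_eq (hB : ∀ c : F, algebraMap F L c ∈ B)
    (hθ : 1 < B.valuation (algebraMap F[X] L X))
    {n : F[X]} (hn : n.Monic) {G : Type*} [Fintype G] (g : G → L)
    {ι : Type*} (s : Finset ι) (lam c : G → ι → L) (hlam : ∀ σ, ∀ i ∈ s, lam σ i ∈ torsion F L n)
    (hc : ∀ σ, ∀ i ∈ s, IsIntegral F (c σ i)) (hg : ∀ σ, g σ = 1 + ∑ i ∈ s, lam σ i * c σ i)
    {f : F[X]} (hf : f ≠ 0) (hprod : algebraMap F[X] L f = ∏ σ, g σ) :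
    f.natDegree * (Fintype.card F - 1) ≤ Fintype.card G := by
  classical
  set w := B.valuation
  set t := w (algebraMap F[X] L X)
  have hadd {x y : L} (hx : w x ^ (Fintype.card F - 1) ≤ t) (hy : w y ^ (Fintype.card F - 1) ≤ t) :
      w (x + y) ^ (Fintype.card F - 1) ≤ t := by
    rcases le_max_iff.mp (w.map_add x y) with h | h
    · exact (pow_le_pow_left₀ zero_le h _).trans hx
    · exact (pow_le_pow_left₀ zero_le h _).trans hy
  have hq : 1 < Fintype.card F := Fintype.one_lt_card
  have hsum (σ : G) (u : Finset ι) (hu : u ⊆ s) :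
      w (∑ i ∈ u, lam σ i * c σ i) ^ (Fintype.card F - 1) ≤ t := by
    induction u using Finset.induction_on with
    | empty =>
      rw [Finset.sum_empty, map_zero, zero_pow (by lia)]
      exact zero_le
    | insert i u hi ih =>
      rw [Finset.sum_insert hi]
      refine hadd ?_ (ih ((Finset.subset_insert _ _).trans hu))
      have his := hu (Finset.mem_insert_self i u)
      refine (pow_le_pow_left₀ zero_le ?_ _).trans (valuation_torsion hθ hn (hlam σ i his))
      rw [map_mul]
      exact mul_le_of_le_one_right' (valuation_le_one_of_isIntegral hB (hc σ i his))
  have hg' (σ : G) : w (g σ) ^ (Fintype.card F - 1) ≤ t := by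
    rw [hg]
    refine hadd ?_ (hsum σ s subset_rfl)
    rw [map_one, one_pow]
    exact hθ.le
  have h1 : t ^ (f.natDegree * (Fintype.card F - 1)) ≤ t ^ Fintype.card G := by
    rw [pow_mul, ← valuation_polynomial hB hθ hf, hprod, map_prod, ← Finset.prod_pow]
    exact (Finset.prod_le_prod' fun σ _ => hg' σ).trans (by rw [Finset.prod_const, Finset.card_univ])
  exact (pow_le_pow_iff_right₀ hθ).mp h1

end Infinity

/-! ### Orthogonality of the maps z ↦ z ^ (q ^ i) -/

section CharacterSum

/-- A power sum over the units is -1 if |E| - 1 divides the exponent and 0 otherwise. The range i <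
2 * m covers all indices that occur in C_(v ^ l * c), whose degree may exceed m; hence the two
possible hits s and s + m. -/
theorem sum_units_inv_pow_mul_pow {E : Type*} [Field E] [Fintype E] [DecidableEq E] {Q m : ℕ} (hQ : 1 < Q)
    (hE : Fintype.card E = Q ^ m) {i s : ℕ} (hs : s < m) (hi : i < 2 * m) :
    ∑ z : Eˣ, ((z⁻¹ : Eˣ) : E) ^ Q ^ i * (z : E) ^ Q ^ s = if i = s ∨ i = s + m then -1 else 0 := by
  wlog him : i < m generalizing i
  · have h := this (i := i - m) (by lia) (by lia)
    have h1 : i ≡ i - m [MOD m] := by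
      have := Nat.ModEq.refl (n := m) (i - m)
      exact (Nat.modEq_iff_dvd' (by lia)).mpr ⟨1, by lia⟩ |>.symm
    have h2 (z : E) : z ^ Q ^ i = z ^ Q ^ (i - m) :=
      pow_card_pow_eq_of_modEq h1 (by rw [← hE, FiniteField.pow_card])
    simp only [h2, h]
    refine if_congr ?_ rfl rfl
    lia
  have hlt {j : ℕ} (hj : j < m) : Q ^ j ≤ Q ^ m - 1 := by
    have := Nat.pow_lt_pow_right hQ hj
    lia
  have hpos (j : ℕ) : 0 < Q ^ j := pow_pos (by lia) j
  have h1 (z : Eˣ) : ((z⁻¹ : Eˣ) : E) ^ Q ^ i * (z : E) ^ Q ^ s =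
      (z : E) ^ (Q ^ s + (Q ^ m - 1 - Q ^ i)) := by
    have h2 : (z : E) ^ (Q ^ m - 1) = 1 := by
      rw [← hE]
      exact FiniteField.pow_card_sub_one_eq_one _ z.ne_zero
    rw [pow_add, mul_comm]
    congr 1
    rw [Units.val_inv_eq_inv_val, inv_pow, inv_eq_iff_eq_inv, eq_comm, inv_eq_iff_eq_inv,
      ← mul_eq_one_iff_eq_inv₀ (pow_ne_zero _ z.ne_zero), ← pow_add, Nat.sub_add_cancel (hlt him), h2]
  have h3 : Fintype.card E - 1 ∣ Q ^ s + (Q ^ m - 1 - Q ^ i) ↔ i = s ∨ i = s + m := by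
    rw [hE]
    have h4 := hlt him
    have h5 := hlt hs
    have h6 := hpos i
    have h7 := hpos s
    constructor
    · rintro ⟨k, hk⟩
      left
      -- The exponent Q ^ s + (Q ^ m - 1 - Q ^ i) lies strictly between 0 and 2 * (Q ^ m - 1), since
      -- Q ^ s ≤ Q ^ m - 1 and Q ^ i ≥ 1.
      have hk1 : k = 1 := by
        have : k ≠ 0 := by rintro rfl; lia
        have : k < 2 := by
          by_contra! h
          have := Nat.mul_le_mul_left (Q ^ m - 1) h
          have h8 : Q ^ s = Q ^ m - 1 ∧ Q ^ m - 1 - Q ^ i = Q ^ m - 1 := by lia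
          lia
        lia
      subst hk1
      exact Nat.pow_right_injective hQ (by simp only; lia)
    · intro h
      obtain rfl : i = s := by lia
      exact ⟨1, by lia⟩
  simp only [h1]
  rw [FiniteField.sum_pow_units]
  exact if_congr h3 rfl rfl

end CharacterSum

/-! ### Congruences for Gauss sums modulo powers of a prime above `v` -/

section Congruence

variable {F : Type*} [Field F] [Fintype F]
variable {O : Type*} [CommRing O] [Algebra F O] [Algebra F[X] O] [IsScalarTower F F[X] O]
variable {E : Type*} [Field E] [Fintype E] [DecidableEq E]

/-- Here φ(z) plays the part of ω(C_c(z)). It is known only modulo `I`, but it is fixed by C_(v ^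
l), and applying C_(v ^ l) to the congruence improves it to one modulo I ^ (l + 1). Orthogonality
then picks out two coefficients of C_(v ^ l * c). -/
theorem gauss_sum_congr (ι : E →+* O) {m : ℕ} (hE : Fintype.card E = Fintype.card F ^ m)
    {v : F[X]} (hvirr : Irreducible v) {I : Ideal O} (hvI : algebraMap F[X] O v ∈ I)
    {l : ℕ} {c : F[X]} (φ : E → O) (hφ : ∀ z, carlitz F O (v ^ l) (φ z) = φ z)
    (hφI : ∀ z, φ z - carlitz F O c (ι z) ∈ I) (hdeg : (v ^ l * c).natDegree < 2 * m) {s : ℕ}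
    (hs : s < m) :
    (1 + ∑ z : Eˣ, φ (z⁻¹ : Eˣ) * ι z ^ Fintype.card F ^ s) -
      (1 - algebraMap F[X] O (carlitzCoeff (v ^ l * c) s) -
        algebraMap F[X] O (carlitzCoeff (v ^ l * c) (s + m))) ∈ I ^ (l + 1) := by
  have h1 (z : E) : φ z - carlitz F O (v ^ l * c) (ι z) ∈ I ^ (l + 1) := by
    rw [carlitz_mul, ← hφ z, ← map_sub]
    exact carlitz_pow_mem_pow_succ hvirr hvI l (hφI z)
  have h2 : ∑ z : Eˣ, carlitz F O (v ^ l * c) (ι (z⁻¹ : Eˣ)) * ι z ^ Fintype.card F ^ s =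
      -algebraMap F[X] O (carlitzCoeff (v ^ l * c) s) -
        algebraMap F[X] O (carlitzCoeff (v ^ l * c) (s + m)) := by
    have h3 (z : Eˣ) : carlitz F O (v ^ l * c) (ι (z⁻¹ : Eˣ)) * ι z ^ Fintype.card F ^ s =
        ∑ i ∈ Finset.range (2 * m), algebraMap F[X] O (carlitzCoeff (v ^ l * c) i) *
          ι (((z⁻¹ : Eˣ) : E) ^ Fintype.card F ^ i * (z : E) ^ Fintype.card F ^ s) := by
      rw [carlitz_eq_sum _ _ hdeg, Finset.sum_mul]
      refine Finset.sum_congr rfl fun i _ => ?_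
      rw [map_mul, map_pow, map_pow, mul_assoc]
    simp only [h3]
    rw [Finset.sum_comm]
    simp only [← Finset.mul_sum, ← map_sum]
    have h4 : ∀ i ∈ Finset.range (2 * m), algebraMap F[X] O (carlitzCoeff (v ^ l * c) i) *
        ι (∑ z : Eˣ, ((z⁻¹ : Eˣ) : E) ^ Fintype.card F ^ i * (z : E) ^ Fintype.card F ^ s) =
        if i ∈ ({s, s + m} : Finset ℕ) then -algebraMap F[X] O (carlitzCoeff (v ^ l * c) i)
          else 0 := by
      intro i hi
      rw [sum_units_inv_pow_mul_pow Fintype.one_lt_card hE hs (Finset.mem_range.mp hi)]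
      simp only [Finset.mem_insert, Finset.mem_singleton]
      split_ifs <;> simp
    rw [Finset.sum_congr rfl h4, Finset.sum_ite_mem, Finset.inter_eq_right.mpr, Finset.sum_pair]
    · ring
    · lia
    · intro i hi
      simp only [Finset.mem_insert, Finset.mem_singleton] at hi
      rw [Finset.mem_range]
      lia
  have e : (1 + ∑ z : Eˣ, φ (z⁻¹ : Eˣ) * ι z ^ Fintype.card F ^ s) -
      (1 - algebraMap F[X] O (carlitzCoeff (v ^ l * c) s) -
        algebraMap F[X] O (carlitzCoeff (v ^ l * c) (s + m))) =
      ∑ z : Eˣ, (φ (z⁻¹ : Eˣ) - carlitz F O (v ^ l * c) (ι (z⁻¹ : Eˣ))) *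
        ι z ^ Fintype.card F ^ s := by
    simp only [sub_mul, Finset.sum_sub_distrib, h2]
    ring
  rw [e]
  exact Ideal.sum_mem _ fun z _ => Ideal.mul_mem_right _ _ (h1 _)

/-- For s = deg c the index s + m is the degree of v ^ l * c, so the second coefficient is 1 and
cancels the constant term; the order is then that of the coefficient at s. -/
theorem gauss_sum_mem_pow (ι : E →+* O) {m : ℕ} (hE : Fintype.card E = Fintype.card F ^ m)
    {v : F[X]} (hv : v.Monic) (hvirr : Irreducible v) {I : Ideal O}
    (hvI : algebraMap F[X] O v ∈ I) {l : ℕ} (hm : m = v.natDegree * l) {c : F[X]} (hc : c.Monic)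
    (φ : E → O) (hφ : ∀ z, carlitz F O (v ^ l) (φ z) = φ z)
    (hφI : ∀ z, φ z - carlitz F O c (ι z) ∈ I) (hs : c.natDegree < m) :
    1 + ∑ z : Eˣ, φ (z⁻¹ : Eˣ) * ι z ^ Fintype.card F ^ c.natDegree ∈
      I ^ (l - c.natDegree / v.natDegree) := by
  have hmon : (v ^ l * c).Monic := (hv.pow l).mul hc
  have hdeg : (v ^ l * c).natDegree = c.natDegree + m := by
    rw [(hv.pow l).natDegree_mul hc, hv.natDegree_pow, hm, add_comm, mul_comm l]
  have h1 := gauss_sum_congr ι hE hvirr hvI φ hφ hφI (by lia) hs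
  rw [← hdeg, carlitzCoeff_natDegree, hmon.leadingCoeff, C_1, map_one] at h1
  have h2 : algebraMap F[X] O (carlitzCoeff (v ^ l * c) c.natDegree) ∈
      I ^ (l - c.natDegree / v.natDegree) := by
    obtain ⟨u, hu⟩ := pow_dvd_carlitzCoeff_pow_mul hvirr c l c.natDegree
    rw [hu, map_mul, map_pow]
    exact Ideal.mul_mem_right _ _ (Ideal.pow_mem_pow hvI _)
  have h3 := (I ^ (l - c.natDegree / v.natDegree)).sub_mem
    (Ideal.pow_le_pow_right (by lia) h1) h2
  convert h3 using 1
  ring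

/-- For s > deg c the index s + m is beyond the degree of v ^ l * c, and the coefficient at s < m is
divisible by v, so only the 1 survives. This serves to show that a Gauss sum is nonzero. -/
theorem gauss_sum_sub_one_mem (ι : E →+* O) {m : ℕ} (hE : Fintype.card E = Fintype.card F ^ m)
    {v : F[X]} (hv : v.Monic) (hvirr : Irreducible v) {I : Ideal O}
    (hvI : algebraMap F[X] O v ∈ I) {l : ℕ} (hm : m = v.natDegree * l) {c : F[X]}
    (φ : E → O) (hφ : ∀ z, carlitz F O (v ^ l) (φ z) = φ z)
    (hφI : ∀ z, φ z - carlitz F O c (ι z) ∈ I) {s : ℕ} (hs : s < m) (hcs : c.natDegree < s) :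
    (1 + ∑ z : Eˣ, φ (z⁻¹ : Eˣ) * ι z ^ Fintype.card F ^ s) - 1 ∈ I := by
  have hdeg : (v ^ l * c).natDegree ≤ c.natDegree + m := by
    refine natDegree_mul_le.trans ?_
    rw [hv.natDegree_pow, hm, add_comm, mul_comm l]
  have h1 := Ideal.pow_le_self (by lia) (gauss_sum_congr ι hE hvirr hvI φ hφ hφI (by lia) hs)
  rw [carlitzCoeff_of_natDegree_lt (i := s + m) (by lia), map_zero, sub_zero] at h1
  have h2 : algebraMap F[X] O (carlitzCoeff (v ^ l * c) s) ∈ I := by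
    have h3 : s / v.natDegree < l := Nat.div_lt_of_lt_mul (by lia)
    obtain ⟨u, hu⟩ := (dvd_pow_self v (by lia)).trans (pow_dvd_carlitzCoeff_pow_mul hvirr c l s)
    rw [hu, map_mul]
    exact I.mul_mem_right _ hvI
  have h3 := I.sub_mem h1 h2
  convert h3 using 1
  ring

end Congruence

/-! ### Coincidences among the conjugates of the prime -/

section Multiplicity

variable {F : Type*} [Field F] [Fintype F]
variable {O : Type*} [CommRing O] [Algebra F O] [Algebra F[X] O]
  [IsScalarTower F F[X] O]
variable {E : Type*} [Field E] [Fintype E]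
variable {G : Type*} [Group G] [MulSemiringAction G O] [SMulCommClass G F[X] O]

/-- Equality of the two conjugate primes means that σ x modulo I is the q ^ t-th power of τ x, with
t = deg a - deg b. For x = θ this forces deg v to divide t; on torsion, where the q ^ (d * i)-th
power is C_(v ^ i), it gives a ≡ b * v ^ i mod n. Both sides have the same degree, below deg n, so
they agree. -/
theorem eq_mul_pow_of_smul_eq [IsDomain O] (ι : E →+* O) {m : ℕ} (hm : 0 < m)
    (hE : Fintype.card E = Fintype.card F ^ m)
    {v n : F[X]} (hv : v.Monic) (hvirr : Irreducible v) (hn : n.Monic) (hvn : IsCoprime v n)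
    (hcard : (torsion F O n).ncard = Fintype.card F ^ n.natDegree) {I : Ideal O} [I.IsPrime]
    (hI : ∀ f : F[X], algebraMap F[X] O f ∈ I ↔ v ∣ f) (hIE : ∀ x, ∃ c, x - ι c ∈ I)
    {a b : F[X]} (ha : a.Monic) (hb : b.Monic) (hadeg : a.degree < n.degree)
    (hab : b.natDegree ≤ a.natDegree) {σ τ : G}
    (hσ : ∀ z ∈ torsion F O n, σ • z = carlitz F O a z)
    (hσE : ∀ c, σ • ι c = ι c ^ Fintype.card F ^ a.natDegree)
    (hτ : ∀ z ∈ torsion F O n, τ • z = carlitz F O b z)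
    (hτE : ∀ c, τ • ι c = ι c ^ Fintype.card F ^ b.natDegree)
    (hστ : σ⁻¹ • I = τ⁻¹ • I) : ∃ i, a = b * v ^ i := by
  set t := a.natDegree - b.natDegree with ht
  have hιI {c : E} (hc : ι c ∈ I) : c = 0 := by
    by_contra h0
    refine (‹I.IsPrime›).ne_top ((Ideal.eq_top_iff_one I).mpr ?_)
    have := I.mul_mem_left (ι c⁻¹) hc
    rwa [← map_mul, inv_mul_cancel₀ h0, map_one] at this
  have hmem (x : O) : σ • x ∈ I ↔ τ • x ∈ I := by
    rw [← Ideal.mem_inv_pointwise_smul_iff, hστ, Ideal.mem_inv_pointwise_smul_iff]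
  have key (x : O) {c : E} (hc : τ • x - ι c ∈ I) : σ • x - ι c ^ Fintype.card F ^ t ∈ I := by
    -- This produces the q ^ (deg b)-th root of c in the residue field, so that τ x ≡ c becomes x -
    -- c' ∈ τ⁻¹ I = σ⁻¹ I.
    have hc' : (c ^ Fintype.card F ^ (m * b.natDegree - b.natDegree)) ^
        Fintype.card F ^ b.natDegree = c := by
      rw [← pow_mul, ← pow_add, Nat.sub_add_cancel (Nat.le_mul_of_pos_left _ hm)]
      have := pow_card_pow_eq_of_modEq (Q := Fintype.card F) (m := m) (s := m * b.natDegree)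
        (t := 0) (Nat.modEq_zero_iff_dvd.mpr (dvd_mul_right _ _)) (c := c)
        (by rw [← hE, FiniteField.pow_card])
      rwa [pow_zero, pow_one] at this
    set c' := c ^ Fintype.card F ^ (m * b.natDegree - b.natDegree)
    have h1 : τ • (x - ι c') ∈ I := by
      rwa [smul_sub, hτE, ← map_pow, hc']
    rw [← hmem, smul_sub, hσE] at h1
    have h2 : a.natDegree = b.natDegree + t := by lia
    rwa [h2, pow_add, pow_mul, ← map_pow, hc'] at h1
  have hdvd : v.natDegree ∣ t := by
    refine hvirr.natDegree_dvd_of_dvd_X_pow_card_pow_sub_X ?_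
    rw [← hI, Nat.card_eq_fintype_card, map_sub, map_pow]
    obtain ⟨c, hc⟩ := hIE (algebraMap F[X] O X)
    have h0 (g : G) : g • algebraMap F[X] O X = algebraMap F[X] O X := smul_algebraMap g X
    have h1 := key (algebraMap F[X] O X) (c := c) (by rwa [h0])
    rw [h0] at h1
    have h2 : algebraMap F[X] O X ^ Fintype.card F ^ t - ι c ^ Fintype.card F ^ t ∈ I := by
      rw [← frobenius_pow_sub]
      exact I.pow_mem_of_mem hc _ (pow_pos Fintype.card_pos _)
    have h3 := I.sub_mem h2 h1
    rwa [sub_sub_sub_cancel_right] at h3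
  obtain ⟨i, hi⟩ := hdvd
  refine ⟨i, ?_⟩
  have hvI : algebraMap F[X] O v ∈ I := (hI v).mpr dvd_rfl
  have hnI : algebraMap F[X] O n ∉ I := by
    rw [hI]
    exact fun h => hvirr.not_isUnit (hvn.isUnit_of_dvd' dvd_rfl h)
  have hdvd : n ∣ a - b * v ^ i := by
    refine dvd_of_carlitz_eq_zero hn hcard fun z hz => ?_
    have hz1 := carlitz_mem_torsion a hz
    have hz2 := carlitz_mem_torsion (b * v ^ i) hz
    rw [carlitz_sub]
    refine eq_zero_of_mem_torsion hnI (torsion_sub hz1 hz2) ?_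
    obtain ⟨c, hc⟩ := hIE (τ • z)
    have h1 := key z hc
    have h2 := I.pow_mem_of_mem hc (Fintype.card F ^ t) (pow_pos Fintype.card_pos _)
    rw [frobenius_pow_sub] at h2
    have h3 := carlitz_pow_sub_pow_mem hv hvirr hvI i (τ • z)
    rw [← hi] at h3
    rw [hσ z hz] at h1
    rw [hτ z hz] at h2 h3
    rw [mul_comm, carlitz_mul]
    have h4 := I.sub_mem h1 (I.add_mem h2 h3)
    convert! h4 using 1
    ring
  have hbv : (b * v ^ i).natDegree = a.natDegree := by
    rw [hb.natDegree_mul (hv.pow i), hv.natDegree_pow, mul_comm i, ← hi]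
    lia
  refine sub_eq_zero.mp (eq_zero_of_dvd_of_degree_lt hdvd ?_)
  refine (degree_sub_le _ _).trans_lt (max_lt hadeg ?_)
  rw [degree_eq_natDegree (hb.mul (hv.pow i)).ne_zero, hbv, ← degree_eq_natDegree ha.ne_zero]
  exact hadeg

/-- The product of the conjugates of `I` divides `x`, if `x` is in high enough powers of them. -/
theorem prod_smul_dvd_span [IsDedekindDomain O] (ι : E →+* O) {m : ℕ}
    (hE : Fintype.card E = Fintype.card F ^ m)
    {v n : F[X]} (hv : v.Monic) (hvirr : Irreducible v) (hn : n.Monic) (hvn : IsCoprime v n)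
    (hcard : (torsion F O n).ncard = Fintype.card F ^ n.natDegree) {I : Ideal O} [I.IsMaximal]
    (hI : ∀ f : F[X], algebraMap F[X] O f ∈ I ↔ v ∣ f) (hIE : ∀ x, ∃ c, x - ι c ∈ I)
    (hm : 0 < m) {S : Finset F[X]} (hS : ∀ a ∈ S, a.Monic ∧ a.degree < n.degree)
    {σ : F[X] → G} (hσ : ∀ a ∈ S, ∀ z ∈ torsion F O n, σ a • z = carlitz F O a z)
    (hσE : ∀ a ∈ S, ∀ c, σ a • ι c = ι c ^ Fintype.card F ^ a.natDegree) {x : O}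
    (hx : ∀ a ∈ S, ∃ e, n.natDegree ≤ v.natDegree * e + a.natDegree ∧ σ a • x ∈ I ^ e) :
    ∏ a ∈ S, (σ a)⁻¹ • I ∣ Ideal.span {x} := by
  classical
  have hd := hvirr.natDegree_pos
  have hlt {a : F[X]} (ha : a ∈ S) : a.natDegree < n.natDegree :=
    natDegree_lt_natDegree (hS a ha).1.ne_zero (hS a ha).2
  have hmax (g : G) : (g • I).IsMaximal := by
    rw [Ideal.pointwise_smul_eq_comap]
    exact Ideal.comap_isMaximal_of_equiv _
  rw [Finset.prod_comp (fun J : Ideal O => J) (fun a => (σ a)⁻¹ • I)]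
  refine Finset.prod_dvd_of_coprime ?_ ?_
  · intro J hJ J' hJ' hne
    obtain ⟨a, _, rfl⟩ := Finset.mem_image.mp hJ
    obtain ⟨b, _, rfl⟩ := Finset.mem_image.mp hJ'
    have := hmax (σ a)⁻¹
    have := hmax (σ b)⁻¹
    exact (Ideal.isCoprime_of_isMaximal hne).pow
  · intro J hJ
    obtain ⟨a, ha, rfl⟩ := Finset.mem_image.mp hJ
    set T := S.filter fun b => (σ b)⁻¹ • I = (σ a)⁻¹ • I with hT
    obtain ⟨b, hbT, hbmin⟩ := T.exists_min_image natDegree ⟨a, Finset.mem_filter.mpr ⟨ha, rfl⟩⟩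
    obtain ⟨hbS, hbI⟩ := Finset.mem_filter.mp hbT
    obtain ⟨e, he, hxe⟩ := hx b hbS
    -- The members of the fibre are b * v ^ i with deg b + d * i < deg n ≤ d * e + deg b, which
    -- leaves only i < e. Minimality of deg b makes one exponent serve the whole fibre.
    have hTe : T.card ≤ e := by
      have hsub : T ⊆ (Finset.range e).image fun i => b * v ^ i := by
        intro c hc
        obtain ⟨hcS, hcI⟩ := Finset.mem_filter.mp hc
        have hcn := hlt hcS
        obtain ⟨i, hi⟩ := eq_mul_pow_of_smul_eq ι hm hE hv hvirr hn hvn hcard hI hIE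
          (hS c hcS).1 (hS b hbS).1 (hS c hcS).2 (hbmin c hc) (hσ c hcS) (hσE c hcS)
          (hσ b hbS) (hσE b hbS) (hcI.trans hbI.symm)
        refine Finset.mem_image.mpr ⟨i, Finset.mem_range.mpr ?_, hi.symm⟩
        rw [hi, (hS b hbS).1.natDegree_mul (hv.pow i), hv.natDegree_pow] at hcn
        by_contra! hie
        have := Nat.mul_le_mul_left v.natDegree hie
        lia
      exact (Finset.card_le_card hsub).trans (Finset.card_image_le.trans (by simp))
    refine (pow_dvd_pow _ hTe).trans ?_
    rw [← hbI, ← smul_pow', Ideal.dvd_span_singleton, Ideal.mem_inv_pointwise_smul_iff]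
    exact hxe

end Multiplicity

/-! ### Trace identity and constant field extensions -/

section ConstantExtension

variable {F : Type*} [Field F] [Fintype F]
variable {E : Type*} [Field E] {A O : Type*} [CommRing A] [CommRing O]

/-- Orthogonality isolates the term s = 0. With f(s) = τ^s(y) it recovers y from the traces of its
constant multiples, so the family of all nonzero constants replaces a dual basis. -/
theorem sum_units_inv_mul_sum_pow [Fintype E] [DecidableEq E] {m : ℕ} (hm : 0 < m) (hE : Fintype.card E = Fintype.card F ^ m)
    (ι : E →+* O) (f : ℕ → O) :
    ∑ z : Eˣ, ι (z⁻¹ : Eˣ) * ∑ s ∈ Finset.range m, ι z ^ Fintype.card F ^ s * f s = -f 0 := by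
  have h1 (z : Eˣ) : ι (z⁻¹ : Eˣ) * ∑ s ∈ Finset.range m, ι z ^ Fintype.card F ^ s * f s =
      ∑ s ∈ Finset.range m,
        ι (((z⁻¹ : Eˣ) : E) ^ Fintype.card F ^ 0 * (z : E) ^ Fintype.card F ^ s) * f s := by
    rw [Finset.mul_sum]
    refine Finset.sum_congr rfl fun s _ => ?_
    rw [map_mul, map_pow, map_pow, pow_zero, pow_one, mul_assoc]
  simp only [h1]
  rw [Finset.sum_comm]
  simp only [← Finset.sum_mul, ← map_sum]
  rw [Finset.sum_eq_single 0]
  · rw [sum_units_inv_pow_mul_pow Fintype.one_lt_card hE hm (by lia), if_pos (by lia), map_neg,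
      map_one, neg_one_mul]
  · intro s hs hs0
    rw [sum_units_inv_pow_mul_pow Fintype.one_lt_card hE (Finset.mem_range.mp hs) (by lia),
      if_neg (by lia), map_zero, zero_mul]
  · simp; lia

variable [Algebra F E] [Algebra F A] [Algebra F O]
variable {i : A →ₐ[F] O} {ι : E →ₐ[F] O} {m : ℕ} {τ : O →+* O}

theorem iterate_const (hι : ∀ c, τ (ι c) = ι c ^ Fintype.card F) (s : ℕ) (c : E) :
    τ^[s] (ι c) = ι c ^ Fintype.card F ^ s := by
  induction s with
  | zero => simp
  | succ s ih => rw [Function.iterate_succ_apply', ih, map_pow, hι, ← pow_mul, ← pow_succ']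

variable [Fintype E] [DecidableEq E]

theorem eq_neg_sum_inv_mul_sum_iterate (hm : 0 < m)
    (hE : Fintype.card E = Fintype.card F ^ m)
    (hι : ∀ c, τ (ι c) = ι c ^ Fintype.card F) (y : O) :
    y = -∑ z : Eˣ, ι (z⁻¹ : Eˣ) * ∑ s ∈ Finset.range m, τ^[s] (ι z * y) := by
  have h := sum_units_inv_mul_sum_pow hm hE (ι : E →+* O) (fun s => τ^[s] y)
  have h1 (z : Eˣ) (s : ℕ) : τ^[s] (ι z * y) = ι z ^ Fintype.card F ^ s * τ^[s] y := by
    rw [iterate_map_mul, iterate_const hι]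
  simp only [h1]
  simp only [RingHom.coe_coe, Function.iterate_zero, id_eq] at h
  rw [h, neg_neg]

theorem map_sum_iterate {m : ℕ} {τ : O →+* O} (hτ : ∀ y, τ^[m] y = y) (y : O) :
    τ (∑ s ∈ Finset.range m, τ^[s] y) = ∑ s ∈ Finset.range m, τ^[s] y := by
  have h := Finset.sum_range_succ (fun s => τ^[s] y) m
  rw [Finset.sum_range_succ', hτ, Function.iterate_zero, id_eq] at h
  rw [map_sum, ← add_right_cancel h]
  simp only [Function.iterate_succ_apply']

/-- If `O` is a cyclic Galois extension of `A` whose Galois group is that of the constant field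
extension `E / F`, then `O = E ⊗ A`. -/
theorem productMap_bijective (hm : 0 < m) (hE : Fintype.card E = Fintype.card F ^ m)
    (hinj : Function.Injective i) (hi : ∀ x, τ (i x) = i x)
    (hι : ∀ c, τ (ι c) = ι c ^ Fintype.card F) (hτ : ∀ y, τ^[m] y = y)
    (hfix : ∀ y, τ y = y → ∃ x, i x = y) :
    Function.Bijective (Algebra.TensorProduct.productMap ι i) := by
  set p := Algebra.TensorProduct.productMap ι i
  have hT : ∀ y, ∃ x, i x = ∑ s ∈ Finset.range m, τ^[s] y := fun y =>
    hfix _ (map_sum_iterate hτ y)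
  choose T hT using hT
  have hT0 : T 0 = 0 := hinj (by rw [hT, map_zero]; simp [iterate_map_zero])
  have hTadd (x y : O) : T (x + y) = T x + T y := hinj (by
    rw [map_add, hT, hT, hT, ← Finset.sum_add_distrib]
    exact Finset.sum_congr rfl fun s _ => iterate_map_add τ s x y)
  constructor
  · rw [injective_iff_map_eq_zero]
    intro t ht
    -- The trace identity lifted to the tensor product; its right side depends only on the image p
    -- t, which gives injectivity. The same expression, with y in place of p t, is a preimage of y.
    have key : t = -∑ z : Eˣ, ((z⁻¹ : Eˣ) : E) ⊗ₜ[F] T (ι z * p t) := by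
      clear ht
      induction t with
      | zero => simp [hT0]
      | add x y hx hy =>
        conv_lhs => rw [hx, hy]
        rw [← neg_add, ← Finset.sum_add_distrib]
        simp only [map_add, mul_add, hTadd, TensorProduct.tmul_add]
      | tmul ε α =>
        have hfr : Module.finrank F E = m := by
          have := Module.card_eq_pow_finrank (K := F) (V := E)
          rw [hE] at this
          exact (Nat.pow_right_injective Fintype.one_lt_card this).symm
        have h1 (z : Eˣ) : T (ι z * p (ε ⊗ₜ α)) = Algebra.trace F E (z * ε) • α := by
          apply hinj
          have h2 : algebraMap F O (Algebra.trace F E (z * ε)) =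
              ∑ s ∈ Finset.range m, ι (z * ε) ^ Fintype.card F ^ s := by
            rw [← ι.commutes, FiniteField.algebraMap_trace_eq_sum_pow, hfr, map_sum,
              Nat.card_eq_fintype_card]
            simp only [map_pow]
          have h3 (s : ℕ) : τ^[s] (i α) = i α := Function.iterate_fixed (hi α) s
          rw [hT, map_smul, Algebra.smul_def, h2, Finset.sum_mul]
          refine Finset.sum_congr rfl fun s _ => ?_
          rw [Algebra.TensorProduct.productMap_apply_tmul, ← mul_assoc, ← map_mul, iterate_map_mul,
            iterate_const hι, h3]
        have h4 : ∑ z : Eˣ, Algebra.trace F E (z * ε) • ((z⁻¹ : Eˣ) : E) = -ε := by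
          have h := sum_units_inv_mul_sum_pow hm hE (RingHom.id E)
            (fun s => ε ^ Fintype.card F ^ s)
          simp only [RingHom.id_apply, pow_zero, pow_one, ← mul_pow] at h
          rw [← h]
          refine Finset.sum_congr rfl fun z _ => ?_
          rw [Algebra.smul_def, FiniteField.algebraMap_trace_eq_sum_pow, hfr,
            Nat.card_eq_fintype_card, mul_comm]
        have h5 : ∑ z : Eˣ, ((z⁻¹ : Eˣ) : E) ⊗ₜ[F] T (ι z * p (ε ⊗ₜ α)) = -(ε ⊗ₜ α) := by
          rw [← TensorProduct.neg_tmul, ← h4, TensorProduct.sum_tmul]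
          refine Finset.sum_congr rfl fun z _ => ?_
          rw [h1, TensorProduct.smul_tmul]
        rw [h5, neg_neg]
    rw [key, ht]
    simp [hT0]
  · intro y
    refine ⟨-∑ z : Eˣ, ((z⁻¹ : Eˣ) : E) ⊗ₜ[F] T (ι z * y), ?_⟩
    rw [map_neg, map_sum]
    simp only [p, Algebra.TensorProduct.productMap_apply_tmul, hT]
    exact (eq_neg_sum_inv_mul_sum_iterate hm hE hι y).symm

end ConstantExtension

/-! ### The automorphisms σ_(a,s) and the tensor decomposition of O_(n,m) -/

section Sigma

variable {F : Type*} [Field F] [Fintype F] {n : F[X]} {m : ℕ}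

theorem sigma_mul (hn : n.Monic) (hm : 0 < m) {a b : F[X]} (ha : IsCoprime a n)
    (hb : IsCoprime b n) (s t : ℕ) :
    sigma n m a s * sigma n m b t = sigma n m (a * b) (s + t) := by
  obtain ⟨h1, h2⟩ := sigma_spec hn hm ha s
  obtain ⟨h3, h4⟩ := sigma_spec hn hm hb t
  obtain ⟨h5, h6⟩ := sigma_spec hn hm (ha.mul_left hb) (s + t)
  refine compField_algEquiv_ext (fun z hz => ?_) (fun c hc => ?_)
  · rw [AlgEquiv.mul_apply, h3 z hz, h1 _ (carlitz_mem_torsion b hz), h5 z hz, carlitz_mul]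
  · rw [AlgEquiv.mul_apply, h4 c hc, map_pow, h2 c hc, h6 c hc, pow_add, pow_mul]

theorem sigma_congr (hn : n.Monic) (hm : 0 < m) {a b : F[X]} (ha : IsCoprime a n)
    (hb : IsCoprime b n) (hab : n ∣ a - b) {s t : ℕ} (hst : s ≡ t [MOD m]) :
    sigma n m a s = sigma n m b t := by
  obtain ⟨h1, h2⟩ := sigma_spec hn hm ha s
  obtain ⟨h3, h4⟩ := sigma_spec hn hm hb t
  refine compField_algEquiv_ext (fun z hz => ?_) (fun c hc => ?_)
  · rw [h1 z hz, h3 z hz, carlitz_eq_of_dvd_sub hab hz]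
  · rw [h2 c hc, h4 c hc]
    exact pow_card_pow_eq_of_modEq hst (Subtype.ext ((mem_constField_iff hm).mp hc))

theorem sigma_one_zero (hn : n.Monic) (hm : 0 < m) : sigma n m 1 0 = 1 := by
  obtain ⟨h1, h2⟩ := sigma_spec hn hm isCoprime_one_left 0
  refine compField_algEquiv_ext (fun z hz => ?_) (fun c hc => ?_)
  · rw [h1 z hz, carlitz_one, AlgEquiv.one_apply]
  · rw [h2 c hc, pow_zero, pow_one, AlgEquiv.one_apply]

theorem sigma_one_one_pow (hn : n.Monic) (hm : 0 < m) (s : ℕ) :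
    sigma n m 1 1 ^ s = sigma n m 1 s := by
  induction s with
  | zero => rw [pow_zero, sigma_one_zero hn hm]
  | succ s ih =>
    rw [pow_succ, ih, sigma_mul hn hm isCoprime_one_left isCoprime_one_left, mul_one]

theorem sigma_one_one_pow_eq_one (hn : n.Monic) (hm : 0 < m) : sigma n m 1 1 ^ m = 1 := by
  rw [sigma_one_one_pow hn hm, ← sigma_one_zero hn hm]
  exact sigma_congr hn hm isCoprime_one_left isCoprime_one_left (by simp) (by simp [Nat.ModEq])

theorem sigma_smul_torsion (hn : n.Monic) (hm : 0 < m) {a : F[X]} (ha : IsCoprime a n) (s : ℕ)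
    {z : integers (compField F n m)} (hz : z ∈ torsion F (integers (compField F n m)) n) :
    sigma n m a s • z = carlitz F (integers (compField F n m)) a z := by
  apply Subtype.ext
  rw [integralClosure.coe_smul]
  exact ((sigma_spec hn hm ha s).1 _ ((coe_mem_torsion_integers_iff _).mpr hz)).trans
    (carlitz_map (integers (compField F n m)).val a z).symm

theorem smul_eq_pow_of_apply_eq_pow {K : IntermediateField (RatFunc F) (kbar F)}
    {σ : Gal(K/RatFunc F)} {y : integers K} {k : ℕ} (h : σ (y : K) = (y : K) ^ k) :
    σ • y = y ^ k := by
  apply Subtype.ext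
  rw [integralClosure.coe_smul, SubmonoidClass.coe_pow, ← h, AlgEquiv.smul_def]

theorem coe_constIncl (n : F[X]) (m : ℕ) (c : constField F m) :
    ((constIncl n m c : compField F n m) : kbar F) = c := by
  unfold constIncl
  rw [AlgHom.coe_mk]
  rfl

theorem coe_constIncl_mem (n : F[X]) (m : ℕ) (c : constField F m) :
    ((constIncl n m c : compField F n m) : kbar F) ∈ constField F m := by
  rw [coe_constIncl]
  exact SetLike.coe_mem c

theorem sigma_smul_constIncl (hn : n.Monic) (hm : 0 < m) {a : F[X]} (ha : IsCoprime a n) (s : ℕ)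
    (c : constField F m) :
    sigma n m a s • constIncl n m c = constIncl n m c ^ Fintype.card F ^ s := by
  have h := (sigma_spec hn hm ha s).2 _ (coe_constIncl_mem n m c)
  exact smul_eq_pow_of_apply_eq_pow h

theorem cycField_algHom_ext {L : Type*} [Field L] [Algebra (RatFunc F) L]
    {σ τ : cycField F n →ₐ[RatFunc F] L}
    (h : ∀ z : cycField F n, z ∈ torsion F (cycField F n) n → σ z = τ z) : σ = τ :=
  IntermediateField.algHom_ext_of_eq_adjoin (S := cycField F n) _ rfl fun _ hx =>
    h _ ((coe_mem_torsion_iff _).mp hx)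

theorem sigma_inclusion (hn : n.Monic) (hm : 0 < m) {a : F[X]} (ha : IsCoprime a n) (s : ℕ)
    (x : cycField F n) :
    sigma n m a s (IntermediateField.inclusion (cycField_le_compField n m) x) =
      IntermediateField.inclusion (cycField_le_compField n m) (rho n a x) := by
  set i := IntermediateField.inclusion (cycField_le_compField (F := F) n m)
  have h : (sigma n m a s : compField F n m →ₐ[RatFunc F] compField F n m).comp i =
      i.comp (rho n a : cycField F n →ₐ[RatFunc F] cycField F n) := by
    refine cycField_algHom_ext fun z hz => ?_
    have h1 : i z ∈ torsion F (compField F n m) n := torsion_map (i.restrictScalars F[X]) hz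
    exact ((sigma_spec hn hm ha s).1 _ h1).trans
      ((carlitz_map (i.restrictScalars F[X]) a z).symm.trans
        (congrArg i (rho_spec hn ha z hz).symm))
  exact DFunLike.congr_fun h x

theorem sigma_smul_integersIncl (hn : n.Monic) (hm : 0 < m) {a : F[X]} (ha : IsCoprime a n) (s : ℕ)
    (x : integers (cycField F n)) :
    sigma n m a s • integersIncl n m x = integersIncl n m (rho n a • x) :=
  Subtype.ext (sigma_inclusion hn hm ha s x)

theorem integersIncl_injective (n : F[X]) (m : ℕ) : Function.Injective (integersIncl n m) := by
  intro x y h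
  have h1 := congrArg Subtype.val h
  exact Subtype.ext ((IntermediateField.inclusion (cycField_le_compField n m)).injective h1)

theorem rho_one (hn : n.Monic) : rho n (1 : F[X]) = 1 := by
  refine AlgEquiv.coe_toAlgHom_injective (cycField_algHom_ext fun z hz => ?_)
  exact (rho_spec hn isCoprime_one_left z hz).trans (carlitz_one z)

/-- An automorphism trivial on K_n is determined by its Frobenius exponent on constants, so it is a
power of τ_q = σ_(1,1); the fixed field of τ_q is therefore K_n. -/
theorem exists_inclusion_eq (hn : n.Monic) (hm : 0 < m) {y : compField F n m}
    (hy : sigma n m 1 1 y = y) :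
    ∃ x, IntermediateField.inclusion (cycField_le_compField n m) x = y := by
  obtain ⟨_, _⟩ := isGalois_compField hn hm
  set i := IntermediateField.inclusion (cycField_le_compField (F := F) n m)
  suffices h : y ∈ i.fieldRange from h
  rw [← IsGalois.fixedField_fixingSubgroup i.fieldRange, IntermediateField.mem_fixedField_iff]
  intro σ hσ
  rw [IntermediateField.mem_fixingSubgroup_iff] at hσ
  obtain ⟨s, -, hs⟩ := exists_forall_const_eq_pow hm
    (fun c hc => mem_compField_of_mem_constField n m hc) σ
  have h1 : σ = sigma n m 1 1 ^ s := by
    rw [sigma_one_one_pow hn hm]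
    obtain ⟨h3, h4⟩ := sigma_spec hn hm isCoprime_one_left s
    refine compField_algEquiv_ext (fun z hz => ?_) (fun c hc => ?_)
    · rw [h3 z hz, carlitz_one]
      refine hσ z ⟨⟨z, torsion_subset_cycField n ((coe_mem_torsion_iff _).mpr hz)⟩, rfl⟩
    · rw [hs c hc, h4 c hc]
  rw [h1]
  clear h1 hs hσ
  induction s with
  | zero => rw [pow_zero, AlgEquiv.one_apply]
  | succ s ih => rw [pow_succ, AlgEquiv.mul_apply, hy, ih]

theorem exists_integersIncl_eq (hn : n.Monic) (hm : 0 < m) {y : integers (compField F n m)}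
    (hy : sigma n m 1 1 • y = y) : ∃ x, integersIncl n m x = y := by
  obtain ⟨x, hx⟩ := exists_inclusion_eq hn hm (congrArg Subtype.val hy)
  have hxi : IsIntegral F[X] x := by
    refine (isIntegral_algHom_iff
      ((IntermediateField.inclusion (cycField_le_compField n m)).restrictScalars F[X])
      (IntermediateField.inclusion (cycField_le_compField n m)).injective).mp ?_
    rw [AlgHom.restrictScalars_apply, hx]
    exact y.2
  exact ⟨⟨x, hxi⟩, Subtype.ext hx⟩

theorem smul_iterate {G O : Type*} [Group G] [Semiring O] [MulSemiringAction G O] (g : G) (s : ℕ)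
    (y : O) : (MulSemiringAction.toRingHom G O g)^[s] y = g ^ s • y := by
  induction s with
  | zero => simp
  | succ s ih =>
    rw [Function.iterate_succ_apply', ih, MulSemiringAction.toRingHom_apply, ← mul_smul, pow_succ']

theorem tensorIntegers_bijective (hn : n.Monic) (hm : 0 < m) :
    Function.Bijective (tensorIntegers n m) := by
  classical
  have := finite_constField (F := F) hm
  have := Fintype.ofFinite (constField F m)
  refine productMap_bijective (τ := MulSemiringAction.toRingHom _ _ (sigma n m 1 1)) hm ?_
    (integersIncl_injective n m) (fun x => ?_) (fun c => ?_) (fun y => ?_) (fun y hy => ?_)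
  · rw [← Nat.card_eq_fintype_card, natCard_constField hm]
  · rw [MulSemiringAction.toRingHom_apply]
    refine (sigma_smul_integersIncl hn hm isCoprime_one_left 1 x).trans ?_
    rw [rho_one hn, one_smul]
    rfl
  · rw [MulSemiringAction.toRingHom_apply, sigma_smul_constIncl hn hm isCoprime_one_left, pow_one]
  · rw [smul_iterate, sigma_one_one_pow_eq_one hn hm, one_smul]
  · exact exists_integersIncl_eq hn hm hy

/-- Transports the residue map ε ⊗ α ↦ ε ψ(α) through the tensor isomorphism, so that membership in
the prime can be tested on constants and on O_n separately. -/
theorem exists_residue_primeAbove (hn : n.Monic) (hm : 0 < m)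
    (P : Ideal (integers (cycField F n)))
    (ψ : (integers (cycField F n) ⧸ P) ≃ₐ[F] constField F m) :
    ∃ χ : integers (compField F n m) →ₐ[F] constField F m,
      (∀ c, χ (constIncl n m c) = c) ∧
      (∀ x, χ (integersIncl n m x) = ψ (Ideal.Quotient.mk P x)) ∧
      primeAbove P ψ = RingHom.ker χ := by
  let e := AlgEquiv.ofBijective (tensorIntegers (F := F) n m) (tensorIntegers_bijective hn hm)
  have he (t) : e t = tensorIntegers n m t := rfl
  have hs (t) : (tensorResidue P ψ).comp e.symm.toAlgHom (e t) = tensorResidue P ψ t :=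
    congrArg _ (e.symm_apply_apply t)
  refine ⟨(tensorResidue P ψ).comp e.symm.toAlgHom, fun c => ?_, fun x => ?_, ?_⟩
  · have h : e (c ⊗ₜ 1) = constIncl n m c := by
      rw [he, tensorIntegers, Algebra.TensorProduct.productMap_left_apply]
    rw [← h, hs, tensorResidue, Algebra.TensorProduct.productMap_left_apply, AlgHom.id_apply]
  · have h : e (1 ⊗ₜ x) = integersIncl n m x := by
      rw [he, tensorIntegers, Algebra.TensorProduct.productMap_right_apply]
      rfl
    rw [← h, hs, tensorResidue, Algebra.TensorProduct.productMap_right_apply]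
    rfl
  · ext y
    obtain ⟨t, rfl⟩ := e.surjective y
    rw [RingHom.mem_ker, hs, primeAbove,
      Ideal.mem_map_iff_of_surjective _ (tensorIntegers_bijective hn hm).2]
    constructor
    · rintro ⟨u, hu, hut⟩
      rw [← he] at hut
      rw [← e.injective hut]
      exact hu
    · intro h
      exact ⟨t, h, rfl⟩

end Sigma

/-! ### Reduction of torsion points and its inverse -/

section Teichmuller

variable {F : Type*} [Field F] [Fintype F]
variable {R : Type*} [CommRing R] [Algebra F R] [Algebra F[X] R] [IsScalarTower F F[X] R]
variable {n : F[X]} {I : Ideal R}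

theorem carlitz_mk (a : F[X]) {x : R} {y : R ⧸ I} (h : Ideal.Quotient.mk I x = y) :
    Ideal.Quotient.mk I (carlitz F R a x) = carlitz F (R ⧸ I) a y := by
  rw [← h]
  exact carlitz_map (Ideal.Quotient.mkₐ F[X] I) a x

theorem torsion_of_dvd {c : F[X]} (hc : ∀ y : R, carlitz F R (n * c) y = 0) (y : R) :
    carlitz F R c y ∈ torsion F R n := by
  rw [mem_torsion, ← carlitz_mul, hc]

theorem carlitz_pow_sub_one_eq_zero {v : F[X]} (hv : v.Monic) (hvirr : Irreducible v)
    (hvR : algebraMap F[X] R v = 0) {l : ℕ}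
    (hR : ∀ y : R, y ^ Fintype.card F ^ (v.natDegree * l) = y) (y : R) :
    carlitz F R (v ^ l - 1) y = 0 := by
  have h := carlitz_pow_sub_pow_mem (L := R) hv hvirr (I := ⊥)
    (by rw [Ideal.mem_bot]; exact hvR) l y
  rw [hR, Ideal.mem_bot] at h
  rw [carlitz_sub, carlitz_one, h]

variable [IsDomain R]

theorem injOn_mk_torsion (hnI : algebraMap F[X] R n ∉ I) :
    Set.InjOn (Ideal.Quotient.mk I) (torsion F R n) := fun _ hx _ hy h =>
  sub_eq_zero.mp (eq_zero_of_mem_torsion hnI (torsion_sub hx hy) (Ideal.Quotient.eq.mp h))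

/-- Reduction is injective on torsion, and the residue ring has at most q ^ (deg n) torsion points,
which is the number upstairs; so it is a bijection and has a genuine inverse. -/
theorem invFunOn_mk_spec (hn : n.Monic) (hcard : (torsion F R n).ncard = Fintype.card F ^ n.natDegree)
    [I.IsPrime] (hnI : algebraMap F[X] R n ∉ I) {y : R ⧸ I} (hy : y ∈ torsion F (R ⧸ I) n) :
    Function.invFunOn (Ideal.Quotient.mk I) (torsion F R n) y ∈ torsion F R n ∧
      Ideal.Quotient.mk I (Function.invFunOn (Ideal.Quotient.mk I) (torsion F R n) y) = y := by
  have h : Ideal.Quotient.mk I '' torsion F R n = torsion F (R ⧸ I) n := by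
    refine Set.eq_of_subset_of_ncard_le ?_ ?_ (finite_torsion hn)
    · rintro _ ⟨x, hx, rfl⟩
      exact torsion_map (Ideal.Quotient.mkₐ F[X] I) hx
    · rw [(injOn_mk_torsion hnI).ncard_image, hcard]
      exact ncard_torsion_le hn
  rw [← h] at hy
  exact ⟨Function.invFunOn_mem hy, Function.invFunOn_eq hy⟩

theorem carlitz_invFunOn_mk (hn : n.Monic)
    (hcard : (torsion F R n).ncard = Fintype.card F ^ n.natDegree)
    [I.IsPrime] (hnI : algebraMap F[X] R n ∉ I) {y : R ⧸ I} (hy : y ∈ torsion F (R ⧸ I) n)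
    (a : F[X]) : carlitz F R a (Function.invFunOn (Ideal.Quotient.mk I) (torsion F R n) y) =
      Function.invFunOn (Ideal.Quotient.mk I) (torsion F R n) (carlitz F (R ⧸ I) a y) := by
  have h1 := invFunOn_mk_spec hn hcard hnI hy
  have h2 := invFunOn_mk_spec hn hcard hnI (carlitz_mem_torsion a hy)
  exact injOn_mk_torsion hnI (carlitz_mem_torsion a h1.1) h2.1
    ((carlitz_mk a h1.2).trans h2.2.symm)

/-- Torsion points inject into the residue ring, so an operator that vanishes there annihilates the
whole n-torsion. Applied to v ^ l - 1, it shows that n divides it. -/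
theorem dvd_of_carlitz_quotient_eq_zero (hn : n.Monic)
    (hcard : (torsion F R n).ncard = Fintype.card F ^ n.natDegree) {a : F[X]}
    (hnI : algebraMap F[X] R n ∉ I) (ha : ∀ y : R ⧸ I, carlitz F (R ⧸ I) a y = 0) : n ∣ a := by
  refine dvd_of_carlitz_eq_zero hn hcard fun z hz => ?_
  refine eq_zero_of_mem_torsion hnI (carlitz_mem_torsion a hz) ?_
  rw [← Ideal.Quotient.eq_zero_iff_mem, carlitz_mk a rfl, ha]

variable {O : Type*} [CommRing O] [Algebra F O] [Algebra F[X] O] [IsScalarTower F F[X] O]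

theorem map_invFunOn_sub_mem (hn : n.Monic)
    (hcard : (torsion F R n).ncard = Fintype.card F ^ n.natDegree) [I.IsPrime]
    (hnI : algebraMap F[X] R n ∉ I) (i : R →ₐ[F[X]] O) {J : Ideal O} {w : O} {y : R ⧸ I}
    (hI : ∀ x ∈ I, i x ∈ J) (hw : ∀ x, Ideal.Quotient.mk I x = y → i x - w ∈ J) {c : F[X]}
    (hy : carlitz F (R ⧸ I) c y ∈ torsion F (R ⧸ I) n) :
    i (Function.invFunOn (Ideal.Quotient.mk I) (torsion F R n) (carlitz F (R ⧸ I) c y)) -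
      carlitz F O c w ∈ J := by
  obtain ⟨x, hx⟩ := Ideal.Quotient.mk_surjective y
  have h1 := (invFunOn_mk_spec hn hcard hnI hy).2
  rw [← carlitz_mk c hx, Ideal.Quotient.eq] at h1
  have h2 := hI _ h1
  have h3 := carlitz_mem_ideal J c (hw x hx)
  rw [map_sub, carlitz_map] at h2
  rw [map_sub] at h3
  rw [carlitz_mk c hx] at h2
  have h4 := add_mem h2 h3
  rwa [sub_add_sub_cancel] at h4

end Teichmuller

/-! ### Teichmüller points in O_(n,m) -/

section TeichPoint

variable {F : Type*} [Field F] [Fintype F] {n : F[X]} {P : Ideal (integers (cycField F n))}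
variable {m : ℕ}

variable (P) in
/-- The torsion point of `K_{n,m}` that reduces to `C_c(z)`. -/
def teichPoint (ψ : (integers (cycField F n) ⧸ P) ≃ₐ[F] constField F m) (c : F[X])
    (z : constField F m) : integers (compField F n m) :=
  integersIncl n m (teichmuller P (carlitz F _ c (ψ.symm z)))

theorem teichPoint_mem_torsion (hn : n.Monic) [P.IsPrime] (hnP : algebraMap F[X] _ n ∉ P)
    {c : F[X]} (hc : ∀ y : integers (cycField F n) ⧸ P, carlitz F _ (n * c) y = 0)
    (ψ : (integers (cycField F n) ⧸ P) ≃ₐ[F] constField F m) (z : constField F m) :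
    teichPoint P ψ c z ∈ torsion F (integers (compField F n m)) n :=
  torsion_map (integersIncl n m) (invFunOn_mk_spec hn
    (ncard_torsion_integers hn (torsion_subset_cycField n)) hnP (torsion_of_dvd hc _)).1

theorem carlitz_teichPoint (hn : n.Monic) [P.IsPrime] (hnP : algebraMap F[X] _ n ∉ P)
    {c : F[X]} (hc : ∀ y : integers (cycField F n) ⧸ P, carlitz F _ (n * c) y = 0)
    (ψ : (integers (cycField F n) ⧸ P) ≃ₐ[F] constField F m) (a : F[X]) (z : constField F m) :
    carlitz F _ a (teichPoint P ψ c z) = teichPoint P ψ (a * c) z := by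
  have h := carlitz_invFunOn_mk hn (ncard_torsion_integers hn (torsion_subset_cycField n)) hnP
    (torsion_of_dvd hc (ψ.symm z)) a
  rw [← carlitz_mul] at h
  exact (carlitz_map (integersIncl n m) a _).symm.trans (congrArg (integersIncl n m) h)

theorem teichPoint_sub_mem (hn : n.Monic) (hm : 0 < m) [P.IsPrime] (hnP : algebraMap F[X] _ n ∉ P)
    {c : F[X]} (hc : ∀ y : integers (cycField F n) ⧸ P, carlitz F _ (n * c) y = 0)
    (ψ : (integers (cycField F n) ⧸ P) ≃ₐ[F] constField F m) (z : constField F m) :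
    teichPoint P ψ c z - carlitz F _ c (constIncl n m z) ∈ primeAbove P ψ := by
  obtain ⟨χ, h1, h2, h3⟩ := exists_residue_primeAbove hn hm P ψ
  refine map_invFunOn_sub_mem hn (ncard_torsion_integers hn (torsion_subset_cycField n)) hnP
    (integersIncl n m) (fun x hx => ?_) (fun x hx => ?_) (torsion_of_dvd hc (ψ.symm z))
  · rw [h3, RingHom.mem_ker, h2, Ideal.Quotient.eq_zero_iff_mem.mpr hx, map_zero]
  · rw [h3, RingHom.mem_ker, map_sub, h1, h2, hx, AlgEquiv.apply_symm_apply, sub_self]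

end TeichPoint

/-! ### Conjugates of the Gauss sum -/

section GaussConj

variable {F : Type*} [Field F] [Fintype F] {n : F[X]} {m : ℕ}
  [Fintype (constField F m)] [DecidableEq (constField F m)]

/-- The conjugates `1 + ∑ ω(C_c(z⁻¹)) ψ(z) ^ (q ^ s)` of the geometric Gauss sum. -/
def gaussConj (P : Ideal (integers (cycField F n)))
    (ψ : (integers (cycField F n) ⧸ P) ≃ₐ[F] constField F m) (c : F[X]) (s : ℕ) :
    integers (compField F n m) :=
  1 + ∑ z : (constField F m)ˣ, teichPoint P ψ c (z⁻¹ : (constField F m)ˣ) *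
    constIncl n m z ^ Fintype.card F ^ s

variable {P : Ideal (integers (cycField F n))}

/-- The automorphism acts on the Teichmüller points as C_a, which multiplies the index c by `a`, and
on the constants as a Frobenius power, which shifts s. Thus all conjugates of the Gauss sum lie in
one two-parameter family. -/
theorem sigma_smul_gaussConj (hn : n.Monic) (hm : 0 < m) [P.IsPrime]
    (hnP : algebraMap F[X] _ n ∉ P) {c : F[X]}
    (hc : ∀ y : integers (cycField F n) ⧸ P, carlitz F _ (n * c) y = 0)
    (ψ : (integers (cycField F n) ⧸ P) ≃ₐ[F] constField F m) {a : F[X]} (ha : IsCoprime a n)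
    (s t : ℕ) : sigma n m a t • gaussConj P ψ c s = gaussConj P ψ (a * c) (s + t) := by
  rw [gaussConj, smul_add, smul_one, Finset.smul_sum, gaussConj]
  congr 1
  refine Finset.sum_congr rfl fun z _ => ?_
  rw [smul_mul', smul_pow', sigma_smul_torsion hn hm ha t (teichPoint_mem_torsion hn hnP hc ψ _),
    carlitz_teichPoint hn hnP hc, sigma_smul_constIncl hn hm ha, ← pow_mul, ← pow_add, add_comm t]

theorem gaussConj_congr (hm : 0 < m) (ψ : (integers (cycField F n) ⧸ P) ≃ₐ[F] constField F m)
    (c : F[X]) {s t : ℕ} (hst : s ≡ t [MOD m]) : gaussConj P ψ c s = gaussConj P ψ c t := by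
  rw [gaussConj, gaussConj]
  congr 1
  refine Finset.sum_congr rfl fun z _ => ?_
  rw [← map_pow, ← map_pow, pow_card_pow_eq_of_modEq hst
    (Subtype.ext ((mem_constField_iff hm).mp (z : constField F m).2))]

theorem num_eq_of_mul_eq (hn0 : n ≠ 0) {a u h : F[X]} (hu : u = n * h) :
    (algebraMap F[X] (RatFunc F) a / algebraMap F[X] (RatFunc F) n *
      algebraMap F[X] (RatFunc F) u).num = a * h := by
  have h0 : algebraMap F[X] (RatFunc F) n ≠ 0 := by simpa using hn0
  have : algebraMap F[X] (RatFunc F) a / algebraMap F[X] (RatFunc F) n *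
      algebraMap F[X] (RatFunc F) u = algebraMap F[X] (RatFunc F) (a * h) := by
    rw [hu, map_mul, map_mul]
    field_simp
  rw [this, RatFunc.num_algebraMap]

end GaussConj

/-! ### The Gauss sum as a member of the family -/

section GaussSumEq

variable {F : Type*} [Field F] [Fintype F] {n v : F[X]} {l : ℕ}
  [Fintype (constField F (v.natDegree * l))] [DecidableEq (constField F (v.natDegree * l))]

theorem coe_mul_pow_one {K : IntermediateField (RatFunc F) (kbar F)} (w c : integers K) (Q : ℕ) :
    ((w * c ^ Q ^ 0 : integers K) : K) = w * c := by
  rw [pow_zero, pow_one]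
  rfl

theorem finsum_units_mapEquiv {A E M : Type*} [Monoid A] [Monoid E] [AddCommMonoid M] [Fintype Eˣ]
    (e : A ≃* E) (f : A → E → M) : ∑ᶠ z : Aˣ, f (z⁻¹ : Aˣ) (e z) =
      ∑ w : Eˣ, f (e.symm (w⁻¹ : Eˣ)) w := by
  rw [← finsum_eq_sum_of_fintype]
  refine finsum_eq_of_bijective (Units.mapEquiv e) (MulEquiv.bijective _) fun z => ?_
  rw [← map_inv, Units.coe_mapEquiv, Units.coe_mapEquiv, e.symm_apply_apply]

theorem gaussSum_eq_gaussConj (hn0 : n ≠ 0) (P : Ideal (integers (cycField F n)))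
    (ψ : (integers (cycField F n) ⧸ P) ≃ₐ[F] constField F (v.natDegree * l)) (a : F[X]) {h : F[X]}
    (hh : v ^ l - 1 = n * h) :
    gaussSum P v l ψ (algebraMap F[X] (RatFunc F) a / algebraMap F[X] (RatFunc F) n) =
      (gaussConj P ψ (a * h) 0 : compField F n (v.natDegree * l)) := by
  rw [gaussSum, num_eq_of_mul_eq hn0 hh, gaussConj, AddMemClass.coe_add, OneMemClass.coe_one,
    AddSubmonoidClass.coe_finsetSum]
  simp only [coe_mul_pow_one, teichPoint]
  congr 1
  exact finsum_units_mapEquiv ψ.toMulEquiv fun z w =>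
    (integersIncl n (v.natDegree * l) (teichmuller P (carlitz F _ (a * h) z)) :
      compField F n (v.natDegree * l)) * (constIncl n (v.natDegree * l) w :
        compField F n (v.natDegree * l))

end GaussSumEq

/-! ### From divisibility to equality by norms -/

section NormBound

variable {F : Type*} [Field F] [Fintype F]
variable {O : Type*} [CommRing O] [IsDedekindDomain O] [Algebra F[X] O]
  [Module.Finite F[X] O] [Module.IsTorsionFree F[X] O]

theorem natDegree_mul_inertiaDeg {v : F[X]} (hv0 : v ≠ 0) (hvirr : Irreducible v) {I : Ideal O}
    [I.IsMaximal] [I.LiesOver (Ideal.span {v})] {m : ℕ}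
    (hcard : Nat.card (O ⧸ I) = Fintype.card F ^ m) :
    v.natDegree * I.inertiaDeg F[X] = m := by
  have hmax : (Ideal.span {v}).IsMaximal := PrincipalIdealRing.isMaximal_of_irreducible hvirr
  obtain ⟨h1, h2⟩ := natCard_quotient_span hv0
  have : Finite (O ⧸ I) := finite_quotient_of_liesOver (Ideal.span {v}) I
  let : Field (F[X] ⧸ Ideal.span {v}) := Ideal.Quotient.field _
  have h3 := Module.natCard_eq_pow_finrank (K := F[X] ⧸ Ideal.span {v}) (V := O ⧸ I)
  rw [← Ideal.inertiaDeg_eq_of_isMaximal, hcard, h2, ← pow_mul] at h3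
  exact (Nat.pow_right_injective Fintype.one_lt_card h3).symm

variable {G : Type*} [Group G] [Finite G] [MulSemiringAction G O] [IsGaloisGroup G F[X] O]

attribute [local instance] FractionRing.liftAlgebra

theorem isGalois_fractionRing (G : Type*) [Group G] [Finite G] [MulSemiringAction G O]
    [IsGaloisGroup G F[X] O] : IsGalois (FractionRing F[X]) (FractionRing O) := by
  let := IsFractionRing.mulSemiringAction G O (FractionRing O)
  have := IsGaloisGroup.to_isFractionRing_of_isIntegral G F[X] O (FractionRing F[X])
    (FractionRing O)
  exact IsGaloisGroup.isGalois G _ _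

/-- Each conjugate of `I` has norm (v ^ f) with deg v * f = m, so the product has norm of degree m *
|S|, the largest degree allowed for the norm of x. The cofactor then has norm 1 and is the unit
ideal. -/
theorem span_eq_of_dvd {v : F[X]} (hv : v.Monic) (hvirr : Irreducible v) {I : Ideal O}
    [I.IsMaximal] [I.LiesOver (Ideal.span {v})] {m : ℕ}
    (hcard : Nat.card (O ⧸ I) = Fintype.card F ^ m) {S : Finset F[X]} {σ : F[X] → G} {x : O}
    (hx : x ≠ 0) (hdvd : ∏ a ∈ S, (σ a)⁻¹ • I ∣ Ideal.span {x})
    (hdeg : ∀ f : F[X], f ≠ 0 → algebraMap F[X] O f = ∏ᶠ g : G, g • x → f.natDegree ≤ m * S.card) :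
    Ideal.span {x} = ∏ a ∈ S, (σ a)⁻¹ • I := by
  have := isGalois_fractionRing (F := F) (O := O) G
  have hfin : FiniteDimensional (FractionRing F[X]) (FractionRing O) :=
    .of_isLocalization F[X] O F[X]⁰
  have hmax : (Ideal.span {v}).IsMaximal := PrincipalIdealRing.isMaximal_of_irreducible hvirr
  have : SMulCommClass G F[X] O := (inferInstance : IsGaloisGroup G F[X] O).commutes
  obtain ⟨J, hJ⟩ := hdvd
  set f := Algebra.intNorm F[X] O x with hf
  have hf0 : f ≠ 0 := Algebra.intNorm_ne_zero.mpr hx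
  have h1 := congrArg (Ideal.relNorm F[X]) hJ
  rw [map_mul, map_prod, Ideal.relNorm_singleton, ← hf] at h1
  have h2 (a : F[X]) : Ideal.relNorm F[X] ((σ a)⁻¹ • I) = Ideal.span {v ^ I.inertiaDeg F[X]} := by
    rw [Ideal.relNorm_smul, Ideal.relNorm_eq_pow_of_isPrime_isGalois I (Ideal.span {v}),
      Ideal.span_singleton_pow]
  simp only [h2] at h1
  rw [Finset.prod_const, Ideal.span_singleton_pow, ← pow_mul] at h1
  have h3 : v ^ (I.inertiaDeg F[X] * S.card) ∣ f := by
    rw [← Ideal.span_singleton_dvd_span_singleton_iff_dvd]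
    exact Dvd.intro _ h1.symm
  have h4 : algebraMap F[X] O f = ∏ᶠ g : G, g • x := by
    cases nonempty_fintype G
    rw [hf, Algebra.algebraMap_intNorm_of_isGalois, finprod_eq_prod_of_fintype]
    refine (Fintype.prod_equiv (IsGaloisGroup.mulEquivAlgEquiv G F[X] O).toEquiv _ _ ?_).symm
    intro g
    rfl
  have h5 := hdeg f hf0 h4
  have h6 : Associated (v ^ (I.inertiaDeg F[X] * S.card)) f := by
    have h7 := natDegree_mul_inertiaDeg hv.ne_zero hvirr hcard
    rw [← h7, mul_assoc, mul_comm, ← hv.natDegree_pow] at h5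
    clear_value f
    exact associated_of_dvd_of_natDegree_le h3 hf0 h5
  have h7 : Ideal.relNorm F[X] J = 1 := by
    rw [← Ideal.span_singleton_eq_span_singleton.mpr h6] at h1
    refine mul_left_cancel₀ (a := Ideal.span {v ^ (I.inertiaDeg F[X] * S.card)}) ?_ ?_
    · rw [Ne, Ideal.zero_eq_bot, Ideal.span_singleton_eq_bot]
      exact pow_ne_zero _ hv.ne_zero
    · rw [← h1, mul_one]
  have h8 : J = 1 := by
    rw [Ideal.one_eq_top, Ideal.eq_top_iff_one, ← map_one (algebraMap F[X] O), ← Ideal.mem_comap]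
    refine Ideal.relNorm_le_comap F[X] J ?_
    rw [h7]
    exact Submodule.one_le.mp le_rfl
  rw [hJ, h8, mul_one]

end NormBound

/-! ### The prime above `P` and the divisibility n ∣ v ^ l - 1 -/

section PrimeAbove

variable {F : Type*} [Field F]

theorem algebraMap_mem_iff_of_liesOver {R : Type*} [CommRing R] [Algebra F[X] R] {v : F[X]}
    (P : Ideal R) [h : P.LiesOver (Ideal.span {v})] (f : F[X]) :
    algebraMap F[X] R f ∈ P ↔ v ∣ f := by
  rw [← Ideal.mem_span_singleton, h.over]
  rfl

variable [Fintype F] {n v : F[X]} {m : ℕ} {P : Ideal (integers (cycField F n))}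

theorem primeAbove_spec (hn : n.Monic) (hm : 0 < m)
    (ψ : (integers (cycField F n) ⧸ P) ≃ₐ[F] constField F m) :
    (primeAbove P ψ).IsMaximal ∧ (primeAbove P ψ).comap (integersIncl n m) = P ∧
      (∀ x, ∃ c, x - constIncl n m c ∈ primeAbove P ψ) ∧
      Nat.card (integers (compField F n m) ⧸ primeAbove P ψ) = Fintype.card F ^ m := by
  obtain ⟨χ, h1, h2, h3⟩ := exists_residue_primeAbove hn hm P ψ
  have hχ : Function.Surjective χ := fun c => ⟨_, h1 c⟩
  refine ⟨?_, ?_, fun x => ⟨χ x, ?_⟩, ?_⟩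
  · rw [h3]
    exact RingHom.ker_isMaximal_of_surjective χ hχ
  · ext x
    rw [Ideal.mem_comap, h3, RingHom.mem_ker, h2, EmbeddingLike.map_eq_zero_iff,
      Ideal.Quotient.eq_zero_iff_mem]
  · rw [h3, RingHom.mem_ker, map_sub, h1, sub_self]
  · rw [h3, Nat.card_congr (Ideal.quotientKerAlgEquivOfSurjective hχ).toEquiv,
      natCard_constField hm]

theorem liesOver_primeAbove (hn : n.Monic) (hm : 0 < m) [h : P.LiesOver (Ideal.span {v})]
    (ψ : (integers (cycField F n) ⧸ P) ≃ₐ[F] constField F m) :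
    (primeAbove P ψ).LiesOver (Ideal.span {v}) := by
  constructor
  ext f
  rw [h.over]
  nth_rw 1 [← (primeAbove_spec hn hm ψ).2.1]
  rw [Ideal.under_def, Ideal.under_def, Ideal.mem_comap, Ideal.mem_comap, Ideal.mem_comap,
    AlgHom.commutes]

/-- The isomorphism ψ fixes the size of the residue field, on which C_(v ^ l) is therefore the
identity. Hence v ^ l - 1 annihilates the reduced torsion and n divides it; the quotient is the base
index of all Gauss sums. -/
theorem exists_pow_sub_one_eq (hv : v.Monic) (hvirr : Irreducible v) (hn : n.Monic)
    (hvn : IsCoprime v n) [P.IsPrime] [h : P.LiesOver (Ideal.span {v})] {l : ℕ}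
    (hm : 0 < v.natDegree * l) (hml : m = v.natDegree * l)
    (ψ : (integers (cycField F n) ⧸ P) ≃ₐ[F] constField F m) :
    algebraMap F[X] _ n ∉ P ∧ ∃ h, v ^ l - 1 = n * h ∧ h.Monic ∧ n.natDegree + h.natDegree = m ∧
      ∀ y : integers (cycField F n) ⧸ P, carlitz F _ (n * h) y = 0 := by
  have hnP : algebraMap F[X] _ n ∉ P := by
    rw [algebraMap_mem_iff_of_liesOver (v := v) P]
    exact fun h => hvirr.not_isUnit (hvn.isUnit_of_dvd' dvd_rfl h)
  have h1 (y : integers (cycField F n) ⧸ P) : carlitz F _ (v ^ l - 1) y = 0 := by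
    refine carlitz_pow_sub_one_eq_zero hv hvirr ?_ (fun y => ?_) y
    · exact Ideal.Quotient.eq_zero_iff_mem.mpr
        ((algebraMap_mem_iff_of_liesOver (v := v) P v).mpr dvd_rfl)
    · apply ψ.injective
      rw [map_pow, ← hml]
      exact Subtype.ext ((mem_constField_iff (hml ▸ hm)).mp (ψ y).2)
  obtain ⟨h, hh⟩ := dvd_of_carlitz_quotient_eq_zero hn
    (ncard_torsion_integers hn (torsion_subset_cycField n)) hnP h1
  have hdeg : (1 : F[X]).degree < (v ^ l).degree := by
    rw [degree_one, ← natDegree_pos_iff_degree_pos, hv.natDegree_pow, mul_comm]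
    exact hm
  have h2 : (n * h).Monic := by
    rw [← hh]
    exact (hv.pow l).sub_of_left hdeg
  have h3 : h.Monic := hn.of_mul_monic_left h2
  refine ⟨hnP, h, hh, h3, ?_, fun y => by rw [← hh, h1]⟩
  rw [← hn.natDegree_mul h3, ← hh, natDegree_sub_eq_left_of_natDegree_lt, hv.natDegree_pow,
    mul_comm, hml]
  exact natDegree_lt_natDegree one_ne_zero hdeg

end PrimeAbove

/-! ### Nonvanishing of Gauss sums -/

section Nonzero

variable {F : Type*} [Field F] [Fintype F] {n : F[X]} {m : ℕ}

/-- Otherwise g would be a nonzero constant, and the torsion equation n * g + g ^ q = 0 would make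
the linear polynomial n a constant, hence fixed by the q ^ m-th power. -/
theorem mul_constIncl_ne_neg_one (hn : n.Monic) (hn1 : n.natDegree = 1) (hm : 0 < m)
    {g : integers (compField F n m)} (hg : g ∈ torsion F (integers (compField F n m)) n)
    (e : constField F m) : 1 + g * constIncl n m e ≠ 0 := by
  intro h
  have he : e ≠ 0 := by
    rintro rfl
    rw [map_zero, mul_zero, add_zero] at h
    exact one_ne_zero h
  have h1 : g = constIncl n m (-e⁻¹) := by
    have h2 : constIncl n m e * constIncl n m e⁻¹ = 1 := by
      rw [← map_mul, mul_inv_cancel₀ he, map_one]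
    rw [map_neg]
    linear_combination constIncl n m e⁻¹ * h - g * h2
  rw [mem_torsion, carlitz_eq_sum n g (B := 2) (by lia), Finset.sum_range_succ,
    Finset.sum_range_one, carlitzCoeff_zero] at hg
  have h2 : carlitzCoeff n 1 = 1 := by
    rw [← hn1, carlitzCoeff_natDegree, hn.leadingCoeff, C_1]
  rw [h2, map_one, one_mul, pow_zero, pow_one, pow_one, h1] at hg
  have h3 : algebraMap F[X] (integers (compField F n m)) n =
      constIncl n m ((-e⁻¹) ^ Fintype.card F * e) := by
    have h4 : constIncl n m (-e⁻¹) * constIncl n m e = -1 := by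
      rw [← map_mul, neg_mul, inv_mul_cancel₀ he, map_neg, map_one]
    rw [map_mul, map_pow]
    linear_combination algebraMap F[X] (integers (compField F n m)) n * h4 -
      constIncl n m e * hg
  have h5 : n ^ Fintype.card F ^ m = n := by
    apply algebraMap_integers_injective (compField F n m)
    rw [map_pow, h3, ← map_pow]
    congr 1
    exact Subtype.ext ((mem_constField_iff hm).mp (SetLike.coe_mem _))
  have h6 := congrArg natDegree h5
  rw [hn.natDegree_pow, hn1, mul_one] at h6
  have := one_lt_card_pow (F := F) hm
  lia

variable [Fintype (constField F m)] [DecidableEq (constField F m)]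
  {P : Ideal (integers (cycField F n))} {v : F[X]}

/-- For deg n = 1 the Carlitz action on torsion factors through F[θ] / n = F, so all torsion points
are `F`-multiples of one generator, which can be taken out of the sum. -/
theorem gaussConj_eq_one_add_mul (hn : n.Monic) (hn1 : n.natDegree = 1) [P.IsPrime]
    (hnP : algebraMap F[X] _ n ∉ P) {c : F[X]}
    (hc : ∀ y : integers (cycField F n) ⧸ P, carlitz F _ (n * c) y = 0)
    (ψ : (integers (cycField F n) ⧸ P) ≃ₐ[F] constField F m) (s : ℕ) :
    ∃ g ∈ torsion F (integers (compField F n m)) n, ∃ e,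
      gaussConj P ψ c s = 1 + g * constIncl n m e := by
  obtain ⟨g, hg, -, hgen⟩ := exists_torsion_generator hn
    (ncard_torsion_integers hn (torsion_subset_compField n m))
  have h1 (z : constField F m) : ∃ b : F, teichPoint P ψ c z = g * constIncl n m (algebraMap F _ b) := by
    obtain ⟨a, ha⟩ := hgen _ (teichPoint_mem_torsion hn hnP hc ψ z)
    have hlt : (a %ₘ n).natDegree < 1 := by
      rw [← hn1]
      exact natDegree_modByMonic_lt a hn (by rintro rfl; simp at hn1)
    refine ⟨(a %ₘ n).coeff 0, ?_⟩
    rw [ha, AlgHom.commutes, mul_comm, ← carlitz_C, ← eq_C_of_natDegree_le_zero (Nat.le_of_lt_succ hlt)]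
    refine carlitz_eq_of_dvd_sub ?_ hg
    rw [modByMonic_eq_sub_mul_div, sub_sub_cancel]
    exact dvd_mul_right _ _
  choose b hb using h1
  refine ⟨g, hg, ∑ z : (constField F m)ˣ,
    algebraMap F _ (b (z⁻¹ : (constField F m)ˣ)) * (z : constField F m) ^ Fintype.card F ^ s, ?_⟩
  rw [gaussConj, map_sum, Finset.mul_sum]
  congr 1
  refine Finset.sum_congr rfl fun z _ => ?_
  rw [hb, map_mul, map_pow, mul_assoc]

end Nonzero

/-! ### Factorization of the base Gauss sum -/

section Factorization

variable {F : Type*} [Field F] [Fintype F] {n v : F[X]} {m : ℕ}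
  [Fintype (constField F m)] [DecidableEq (constField F m)] {P : Ideal (integers (cycField F n))}

theorem isIntegral_constIncl (n : F[X]) (m : ℕ) (c : constField F m) :
    IsIntegral F (constIncl n m c : compField F n m) :=
  isIntegral_of_coe_mem_constField (coe_constIncl_mem n m c)

/-- At a place above infinity each conjugate has size at most |θ| ^ (1 / (q - 1)); multiplying over
the Galois group and inserting the bound on its order cancels q - 1. -/
theorem natDegree_le_of_prod_smul_gaussConj (hn : n.Monic) (hn0 : 0 < n.natDegree) (hm : 0 < m)
    [P.IsPrime] (hnP : algebraMap F[X] _ n ∉ P) {c : F[X]}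
    (hc : ∀ y : integers (cycField F n) ⧸ P, carlitz F _ (n * c) y = 0)
    (ψ : (integers (cycField F n) ⧸ P) ≃ₐ[F] constField F m) (s : ℕ) {f : F[X]} (hf : f ≠ 0)
    (hprod : algebraMap F[X] (integers (compField F n m)) f =
      ∏ᶠ σ : Gal(compField F n m/RatFunc F), σ • gaussConj P ψ c s) :
    f.natDegree ≤ m * (monicCoprime F n).card := by
  obtain ⟨_, _⟩ := isGalois_compField hn hm
  cases nonempty_fintype Gal(compField F n m/RatFunc F)
  rw [finprod_eq_prod_of_fintype] at hprod
  have hinj : Function.Injective (algebraMap F[X] (compField F n m)) :=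
    Subtype.val_injective.comp (algebraMap_integers_injective (compField F n m))
  obtain ⟨B, hB, hθ⟩ := exists_valuationSubring_infty hinj
  have h := natDegree_mul_le_of_prod_eq hB hθ hn
    (g := fun σ : Gal(compField F n m/RatFunc F) => σ (gaussConj P ψ c s : compField F n m))
    (Finset.univ : Finset (constField F m)ˣ)
    (fun σ z => σ (teichPoint P ψ c (z⁻¹ : (constField F m)ˣ) : compField F n m))
    (fun σ z => σ (constIncl n m z : compField F n m) ^ Fintype.card F ^ s)
    (fun σ z _ => ?_) (fun σ z _ => ?_) (fun σ => ?_) hf ?_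
  · have h2 := natCard_gal_compField_le hn hn0 hm
    rw [Nat.card_eq_fintype_card] at h2
    have h3 := h.trans h2
    rw [mul_comm (Fintype.card F - 1), ← mul_assoc] at h3
    exact Nat.le_of_mul_le_mul_right h3 (Nat.sub_pos_of_lt Fintype.one_lt_card)
  · exact torsion_map (σ.toAlgHom.restrictScalars F[X])
      ((coe_mem_torsion_integers_iff _).mpr (teichPoint_mem_torsion hn hnP hc ψ _))
  · exact ((isIntegral_constIncl n m z).map (σ.toAlgHom.restrictScalars F)).pow _
  · rw [gaussConj, AddMemClass.coe_add, OneMemClass.coe_one, AddSubmonoidClass.coe_finsetSum,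
      map_add, map_one, map_sum]
    congr 1
    refine Finset.sum_congr rfl fun z _ => ?_
    rw [MulMemClass.coe_mul, SubmonoidClass.coe_pow, map_mul, map_pow]
  · have h2 := congrArg (Subtype.val : integers (compField F n m) → compField F n m) hprod
    rw [SubmonoidClass.coe_finsetProd] at h2
    exact h2

theorem carlitz_mul_eq_zero {c : F[X]}
    (hc : ∀ y : integers (cycField F n) ⧸ P, carlitz F _ (n * c) y = 0) (a : F[X])
    (y : integers (cycField F n) ⧸ P) : carlitz F _ (n * (a * c)) y = 0 := by
  rw [mul_left_comm, carlitz_mul, hc, map_zero]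

theorem carlitz_pow_teichPoint (hn : n.Monic) [P.IsPrime] (hnP : algebraMap F[X] _ n ∉ P)
    {c : F[X]} (hc : ∀ y : integers (cycField F n) ⧸ P, carlitz F _ (n * c) y = 0)
    (ψ : (integers (cycField F n) ⧸ P) ≃ₐ[F] constField F m) {l : ℕ} (hnv : n ∣ v ^ l - 1)
    (z : constField F m) : carlitz F _ (v ^ l) (teichPoint P ψ c z) = teichPoint P ψ c z := by
  rw [carlitz_eq_of_dvd_sub hnv (teichPoint_mem_torsion hn hnP hc ψ z), carlitz_one]

theorem gaussConj_mem_pow (hv : v.Monic) (hvirr : Irreducible v) (hn : n.Monic) (hm : 0 < m)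
    [P.IsPrime] [P.LiesOver (Ideal.span {v})] (hnP : algebraMap F[X] _ n ∉ P) {c : F[X]}
    (hc : ∀ y : integers (cycField F n) ⧸ P, carlitz F _ (n * c) y = 0)
    (ψ : (integers (cycField F n) ⧸ P) ≃ₐ[F] constField F m) {l : ℕ} (hml : m = v.natDegree * l)
    (hnv : n ∣ v ^ l - 1) (hcm : c.Monic) (hcdeg : c.natDegree < m) :
    gaussConj P ψ c c.natDegree ∈ primeAbove P ψ ^ (l - c.natDegree / v.natDegree) := by
  have := liesOver_primeAbove (v := v) hn hm ψ
  have h := gauss_sum_mem_pow (constIncl n m : constField F m →+* integers (compField F n m))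
    (card_constField hm) hv hvirr (I := primeAbove P ψ)
    ((algebraMap_mem_iff_of_liesOver (v := v) _ v).mpr dvd_rfl) hml hcm (teichPoint P ψ c)
    (carlitz_pow_teichPoint hn hnP hc ψ hnv)
    (fun z => by
      rw [RingHom.coe_coe]
      exact teichPoint_sub_mem hn hm hnP hc ψ z) hcdeg
  simp only [RingHom.coe_coe] at h
  exact h

theorem gaussConj_sub_one_mem (hv : v.Monic) (hvirr : Irreducible v) (hn : n.Monic) (hm : 0 < m)
    [P.IsPrime] [P.LiesOver (Ideal.span {v})] (hnP : algebraMap F[X] _ n ∉ P) {c : F[X]}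
    (hc : ∀ y : integers (cycField F n) ⧸ P, carlitz F _ (n * c) y = 0)
    (ψ : (integers (cycField F n) ⧸ P) ≃ₐ[F] constField F m) {l : ℕ} (hml : m = v.natDegree * l)
    (hnv : n ∣ v ^ l - 1) {s : ℕ} (hs : s < m) (hcs : c.natDegree < s) :
    gaussConj P ψ c s - 1 ∈ primeAbove P ψ := by
  have := liesOver_primeAbove (v := v) hn hm ψ
  have h := gauss_sum_sub_one_mem (constIncl n m : constField F m →+* integers (compField F n m))
    (card_constField hm) hv hvirr (I := primeAbove P ψ)
    ((algebraMap_mem_iff_of_liesOver (v := v) _ v).mpr dvd_rfl) hml (teichPoint P ψ c)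
    (carlitz_pow_teichPoint hn hnP hc ψ hnv)
    (fun z => by
      rw [RingHom.coe_coe]
      exact teichPoint_sub_mem hn hm hnP hc ψ z) hs hcs
  simp only [RingHom.coe_coe] at h
  exact h

/-- For deg n ≥ 2, applying the Frobenius power σ_(1, deg n - 1) moves s = m - deg n to m - 1, above
deg c, and there the sum is ≡ 1 modulo the prime. For deg n = 1 that shift is trivial, and the sum
is excluded from being zero by its special form. -/
theorem gaussConj_ne_zero (hv : v.Monic) (hvirr : Irreducible v) (hn : n.Monic)
    (hn0 : 0 < n.natDegree) (hm : 0 < m)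
    [P.IsPrime] [P.LiesOver (Ideal.span {v})] (hnP : algebraMap F[X] _ n ∉ P) {c : F[X]}
    (ψ : (integers (cycField F n) ⧸ P) ≃ₐ[F] constField F m) {l : ℕ} (hml : m = v.natDegree * l)
    (hnv : n ∣ v ^ l - 1) (hcdeg : n.natDegree + c.natDegree = m) {s : ℕ}
    (hs : n.natDegree + s = m)
    (hc : ∀ y : integers (cycField F n) ⧸ P, carlitz F _ (n * c) y = 0) :
    gaussConj P ψ c s ≠ 0 := by
  rcases eq_or_lt_of_le (Nat.succ_le_of_lt hn0) with h1 | h1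
  · obtain ⟨g, hg, e, he⟩ := gaussConj_eq_one_add_mul hn h1.symm hnP hc ψ s
    rw [he]
    exact mul_constIncl_ne_neg_one hn h1.symm hm hg e
  · have h2 : m - 1 < m ∧ c.natDegree < m - 1 ∧ s + (n.natDegree - 1) = m - 1 := by
      clear hc hnP
      lia
    intro h0
    have h3 := gaussConj_sub_one_mem hv hvirr hn hm hnP hc ψ hml hnv h2.1 h2.2.1
    have h4 := sigma_smul_gaussConj hn hm hnP hc ψ isCoprime_one_left s (n.natDegree - 1)
    rw [h0, smul_zero, one_mul, h2.2.2] at h4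
    rw [← h4, zero_sub, neg_mem_iff] at h3
    exact (primeAbove_spec hn hm ψ).1.ne_top ((Ideal.eq_top_iff_one _).mpr h3)

/-- The exponent m - deg n equals deg c, so σ_(a, deg a) carries the sum to the pair (a * c, deg (a
* c)), exactly where the leading coefficient cancels the 1, simultaneously for every `a` in the
index set. -/
theorem span_gaussConj (hv : v.Monic) (hvirr : Irreducible v) (hn : n.Monic)
    (hvn : IsCoprime v n) (hn0 : 0 < n.natDegree) (hm : 0 < m)
    [P.IsPrime] [P.LiesOver (Ideal.span {v})] (hnP : algebraMap F[X] _ n ∉ P) {c : F[X]}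
    (ψ : (integers (cycField F n) ⧸ P) ≃ₐ[F] constField F m) {l : ℕ} (hml : m = v.natDegree * l)
    (hnv : n ∣ v ^ l - 1) (hcm : c.Monic) (hcdeg : n.natDegree + c.natDegree = m)
    (hc : ∀ y : integers (cycField F n) ⧸ P, carlitz F _ (n * c) y = 0) :
    Ideal.span {gaussConj P ψ c (m - n.natDegree)} =
      ∏ a ∈ monicCoprime F n, (sigma n m a a.natDegree)⁻¹ • primeAbove P ψ := by
  obtain ⟨_, _⟩ := isGalois_compField hn hm
  obtain ⟨hmax, -, hE, hcard⟩ := primeAbove_spec hn hm ψ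
  have := liesOver_primeAbove (v := v) hn hm ψ
  have := isDedekindDomain_integers (compField F n m)
  have := finite_integers (compField F n m)
  have := isGaloisGroup_integers (compField F n m)
  have : Module.IsTorsionFree F[X] (integers (compField F n m)) :=
    Module.isTorsionFree_iff_algebraMap_injective.mpr (algebraMap_integers_injective _)
  refine span_eq_of_dvd hv hvirr hcard ?_ ?_ ?_
  · refine gaussConj_ne_zero hv hvirr hn hn0 hm hnP ψ hml hnv hcdeg ?_ hc
    rw [← hcdeg, Nat.add_sub_cancel_left]
  · refine prod_smul_dvd_span (constIncl n m : constField F m →+* integers (compField F n m))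
      (card_constField hm) hv hvirr hn hvn
      (ncard_torsion_integers hn (torsion_subset_compField n m))
      (algebraMap_mem_iff_of_liesOver (v := v) _) hE hm
      (fun a ha => ⟨(mem_monicCoprime.mp ha).1, (mem_monicCoprime.mp ha).2.1⟩)
      (fun a ha z hz => sigma_smul_torsion hn hm (mem_monicCoprime.mp ha).2.2 _ hz)
      (fun a ha e => ?_) (fun a ha => ?_)
    · rw [RingHom.coe_coe]
      exact sigma_smul_constIncl hn hm (mem_monicCoprime.mp ha).2.2 _ e
    · obtain ⟨h1, h2, h3⟩ := mem_monicCoprime.mp ha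
      have h4 : (a * c).natDegree = m - n.natDegree + a.natDegree := by
        rw [h1.natDegree_mul hcm, ← hcdeg, Nat.add_sub_cancel_left, add_comm]
      have h5 : a.natDegree < n.natDegree := natDegree_lt_natDegree h1.ne_zero h2
      have h6 : (a * c).natDegree < m := by
        rw [h4]
        clear hc hnP
        lia
      -- With this exponent e, rounding down gives d * e ≥ m - deg (a * c) = deg n - deg a.
      refine ⟨l - (a * c).natDegree / v.natDegree, ?_, ?_⟩
      · rw [Nat.mul_sub, ← hml]
        have := Nat.mul_div_le (a * c).natDegree v.natDegree
        rw [h4] at this ⊢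
        clear hc hnP hE hcard
        lia
      · rw [sigma_smul_gaussConj hn hm hnP hc ψ h3, ← h4]
        exact gaussConj_mem_pow hv hvirr hn hm hnP (carlitz_mul_eq_zero hc a) ψ hml hnv
          (h1.mul hcm) h6
  · intro f hf hprod
    exact natDegree_le_of_prod_smul_gaussConj hn hn0 hm hnP hc ψ _ hf hprod

end Factorization

/-! ### Powers of ideals by group ring elements -/

section IdealPow

variable {F : Type*} [Field F] [Fintype F] {K : IntermediateField (RatFunc F) (kbar F)}
  [IsDedekindDomain (integers K)]

theorem pow_toNat_div_pow_toNat {M : Type*} [GroupWithZero M] {x : M} (hx : x ≠ 0) (e : ℤ) :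
    x ^ e.toNat / x ^ (-e).toNat = x ^ e := by
  rw [← zpow_natCast, ← zpow_natCast, ← zpow_sub₀ hx, Int.toNat_sub_toNat_neg]

theorem smul_ideal_ne_zero {G R : Type*} [Group G] [CommRing R] [MulSemiringAction G R]
    {I : Ideal R} (hI : I ≠ 0) (g : G) : g • I ≠ 0 := by
  intro h
  apply hI
  rw [← inv_smul_smul g I, h]
  exact smul_zero _

/-- For a nonzero ideal the quotient of the two truncated powers is an integral power in the group
of fractional ideals, so exponents add even when distinct indices give the same automorphism. -/
theorem idealPow_add {I : Ideal (integers K)} (hI : I ≠ 0)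
    (η₁ η₂ : MonoidAlgebra ℤ Gal(K/RatFunc F)) :
    idealPow I (η₁ + η₂) = idealPow I η₁ * idealPow I η₂ := by
  classical
  have h (σ : Gal(K/RatFunc F)) :
      ((σ • I : Ideal (integers K)) : FractionalIdeal (integers K)⁰ K) ≠ 0 :=
    FractionalIdeal.coeIdeal_ne_zero.mpr (smul_ideal_ne_zero hI σ)
  simp only [idealPow, pow_toNat_div_pow_toNat (h _)]
  rw [MonoidAlgebra.coeff_add]
  exact Finsupp.prod_add_index' (fun σ => zpow_zero _) fun σ a b => zpow_add₀ (h σ) a b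

theorem idealPow_single (I : Ideal (integers K)) (σ : Gal(K/RatFunc F)) :
    idealPow I (MonoidAlgebra.single σ 1) = ((σ • I : Ideal (integers K)) : FractionalIdeal _ K) := by
  rw [idealPow, MonoidAlgebra.coeff_single, Finsupp.prod_single_index] <;> simp

theorem idealPow_sum {I : Ideal (integers K)} (hI : I ≠ 0) {ι : Type*} (S : Finset ι)
    (σ : ι → Gal(K/RatFunc F)) : idealPow I (∑ a ∈ S, MonoidAlgebra.single (σ a) 1) =
      ((∏ a ∈ S, σ a • I : Ideal (integers K)) : FractionalIdeal _ K) := by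
  classical
  induction S using Finset.induction_on with
  | empty => simp [idealPow]
  | insert a S ha ih =>
    rw [Finset.sum_insert ha, Finset.prod_insert ha, idealPow_add hI, ih, idealPow_single,
      FractionalIdeal.coeIdeal_mul]

theorem spanSingleton_eq_idealPow {I : Ideal (integers K)} (hI : I ≠ 0) {ι : Type*} (S : Finset ι)
    (τ : Gal(K/RatFunc F)) (σ : ι → Gal(K/RatFunc F)) {x : integers K}
    (hx : Ideal.span {x} = ∏ a ∈ S, (τ * σ a) • I) :
    FractionalIdeal.spanSingleton _ (x : K) =
      idealPow I (MonoidAlgebra.single τ 1 * ∑ a ∈ S, MonoidAlgebra.single (σ a) 1) := by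
  simp only [Finset.mul_sum, MonoidAlgebra.single_mul_single, mul_one]
  rw [idealPow_sum hI, ← hx, FractionalIdeal.coeIdeal_span_singleton]
  rfl

end IdealPow

theorem span_smul_eq {G R ι : Type*} [Group G] [CommRing R] [MulSemiringAction G R] (g : G)
    {x : R} {S : Finset ι} {J : ι → Ideal R} (h : Ideal.span {x} = ∏ a ∈ S, J a) :
    Ideal.span {g • x} = ∏ a ∈ S, g • J a := by
  rw [← Finset.smul_prod', ← h, Ideal.pointwise_smul_def, Ideal.map_span, Set.image_singleton]
  rfl

/-! ### Ideals in a constant field extension -/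

section ConstantExtensionIdeals

variable {F : Type*} [Field F] [Fintype F] {E : Type*} [Field E] [Fintype E] [DecidableEq E]
variable {A O : Type*} [CommRing A] [CommRing O] {G : Type*} [Group G] [MulSemiringAction G O]
variable [Algebra F E] [Algebra F O]
variable {i : A →+* O} {ι : E →ₐ[F] O} {m : ℕ} {g : G}

theorem eq_neg_sum_inv_mul_sum_smul (hm : 0 < m) (hE : Fintype.card E = Fintype.card F ^ m)
    (hι : ∀ c, g • ι c = ι c ^ Fintype.card F) (y : O) :
    y = -∑ z : Eˣ, ι (z⁻¹ : Eˣ) * ∑ s ∈ Finset.range m, g ^ s • (ι z * y) := by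
  have h := eq_neg_sum_inv_mul_sum_iterate (τ := MulSemiringAction.toRingHom G O g) hm hE hι y
  simp only [smul_iterate] at h
  exact h

theorem exists_map_eq_sum_smul (hgm : g ^ m = 1) (hfix : ∀ y, g • y = y → ∃ x, i x = y) (y : O) :
    ∃ x, i x = ∑ s ∈ Finset.range m, g ^ s • y := by
  refine hfix _ ?_
  have h := map_sum_iterate (m := m) (τ := MulSemiringAction.toRingHom G O g)
    (fun y => by rw [smul_iterate, hgm, one_smul]) y
  simp only [smul_iterate] at h
  exact h

theorem pow_smul_map (hi : ∀ x, g • i x = i x) (s : ℕ) (x : A) : g ^ s • i x = i x := by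
  induction s with
  | zero => rw [pow_zero, one_smul]
  | succ s ih => rw [pow_succ, mul_smul, hi, ih]

theorem pow_smul_const (hι : ∀ c, g • ι c = ι c ^ Fintype.card F) (s : ℕ) (c : E) :
    g ^ s • ι c = ι c ^ Fintype.card F ^ s := by
  have h := iterate_const (τ := MulSemiringAction.toRingHom G O g) hι s c
  rwa [smul_iterate] at h

/-- The trace is linear over the base ring, so it maps the extension of `I` into `I`. The arbitrary
factor w absorbs the coefficients in the induction over the span. -/
theorem exists_sum_smul_eq_map_of_mem_map (hgm : g ^ m = 1) (hi : ∀ x, g • i x = i x)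
    (hfix : ∀ y, g • y = y → ∃ x, i x = y) {I : Ideal A} {y : O} (hy : y ∈ I.map i) (w : O) :
    ∃ x ∈ I, ∑ s ∈ Finset.range m, g ^ s • (w * y) = i x := by
  induction hy using Submodule.span_induction generalizing w with
  | mem y hy =>
    obtain ⟨x, hx, rfl⟩ := hy
    obtain ⟨x', hx'⟩ := exists_map_eq_sum_smul hgm hfix w
    refine ⟨x' * x, I.mul_mem_left _ hx, ?_⟩
    rw [map_mul, hx', Finset.sum_mul]
    simp only [smul_mul', pow_smul_map hi]
  | zero => exact ⟨0, I.zero_mem, by simp⟩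
  | add y y' _ _ h h' =>
    obtain ⟨x, hx, e⟩ := h w
    obtain ⟨x', hx', e'⟩ := h' w
    refine ⟨x + x', I.add_mem hx hx', ?_⟩
    rw [map_add, ← e, ← e', ← Finset.sum_add_distrib]
    simp only [mul_add, smul_add]
  | smul c y _ h =>
    obtain ⟨x, hx, e⟩ := h (w * c)
    refine ⟨x, hx, ?_⟩
    rw [← e, smul_eq_mul, mul_assoc]

/-- Some constant z has nonzero trace t, by the trace identity for y = 1. If x lies in the extended
ideal, the trace of z * x is t * x and lies in `I`, and t is invertible. -/
theorem comap_map_eq_of_constant_extension [IsDomain A] (hinj : Function.Injective i) (hm : 0 < m)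
    (hE : Fintype.card E = Fintype.card F ^ m) (hgm : g ^ m = 1) (hi : ∀ x, g • i x = i x)
    (hι : ∀ c, g • ι c = ι c ^ Fintype.card F)
    (hfix : ∀ y, g • y = y → ∃ x, i x = y) (I : Ideal A) : (I.map i).comap i = I := by
  refine le_antisymm (fun x hx => ?_) Ideal.le_comap_map
  have h1 : ∃ z : E, ∑ s ∈ Finset.range m, g ^ s • ι z ≠ 0 := by
    by_contra! h
    have h2 := eq_neg_sum_inv_mul_sum_smul hm hE hι 1
    simp only [mul_one, h, mul_zero, Finset.sum_const_zero, neg_zero] at h2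
    exact one_ne_zero (hinj (by rw [map_one, h2, map_zero]) : (1 : A) = 0)
  obtain ⟨z, hz⟩ := h1
  obtain ⟨t, ht⟩ := exists_map_eq_sum_smul hgm hfix (ι z)
  obtain ⟨r, hr, hr2⟩ := exists_sum_smul_eq_map_of_mem_map hgm hi hfix hx (ι z)
  have h3 : t * x = r := by
    apply hinj
    rw [← hr2, map_mul, ht, Finset.sum_mul]
    simp only [smul_mul', pow_smul_map hi]
  -- On a trace of a constant the q-th power agrees with g, which fixes traces. Hence t, being
  -- nonzero in a domain, satisfies t ^ (q - 1) = 1.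
  have h4 : t ^ Fintype.card F = t := by
    apply hinj
    have h5 : (∑ s ∈ Finset.range m, g ^ s • ι z) ^ Fintype.card F =
        g • ∑ s ∈ Finset.range m, g ^ s • ι z := by
      rw [Finset.smul_sum, ← FiniteField.frobeniusAlgHom_apply (K := F), map_sum]
      refine Finset.sum_congr rfl fun s _ => ?_
      rw [FiniteField.frobeniusAlgHom_apply, pow_smul_const hι, smul_pow', hι, ← pow_mul,
        ← pow_mul, mul_comm]
    rw [map_pow, ht, h5, ← ht, hi]
  have ht0 : t ≠ 0 := by
    rintro rfl
    rw [map_zero] at ht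
    exact hz ht.symm
  have h6 : t ^ (Fintype.card F - 1) = 1 := by
    refine mul_right_cancel₀ ht0 ?_
    rw [← pow_succ, Nat.sub_add_cancel Fintype.card_pos, h4, one_mul]
  have h7 : t ^ (Fintype.card F - 1 - 1) * (t * x) = x := by
    rw [← mul_assoc, ← pow_succ, Nat.sub_add_cancel
      (Nat.sub_pos_of_lt Fintype.one_lt_card), h6, one_mul]
  rw [← h7, h3]
  exact I.mul_mem_left _ hr

/-- The conjugates of `J` are distinct because a constant moved by a Frobenius power has another
residue, so their product is their intersection and contains the extension of `I`. Conversely, for y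
in all of them the traces of z * y lie in `J` and in the base ring, hence in `I`, and the trace
identity rebuilds y from them. -/
theorem map_eq_prod_pow_smul (hm : 0 < m) (hE : Fintype.card E = Fintype.card F ^ m)
    (hgm : g ^ m = 1) (hi : ∀ x, g • i x = i x) (hι : ∀ c, g • ι c = ι c ^ Fintype.card F)
    (hfix : ∀ y, g • y = y → ∃ x, i x = y) {I : Ideal A} {J : Ideal O} [J.IsMaximal]
    (hJ : J.comap i = I) (hJE : ∀ c, ∃ x, i x - ι c ∈ J)
    (hdist : ∀ r, 0 < r → r < m → ∃ c : E, c ^ Fintype.card F ^ r ≠ c) :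
    I.map i = ∏ s ∈ Finset.range m, g ^ s • J := by
  have hmem (y : O) (hy : ∀ s < m, y ∈ g ^ s • J) (s : ℕ) (hs : s < m) : g ^ s • y ∈ J := by
    rcases Nat.eq_zero_or_pos s with rfl | h0
    · simpa using hy 0 hm
    · have h1 := hy (m - s) (Nat.sub_lt hm h0)
      rw [Ideal.mem_pointwise_smul_iff_inv_smul_mem] at h1
      convert h1 using 2
      rw [eq_inv_iff_mul_eq_one, ← pow_add, Nat.add_sub_cancel' hs.le, hgm]
  refine le_antisymm ?_ fun y hy => ?_
  · have hmax (s : ℕ) : (g ^ s • J).IsMaximal := by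
      rw [Ideal.pointwise_smul_eq_comap]
      exact Ideal.comap_isMaximal_of_equiv _
    rw [Ideal.prod_eq_iInf_of_pairwise_isCoprime]
    · refine le_iInf₂ fun s _ => Ideal.map_le_iff_le_comap.mpr fun x hx => ?_
      rw [Ideal.mem_comap, ← pow_smul_map hi s x, Ideal.smul_mem_pointwise_smul_iff,
        ← Ideal.mem_comap, hJ]
      exact hx
    · have hlt : ∀ s t, s < t → t < m → g ^ s • J ≠ g ^ t • J := by
        intro s t hst htm h
        obtain ⟨c, hc⟩ := hdist (t - s) (Nat.sub_pos_of_lt hst) ((Nat.sub_le _ _).trans_lt htm)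
        obtain ⟨x, hx⟩ := hJE c
        have h1 : g ^ (t - s) • J = J := by
          rw [← Nat.add_sub_cancel' hst.le, pow_add, mul_smul] at h
          simpa using h.symm
        have h2 := Ideal.smul_mem_pointwise_smul (g ^ (t - s)) _ J hx
        rw [h1, smul_sub, pow_smul_map hi, pow_smul_const hι] at h2
        have h3 := J.sub_mem hx h2
        rw [sub_sub_sub_cancel_left, ← map_pow, ← map_sub] at h3
        have h4 := J.mul_mem_left (ι (c ^ Fintype.card F ^ (t - s) - c)⁻¹) h3
        rw [← map_mul, inv_mul_cancel₀ (sub_ne_zero.mpr hc), map_one] at h4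
        exact (‹J.IsMaximal›).ne_top ((Ideal.eq_top_iff_one J).mpr h4)
      intro s hs t ht hst
      refine Ideal.isCoprime_of_isMaximal ?_
      rcases lt_or_gt_of_ne hst with h | h
      · exact hlt s t h (Finset.mem_range.mp ht)
      · exact (hlt t s h (Finset.mem_range.mp hs)).symm
  · have hy' (s : ℕ) (hs : s < m) : y ∈ g ^ s • J :=
      Finset.inf_le (f := fun s => g ^ s • J) (Finset.mem_range.mpr hs) (Ideal.prod_le_inf hy)
    rw [eq_neg_sum_inv_mul_sum_smul hm hE hι y]
    refine neg_mem (Ideal.sum_mem _ fun z _ => Ideal.mul_mem_left _ _ ?_)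
    obtain ⟨x, hx⟩ := exists_map_eq_sum_smul hgm hfix (ι z * y)
    rw [← hx]
    refine Ideal.mem_map_of_mem i ?_
    rw [← hJ, Ideal.mem_comap, hx]
    refine Ideal.sum_mem _ fun s hs => ?_
    rw [smul_mul']
    exact J.mul_mem_left _ (hmem y hy' s (Finset.mem_range.mp hs))

end ConstantExtensionIdeals

/-! ### The action of a group on ideals -/

section PointwiseIdeal

variable {G R : Type*} [Group G] [CommRing R] [MulSemiringAction G R]

theorem ideal_mul_smul (g h : G) (I : Ideal R) : (g * h) • I = g • h • I :=
  mul_smul g h I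

theorem ideal_smul_inv_smul (g : G) (I : Ideal R) : g • g⁻¹ • I = I :=
  smul_inv_smul g I

theorem ideal_inv_smul_smul (g : G) (I : Ideal R) : g⁻¹ • g • I = I :=
  inv_smul_smul g I

theorem ideal_smul_prod {ι : Type*} (g : G) (S : Finset ι) (J : ι → Ideal R) :
    ∏ a ∈ S, g • J a = g • ∏ a ∈ S, J a :=
  Finset.smul_prod'.symm

end PointwiseIdeal

/-! ### Descent from K_(n,m) to K_n -/

section Descent

variable {F : Type*} [Field F] [Fintype F] {n v : F[X]} {m : ℕ}

/-- The inclusion of the ring of integers of `K_n` in that of `K_{n,m}`, as a ring homomorphism. -/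
def inclHom (n : F[X]) (m : ℕ) : integers (cycField F n) →+* integers (compField F n m) :=
  (integersIncl n m : integers (cycField F n) →+* integers (compField F n m))

theorem inclHom_apply (x : integers (cycField F n)) : inclHom n m x = integersIncl n m x := by
  rw [inclHom, RingHom.coe_coe]

theorem sigma_smul_inclHom (hn : n.Monic) (hm : 0 < m) {a : F[X]} (ha : IsCoprime a n) (s : ℕ)
    (x : integers (cycField F n)) :
    sigma n m a s • inclHom n m x = inclHom n m (rho n a • x) := by
  rw [inclHom_apply, inclHom_apply, sigma_smul_integersIncl hn hm ha]

theorem sigma_one_one_smul_inclHom (hn : n.Monic) (hm : 0 < m) (x : integers (cycField F n)) :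
    sigma n m 1 1 • inclHom n m x = inclHom n m x := by
  rw [sigma_smul_inclHom hn hm isCoprime_one_left, rho_one hn, one_smul]

theorem exists_inclHom_eq (hn : n.Monic) (hm : 0 < m) (y : integers (compField F n m))
    (hy : sigma n m 1 1 • y = y) : ∃ x, inclHom n m x = y := by
  obtain ⟨x, hx⟩ := exists_integersIncl_eq hn hm hy
  exact ⟨x, by rw [inclHom_apply, hx]⟩

theorem inclHom_injective (n : F[X]) (m : ℕ) : Function.Injective (inclHom n m) := by
  intro x y h
  rw [inclHom_apply, inclHom_apply] at h
  exact integersIncl_injective n m h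

theorem sigma_one_one_smul_constIncl (hn : n.Monic) (hm : 0 < m) (c : constField F m) :
    sigma n m 1 1 • constIncl n m c = constIncl n m c ^ Fintype.card F := by
  rw [sigma_smul_constIncl hn hm isCoprime_one_left, pow_one]

/-- Otherwise the field with q ^ m elements would lie in the one with q ^ r elements. This separates
the τ_q-conjugates of the prime. -/
theorem exists_pow_ne {r : ℕ} (hr : 0 < r) (hrm : r < m) :
    ∃ c : constField F m, c ^ Fintype.card F ^ r ≠ c := by
  by_contra! h
  have hle : constField F m ≤ constField F r := fun c hc =>
    (mem_constField_iff hr).mpr (congrArg Subtype.val (h ⟨c, hc⟩))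
  have := finite_constField (F := F) hr
  have h1 := Nat.card_le_card_of_injective _ (IntermediateField.inclusion_injective hle)
  rw [natCard_constField (hr.trans hrm), natCard_constField hr] at h1
  exact absurd h1 (not_le_of_gt (Nat.pow_lt_pow_right Fintype.one_lt_card hrm))

theorem comap_map_inclHom (hn : n.Monic) (hm : 0 < m) (I : Ideal (integers (cycField F n))) :
    (I.map (inclHom n m)).comap (inclHom n m) = I := by
  classical
  have := finite_constField (F := F) hm
  have := Fintype.ofFinite (constField F m)
  exact comap_map_eq_of_constant_extension (inclHom_injective n m) hm (card_constField hm)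
    (sigma_one_one_pow_eq_one hn hm) (sigma_one_one_smul_inclHom hn hm)
    (sigma_one_one_smul_constIncl hn hm) (exists_inclHom_eq hn hm) I

theorem map_inclHom_eq_prod (hn : n.Monic) (hm : 0 < m) (P : Ideal (integers (cycField F n)))
    (ψ : (integers (cycField F n) ⧸ P) ≃ₐ[F] constField F m) :
    P.map (inclHom n m) = ∏ s ∈ Finset.range m, sigma n m 1 1 ^ s • primeAbove P ψ := by
  classical
  have := finite_constField (F := F) hm
  have := Fintype.ofFinite (constField F m)
  obtain ⟨hmax, hP, -⟩ := primeAbove_spec hn hm ψ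
  refine map_eq_prod_pow_smul hm (card_constField hm)
    (sigma_one_one_pow_eq_one hn hm) (sigma_one_one_smul_inclHom hn hm)
    (sigma_one_one_smul_constIncl hn hm) (exists_inclHom_eq hn hm) hP (fun c => ?_)
    fun r => exists_pow_ne
  obtain ⟨χ, h1, h2, h3⟩ := exists_residue_primeAbove hn hm P ψ
  obtain ⟨x, hx⟩ := Ideal.Quotient.mk_surjective (ψ.symm c)
  refine ⟨x, ?_⟩
  rw [h3, RingHom.mem_ker, map_sub, inclHom_apply, h1, h2, hx, AlgEquiv.apply_symm_apply, sub_self]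

theorem sigma_smul_map (hn : n.Monic) (hm : 0 < m) {a : F[X]} (ha : IsCoprime a n) (s : ℕ)
    (I : Ideal (integers (cycField F n))) :
    sigma n m a s • I.map (inclHom n m) = (rho n a • I).map (inclHom n m) := by
  rw [Ideal.pointwise_smul_def, Ideal.pointwise_smul_def, Ideal.map_map, Ideal.map_map]
  congr 1
  ext1 x
  exact sigma_smul_inclHom hn hm ha s x

theorem sigma_inv_smul_map (hn : n.Monic) (hm : 0 < m) {a : F[X]} (ha : IsCoprime a n) (s : ℕ)
    (I : Ideal (integers (cycField F n))) :
    (sigma n m a s)⁻¹ • I.map (inclHom n m) = ((rho n a)⁻¹ • I).map (inclHom n m) := by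
  have h := sigma_smul_map hn hm ha s ((rho n a)⁻¹ • I)
  rw [ideal_smul_inv_smul] at h
  rw [← h, ideal_inv_smul_smul]

theorem commute_sigma (hn : n.Monic) (hm : 0 < m) {a : F[X]} (ha : IsCoprime a n) (s : ℕ) :
    Commute (sigma n m 1 1) (sigma n m a s) := by
  rw [Commute, SemiconjBy, sigma_mul hn hm isCoprime_one_left ha,
    sigma_mul hn hm ha isCoprime_one_left, one_mul, mul_one, add_comm]

theorem coe_prod_pow_smul {K : IntermediateField (RatFunc F) (kbar F)} (σ : Gal(K/RatFunc F))
    (y : integers K) (m : ℕ) : ((∏ s ∈ Finset.range m, σ ^ s • y : integers K) : K) =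
      ∏ s ∈ Finset.range m, (σ ^ s) (y : K) := by
  rw [SubmonoidClass.coe_finsetProd]
  rfl

theorem smul_prod_range_pow_smul {G M : Type*} [Group G] [CommMonoid M] [MulDistribMulAction G M]
    {g : G} {m : ℕ} (hgm : g ^ m = 1) (y : M) :
    g • ∏ s ∈ Finset.range m, g ^ s • y = ∏ s ∈ Finset.range m, g ^ s • y := by
  rw [Finset.smul_prod']
  simp only [smul_smul, ← pow_succ']
  cases m with
  | zero => rfl
  | succ m => rw [Finset.prod_range_succ, hgm, Finset.prod_range_succ' , pow_zero]

theorem span_pow_smul_eq (hn : n.Monic) (hm : 0 < m) {S : Finset F[X]}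
    (hS : ∀ a ∈ S, IsCoprime a n) {s₀ : ℕ} {s : F[X] → ℕ} {a₀ : F[X]} (ha₀ : IsCoprime a₀ n)
    {y : integers (compField F n m)} {J : Ideal (integers (compField F n m))}
    (hy : Ideal.span {y} = ∏ a ∈ S, (sigma n m a₀ s₀ * (sigma n m a (s a))⁻¹) • J) (t : ℕ) :
    Ideal.span {sigma n m 1 1 ^ t • y} =
      ∏ a ∈ S, (sigma n m a₀ s₀ * (sigma n m a (s a))⁻¹) • sigma n m 1 1 ^ t • J := by
  rw [span_smul_eq _ hy]
  refine Finset.prod_congr rfl fun a ha => ?_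
  rw [← ideal_mul_smul, ← ideal_mul_smul]
  congr 1
  exact (((commute_sigma hn hm ha₀ s₀).mul_right
    (commute_sigma hn hm (hS a ha) (s a)).inv_right).pow_left t).eq

theorem sigma_mul_inv_smul_map (hn : n.Monic) (hm : 0 < m) {a b : F[X]} (ha : IsCoprime a n)
    (hb : IsCoprime b n) (s t : ℕ) (I : Ideal (integers (cycField F n))) :
    (sigma n m a s * (sigma n m b t)⁻¹) • I.map (inclHom n m) =
      ((rho n a * (rho n b)⁻¹) • I).map (inclHom n m) := by
  rw [ideal_mul_smul, ideal_mul_smul, sigma_inv_smul_map hn hm hb, sigma_smul_map hn hm ha]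

theorem map_prod_smul_eq (hn : n.Monic) (hm : 0 < m) {S : Finset F[X]}
    (hS : ∀ a ∈ S, IsCoprime a n) (s₀ : ℕ) (s : F[X] → ℕ) {a₀ : F[X]} (ha₀ : IsCoprime a₀ n)
    (P : Ideal (integers (cycField F n)))
    (ψ : (integers (cycField F n) ⧸ P) ≃ₐ[F] constField F m) :
    (∏ a ∈ S, (rho n a₀ * (rho n a)⁻¹) • P).map (inclHom n m) =
      ∏ a ∈ S, (sigma n m a₀ s₀ * (sigma n m a (s a))⁻¹) •
        ∏ t ∈ Finset.range m, sigma n m 1 1 ^ t • primeAbove P ψ := by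
  rw [← map_inclHom_eq_prod hn hm P ψ, ← Ideal.mapHom_apply, map_prod]
  refine Finset.prod_congr rfl fun a ha => ?_
  rw [Ideal.mapHom_apply, sigma_mul_inv_smul_map hn hm ha₀ (hS a ha)]

/-- The product over the powers of τ_q is fixed by τ_q, so it comes from O_n. After extension to
O_(n,m) the two ideals agree, since τ_q commutes with all σ_(a,s) and the conjugates of the prime
multiply to the extension of P; extended ideals contract back to themselves. -/
theorem exists_span_eq_prod_smul (hn : n.Monic) (hm : 0 < m) {P : Ideal (integers (cycField F n))}
    (ψ : (integers (cycField F n) ⧸ P) ≃ₐ[F] constField F m) {S : Finset F[X]}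
    (hS : ∀ a ∈ S, IsCoprime a n) {s₀ : ℕ} {s : F[X] → ℕ} {a₀ : F[X]} (ha₀ : IsCoprime a₀ n)
    {y : integers (compField F n m)}
    (hy : Ideal.span {y} = ∏ a ∈ S, (sigma n m a₀ s₀ * (sigma n m a (s a))⁻¹) • primeAbove P ψ) :
    ∃ x : integers (cycField F n),
      inclHom n m x = ∏ s ∈ Finset.range m, sigma n m 1 1 ^ s • y ∧
      Ideal.span {x} = ∏ a ∈ S, (rho n a₀ * (rho n a)⁻¹) • P := by
  obtain ⟨x, hx⟩ := exists_inclHom_eq hn hm (∏ s ∈ Finset.range m, sigma n m 1 1 ^ s • y)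
    (smul_prod_range_pow_smul (sigma_one_one_pow_eq_one hn hm) y)
  refine ⟨x, hx, ?_⟩
  suffices h : (Ideal.span {x}).map (inclHom n m) =
      (∏ a ∈ S, (rho n a₀ * (rho n a)⁻¹) • P).map (inclHom n m) by
    rw [← comap_map_inclHom hn hm (Ideal.span {x}), h, comap_map_inclHom hn hm]
  rw [Ideal.map_span, Set.image_singleton, hx, ← Ideal.prod_span_singleton,
    map_prod_smul_eq hn hm hS s₀ s ha₀ P ψ,
    Finset.prod_congr rfl fun t _ => span_pow_smul_eq hn hm hS ha₀ hy t, Finset.prod_comm]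
  exact Finset.prod_congr rfl fun a _ => ideal_smul_prod _ _ _

end Descent

/-! ### The factorization of the Gauss sum -/

section Main

variable {F : Type*} [Field F] [Fintype F] {n v : F[X]} {m : ℕ}
  [Fintype (constField F m)] [DecidableEq (constField F m)] {P : Ideal (integers (cycField F n))}

/-- Applying σ_(a₀, deg n) to the base sum brings the Frobenius exponent m - deg n to m, which is 0
on the constant field; this is where deg n enters the twist. -/
theorem span_gaussConj_zero (hv : v.Monic) (hvirr : Irreducible v) (hn : n.Monic)
    (hvn : IsCoprime v n) (hn0 : 0 < n.natDegree) (hm : 0 < m)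
    [P.IsPrime] [P.LiesOver (Ideal.span {v})] (hnP : algebraMap F[X] _ n ∉ P) {c : F[X]}
    (ψ : (integers (cycField F n) ⧸ P) ≃ₐ[F] constField F m) {l : ℕ} (hml : m = v.natDegree * l)
    (hnv : n ∣ v ^ l - 1) (hcm : c.Monic) (hcdeg : n.natDegree + c.natDegree = m)
    (hc : ∀ y : integers (cycField F n) ⧸ P, carlitz F _ (n * c) y = 0) {a₀ : F[X]}
    (ha₀ : IsCoprime a₀ n) :
    Ideal.span {gaussConj P ψ (a₀ * c) 0} = ∏ a ∈ monicCoprime F n,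
      (sigma n m a₀ n.natDegree * (sigma n m a a.natDegree)⁻¹) • primeAbove P ψ := by
  have h := sigma_smul_gaussConj hn hm hnP hc ψ ha₀ (m - n.natDegree) n.natDegree
  have h1 : m - n.natDegree + n.natDegree ≡ 0 [MOD m] := by
    rw [Nat.sub_add_cancel (hcdeg ▸ Nat.le_add_right _ _)]
    exact (Nat.modEq_zero_iff_dvd).mpr dvd_rfl
  rw [gaussConj_congr hm ψ _ h1] at h
  rw [← h, span_smul_eq _
    (span_gaussConj hv hvirr hn hvn hn0 hm hnP ψ hml hnv hcm hcdeg hc)]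
  exact Finset.prod_congr rfl fun a _ => (ideal_mul_smul _ _ _).symm

end Main

end GeometricGauss

end

theorem mainTheorem3 (F : Type*) [Field F] [Fintype F]
    (v n : F[X]) (hv : v.Monic) (hvirr : Irreducible v) (hn : n.Monic) (hvn : IsCoprime v n)
    (P : Ideal (GeometricGauss.integers (GeometricGauss.cycField F n)))
    (hP : P.IsPrime) (hPv : P.LiesOver (Ideal.span {v}))
    (l : ℕ) (hl : l = P.inertiaDeg F[X])
    (ψ : (GeometricGauss.integers (GeometricGauss.cycField F n) ⧸ P) ≃ₐ[F]
      GeometricGauss.constField F (v.natDegree * l))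
    (x : RatFunc F)
    (hx0 : 0 < GeometricGauss.inftyAbs F x) (hx1 : GeometricGauss.inftyAbs F x < 1)
    (a₀ : F[X]) (ha₀ : a₀.degree < n.degree) (ha₀n : IsCoprime a₀ n)
    (hx : x = algebraMap F[X] (RatFunc F) a₀ / algebraMap F[X] (RatFunc F) n) :
    ((GeometricGauss.primeAbove P ψ).IsPrime ∧ (GeometricGauss.primeAbove P ψ).comap
        (GeometricGauss.integersIncl n (v.natDegree * l)) = P) ∧
    FractionalIdeal.spanSingleton _ (GeometricGauss.gaussSum P v l ψ x) =
      GeometricGauss.idealPow (GeometricGauss.primeAbove P ψ)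
        (MonoidAlgebra.single (GeometricGauss.sigma n (v.natDegree * l) a₀ n.natDegree) 1 *
          GeometricGauss.etaComp n (v.natDegree * l)) ∧
    ∃ g : GeometricGauss.cycField F n,
      IntermediateField.inclusion
          (GeometricGauss.cycField_le_compField n (v.natDegree * l)) g =
        GeometricGauss.frobMonomial (GeometricGauss.gaussSum P v l ψ x) ∧
      FractionalIdeal.spanSingleton _ g =
        GeometricGauss.idealPow P
          (MonoidAlgebra.single (GeometricGauss.rho n a₀) 1 * GeometricGauss.etaCyc n) := by
  classical
  subst hx
  have ha0 : a₀ ≠ 0 := by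
    rintro rfl
    simp [GeometricGauss.inftyAbs] at hx0
  have hn0 : 0 < n.natDegree :=
    (Nat.zero_le _).trans_lt (natDegree_lt_natDegree ha0 ha₀)
  obtain ⟨_, _⟩ := GeometricGauss.isGalois_cycField hn
  have := GeometricGauss.isDedekindDomain_integers (GeometricGauss.cycField F n)
  have := GeometricGauss.finite_integers (GeometricGauss.cycField F n)
  -- Only the positivity of the residue degree is drawn from its definition; its value is already
  -- encoded in the target of ψ.
  have hm : 0 < v.natDegree * l :=
    Nat.mul_pos hvirr.natDegree_pos (hl ▸ Ideal.inertiaDeg_pos P F[X])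
  obtain ⟨_, _⟩ := GeometricGauss.isGalois_compField hn hm
  have := GeometricGauss.isDedekindDomain_integers
    (GeometricGauss.compField F n (v.natDegree * l))
  have := GeometricGauss.finite_constField (F := F) hm
  have := Fintype.ofFinite (GeometricGauss.constField F (v.natDegree * l))
  obtain ⟨hnP, c, hnc, hcm, hcdeg, hc⟩ :=
    GeometricGauss.exists_pow_sub_one_eq hv hvirr hn hvn hm rfl ψ
  obtain ⟨hmax, hcomap, -⟩ := GeometricGauss.primeAbove_spec hn hm ψ
  have hspan := GeometricGauss.span_gaussConj_zero hv hvirr hn hvn hn0 hm hnP ψ rfl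
    (Dvd.intro _ hnc.symm) hcm hcdeg hc ha₀n
  obtain ⟨g, hg, hgspan⟩ := GeometricGauss.exists_span_eq_prod_smul hn hm ψ
    (fun a ha => (GeometricGauss.mem_monicCoprime.mp ha).2.2) ha₀n hspan
  rw [GeometricGauss.gaussSum_eq_gaussConj hn.ne_zero P ψ a₀ hnc]
  -- Both primes contain the nonzero element v, so they are nonzero ideals, and exponents from the
  -- group ring can be added.
  have hv0 (K : IntermediateField (RatFunc F) (GeometricGauss.kbar F)) :
      algebraMap F[X] (GeometricGauss.integers K) v ≠ 0 := fun h =>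
    hv.ne_zero (GeometricGauss.algebraMap_integers_injective K (h.trans (map_zero _).symm))
  have hP0 : P ≠ 0 := by
    intro h
    have h1 := (GeometricGauss.algebraMap_mem_iff_of_liesOver (v := v) P v).mpr dvd_rfl
    rw [h] at h1
    exact hv0 _ h1
  have := GeometricGauss.liesOver_primeAbove (v := v) hn hm ψ
  have hPP0 : GeometricGauss.primeAbove P ψ ≠ 0 := by
    intro h
    have h1 := (GeometricGauss.algebraMap_mem_iff_of_liesOver (v := v)
      (GeometricGauss.primeAbove P ψ) v).mpr dvd_rfl
    rw [h] at h1
    exact hv0 _ h1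
  refine ⟨⟨hmax.isPrime, hcomap⟩, GeometricGauss.spanSingleton_eq_idealPow hPP0 _ _ _ hspan,
    g, ?_, GeometricGauss.spanSingleton_eq_idealPow hP0 _ _ _ hgspan⟩
  have h := congrArg (Subtype.val : GeometricGauss.integers
    (GeometricGauss.compField F n (v.natDegree * l)) → _) hg
  rw [GeometricGauss.coe_prod_pow_smul, GeometricGauss.inclHom_apply] at h
  exact h
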